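/- Let $d\in\{2,3\}$, let $\Omega\subset\mathbb{R}^d$ be a bounded domain with Lipschitz boundary, and let $\partial\Omega_D\subset\partial\Omega$ be a measurable (Dirichlet) part of the boundary. Let $A\in L^\infty(\Omega)^{d\times d}$ be symmetric with $\alpha|\xi|^2\le A(x)\xi\cdot\xi\le\beta|\xi|^2$ for all $\xi\in\mathbb{R}^d$ and a.e. $x\in\Omega$, where $0<\alpha<\beta<\infty$. Let $\omega\subset\omega^*\subset\Omega$, where $\omega^*$ is a domain with Lipschitz boundary, $\omega$ is a nonempty open set with Lipschitz boundary, and $\partial\omega^*\cap\partial\Omega_D$ has positive $(d-1)$-dimensional measure. Let $\chi:\Omega\to[0,1]$ be continuous, equal to $0$ on $\Omega\setminus\omega$, and $C^1$ with bounded gradient on $\omega$. For $U\in\{\omega,\omega^*\}$ put $a_U(u,v)=\int_U A\nabla u\cdot\nabla v\,dx$ and $\|u\|_{a,U}=a_U(u,u)^{1/2}$. With boundary values in the sense of traces, let $$H^1_{0D}(U)=\{v\in H^1(U): v=0\text{ on }(\partial U\cap\Omega)\cup(\partial U\cap\partial\Omega_D)\},$$ $$H^0_{A,D}(\omega^*)=\{u\in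 H^1(\omega^*): a_{\omega^*}(u,v)=0\ \ \forall v\in H^1_{0D}(\omega^*),\ \ u=0\text{ on }\partial\omega^*\cap\partial\Omega_D\}.$$ Then $Pu=\chi u|_\omega$ defines a compact linear operator $P:H^0_{A,D}(\omega^*)\to H^1_{0D}(\omega)$, and $\|\cdot\|_{a,\omega^*}$ is equivalent to the $H^1$ norm on $H^0_{A,D}(\omega^*)$. Consider the eigenvalue problem: find $\lambda\in\mathbb{R}$ and $0\ne v\in H^0_{A,D}(\omega^*)$ with $$a_{\omega^*}(v,\varphi)=\lambda\,a_\omega(\chi v,\chi\varphi)=\lambda\int_\omega (A\nabla\chi\cdot\nabla\chi)\,v\varphi\,dx\qquad\forall\varphi\in H^0_{A,D}(\omega^*)$$ (the second equality holds for all $v,\varphi\in H^0_{A,D}(\omega^*)$). All eigenvalues are positive, and they can be listed, repeated according to multiplicity, as $\lambda_1\le\lambda_2\le\cdots$ (a list of some length $N\in\{0,1,2,\dots\}\cup\{\infty\}$) with linearly independent eigenfunctions $v_1,v_2,\dots$ such that every eigenfunction for an eigenvalue $\lambda$ is a linear combination of the $v_k$ with $\lambda_k=\lambda$. If $N<\infty$,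 put $\lambda_k=\infty$ and $\lambda_k^{-1/2}=0$ for $k>N$. For every such list and every integer $n\ge 0$, the $n$-width $$d_n(\omega,\omega^*)=\inf_{\substack{Q\subset H^1_{0D}(\omega)\\ \dim Q=n}}\ \sup_{0\ne u\in H^0_{A,D}(\omega^*)}\ \inf_{v\in Q}\frac{\|Pu-v\|_{a,\omega}}{\|u\|_{a,\omega^*}}$$ satisfies $d_n(\omega,\omega^*)=\lambda_{n+1}^{-1/2}$; and if $n\le N$, the space $\hat Q(n)=\mathrm{span}\{\chi v_1,\dots,\chi v_n\}$ is $n$-dimensional and attains the infimum. -/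

import Mathlib

open MeasureTheory Filter Topology
open scoped ENNReal

namespace MSGFEM

noncomputable section

/-- Euclidean space `ℝ^d`. -/
abbrev E (d : ℕ) : Type := EuclideanSpace ℝ (Fin d)

/-! ### Lipschitz domains -/

/-- Near each boundary point, and in suitable Cartesian coordinates, `U` is the part of the space
strictly above the graph of a Lipschitz function. The height of `y` is `⟪ν, y⟫` for a unit vector `ν`,
and `y - ⟪ν, y⟫ ν` is its projection to the hyperplane orthogonal to `ν`. -/
def HasLipschitzBoundary {d : ℕ} (U : Set (E d)) : Prop :=
  ∀ x ∈ frontier U, ∃ (ν : E d) (K : NNReal) (g : E d → ℝ) (r : ℝ),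
    ‖ν‖ = 1 ∧ LipschitzWith K g ∧ 0 < r ∧
      ∀ y ∈ Metric.ball x r, y ∈ U ↔ g (y - inner ℝ ν y • ν) < inner ℝ ν y

/-- A bounded domain (open, connected, nonempty set) with Lipschitz boundary. -/
structure IsLipschitzDomain {d : ℕ} (U : Set (E d)) : Prop where
  isOpen : IsOpen U
  isConnected : IsConnected U
  isBounded : Bornology.IsBounded U
  lipschitz : HasLipschitzBoundary U

/-! ### The Sobolev space `H¹(U)` -/

/-- `L²(U) × L²(U; ℝ^d)` with its Hilbert norm. -/
abbrev L2Pair {d : ℕ} (U : Set (E d)) : Type :=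
  WithLp 2 (Lp ℝ 2 (volume.restrict U) × Lp (E d) 2 (volume.restrict U))

/-- The test functions `C_c^∞(U)`. -/
structure IsTestFunction {d : ℕ} (U : Set (E d)) (φ : E d → ℝ) : Prop where
  smooth : ContDiff ℝ (⊤ : ℕ∞) φ
  compact : HasCompactSupport φ
  support : tsupport φ ⊆ U

theorem IsTestFunction.memLp {d : ℕ} {U : Set (E d)} {φ : E d → ℝ} (h : IsTestFunction U φ) :
    MemLp φ 2 (volume.restrict U) :=
  (h.smooth.continuous.memLp_of_hasCompactSupport h.compact).restrict U

theorem IsTestFunction.gradient_memLp {d : ℕ} {U : Set (E d)} {φ : E d → ℝ}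
    (h : IsTestFunction U φ) : MemLp (gradient φ) 2 (volume.restrict U) := by
  have hc : Continuous (gradient φ) :=
    (InnerProductSpace.toDual ℝ (E d)).symm.continuous.comp (h.smooth.continuous_fderiv (by simp))
  have hs : HasCompactSupport (gradient φ) :=
    (h.compact.fderiv ℝ).comp_left (g := (InnerProductSpace.toDual ℝ (E d)).symm) (map_zero _)
  exact (hc.memLp_of_hasCompactSupport hs).restrict U

theorem integrable_smul_of_memLp {d : ℕ} {X : Type*} [MeasurableSpace X] {μ : Measure X} {f : X → ℝ}
    {g : X → E d} (hf : MemLp f 2 μ) (hg : MemLp g 2 μ) : Integrable (fun x => f x • g x) μ :=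
  memLp_one_iff_integrable.1 (hg.smul hf)

/-- `H¹(U)`, each `u` being stored together with its weak gradient: the pairs `(u, ∇u)` with
`u ∈ L²(U)`, `∇u ∈ L²(U; ℝ^d)` and `∫_U u ∇φ = - ∫_U φ ∇u` for all `φ ∈ C_c^∞(U)`. The norm inherited
from `L²(U) × L²(U; ℝ^d)` is the usual norm of `H¹(U)`. -/
def H1 {d : ℕ} (U : Set (E d)) : Submodule ℝ (L2Pair U) where
  carrier := {u | ∀ φ : E d → ℝ, IsTestFunction U φ →
    ∫ x in U, u.fst x • gradient φ x = - ∫ x in U, φ x • u.snd x}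
  zero_mem' := by
    intro φ _
    have h1 : (fun x => (0 : L2Pair U).fst x • gradient φ x) =ᵐ[volume.restrict U] fun _ => 0 := by
      filter_upwards [Lp.coeFn_zero ℝ 2 (volume.restrict U)] with x hx
      change ((0 : Lp ℝ 2 (volume.restrict U)) x) • gradient φ x = 0
      rw [hx]; simp
    have h2 : (fun x => φ x • (0 : L2Pair U).snd x) =ᵐ[volume.restrict U] fun _ => 0 := by
      filter_upwards [Lp.coeFn_zero (E d) 2 (volume.restrict U)] with x hx
      change φ x • ((0 : Lp (E d) 2 (volume.restrict U)) x) = 0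
      rw [hx]; simp
    rw [integral_congr_ae h1, integral_congr_ae h2]; simp
  add_mem' := by
    intro u v hu hv φ hφ
    have h1 : (fun x => (u + v).fst x • gradient φ x) =ᵐ[volume.restrict U]
        fun x => u.fst x • gradient φ x + v.fst x • gradient φ x := by
      filter_upwards [Lp.coeFn_add u.fst v.fst] with x hx
      change ((u.fst + v.fst : Lp ℝ 2 (volume.restrict U)) x) • gradient φ x = _
      rw [hx]; simp [add_smul]
    have h2 : (fun x => φ x • (u + v).snd x) =ᵐ[volume.restrict U]
        fun x => φ x • u.snd x + φ x • v.snd x := by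
      filter_upwards [Lp.coeFn_add u.snd v.snd] with x hx
      change φ x • ((u.snd + v.snd : Lp (E d) 2 (volume.restrict U)) x) = _
      rw [hx]; simp [smul_add]
    rw [integral_congr_ae h1, integral_congr_ae h2,
      integral_add (integrable_smul_of_memLp (Lp.memLp u.fst) hφ.gradient_memLp)
        (integrable_smul_of_memLp (Lp.memLp v.fst) hφ.gradient_memLp),
      integral_add (integrable_smul_of_memLp hφ.memLp (Lp.memLp u.snd))
        (integrable_smul_of_memLp hφ.memLp (Lp.memLp v.snd)), hu φ hφ, hv φ hφ]
    abel
  smul_mem' := by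
    intro c u hu φ hφ
    have h1 : (fun x => (c • u).fst x • gradient φ x) =ᵐ[volume.restrict U]
        fun x => c • (u.fst x • gradient φ x) := by
      filter_upwards [Lp.coeFn_smul c u.fst] with x hx
      change ((c • u.fst : Lp ℝ 2 (volume.restrict U)) x) • gradient φ x = _
      rw [hx]; simp [mul_smul]
    have h2 : (fun x => φ x • (c • u).snd x) =ᵐ[volume.restrict U]
        fun x => c • (φ x • u.snd x) := by
      filter_upwards [Lp.coeFn_smul c u.snd] with x hx
      change φ x • ((c • u.snd : Lp (E d) 2 (volume.restrict U)) x) = _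
      rw [hx, Pi.smul_apply, smul_comm]
    rw [integral_congr_ae h1, integral_congr_ae h2, integral_smul, integral_smul, hu φ hφ, smul_neg]

/-! ### Vanishing on a part of the boundary -/

/-- `u = 0` on `Γ` in the sense of traces: `u` is the `H¹(U)`-limit of smooth functions `φ_k` on `ℝ^d`
whose restrictions to `Γ` tend to `0` in `L²(Γ)` for the surface measure (the Hausdorff measure of
dimension `d - 1`). If `U` is bounded with Lipschitz boundary and `Γ ⊆ ∂U`, then, smooth functions
being dense in `H¹(U)` and the trace operator `γ : H¹(U) → L²(∂U)` being continuous, this says exactly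
that `γ u = 0` almost everywhere on `Γ`. -/
def HasZeroTrace {d : ℕ} (U Γ : Set (E d)) (u : L2Pair U) : Prop :=
  ∃ φ : ℕ → E d → ℝ, (∀ k, ContDiff ℝ (⊤ : ℕ∞) (φ k)) ∧
    Tendsto (fun k => eLpNorm (fun x => φ k x - u.fst x) 2 (volume.restrict U)) atTop (𝓝 0) ∧
    Tendsto (fun k => eLpNorm (fun x => gradient (φ k) x - u.snd x) 2 (volume.restrict U))
      atTop (𝓝 0) ∧
    Tendsto (fun k => eLpNorm (φ k) 2 ((Measure.hausdorffMeasure ((d : ℝ) - 1)).restrict Γ))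
      atTop (𝓝 0)

theorem continuous_gradient {d : ℕ} {φ : E d → ℝ} (h : ContDiff ℝ (⊤ : ℕ∞) φ) :
    Continuous (gradient φ) :=
  (InnerProductSpace.toDual ℝ (E d)).symm.continuous.comp (h.continuous_fderiv (by simp))

theorem gradient_add_apply {d : ℕ} {φ ψ : E d → ℝ} (hφ : ContDiff ℝ (⊤ : ℕ∞) φ) (hψ : ContDiff ℝ (⊤ : ℕ∞) ψ)
    (x : E d) : gradient (fun y => φ y + ψ y) x = gradient φ x + gradient ψ x := by
  have h1 : DifferentiableAt ℝ φ x := (hφ.differentiable (by simp)) x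
  have h2 : DifferentiableAt ℝ ψ x := (hψ.differentiable (by simp)) x
  simp only [gradient]
  rw [fderiv_fun_add h1 h2, map_add]

theorem gradient_smul_apply {d : ℕ} {φ : E d → ℝ} (hφ : ContDiff ℝ (⊤ : ℕ∞) φ) (c : ℝ) (x : E d) :
    gradient (fun y => c * φ y) x = c • gradient φ x := by
  have h1 : DifferentiableAt ℝ φ x := (hφ.differentiable (by simp)) x
  simp only [gradient]
  rw [fderiv_const_mul h1, map_smul]

theorem tendsto_eLpNorm_add {X F : Type*} [MeasurableSpace X] [NormedAddCommGroup F]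
    {μ : Measure X} {f g h : ℕ → X → F}
    (hf : ∀ k, AEStronglyMeasurable (f k) μ) (hg : ∀ k, AEStronglyMeasurable (g k) μ)
    (hfg : ∀ k, h k =ᵐ[μ] fun x => f k x + g k x)
    (h1 : Tendsto (fun k => eLpNorm (f k) 2 μ) atTop (𝓝 0))
    (h2 : Tendsto (fun k => eLpNorm (g k) 2 μ) atTop (𝓝 0)) :
    Tendsto (fun k => eLpNorm (h k) 2 μ) atTop (𝓝 0) := by
  refine tendsto_of_tendsto_of_tendsto_of_le_of_le tendsto_const_nhds
    (by simpa using h1.add h2) (fun _ => zero_le) (fun k => ?_)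
  rw [eLpNorm_congr_ae (hfg k)]
  exact eLpNorm_add_le (hf k) (hg k) (by norm_num)

theorem tendsto_eLpNorm_smul {X F : Type*} [MeasurableSpace X] [NormedAddCommGroup F]
    [NormedSpace ℝ F] {μ : Measure X} {f h : ℕ → X → F} (c : ℝ)
    (hfg : ∀ k, h k =ᵐ[μ] fun x => c • f k x)
    (h1 : Tendsto (fun k => eLpNorm (f k) 2 μ) atTop (𝓝 0)) :
    Tendsto (fun k => eLpNorm (h k) 2 μ) atTop (𝓝 0) := by
  have h3 : ∀ k, eLpNorm (h k) 2 μ = ‖c‖ₑ * eLpNorm (f k) 2 μ := by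
    intro k
    rw [eLpNorm_congr_ae (hfg k)]
    exact eLpNorm_const_smul c (f k) 2 μ
  simp only [h3]
  simpa using ENNReal.Tendsto.const_mul h1 (Or.inr (by simp))

/-- The functions of `H¹(U)` that vanish on `Γ` in the sense of traces. -/
def H1Zero {d : ℕ} (U Γ : Set (E d)) : Submodule ℝ (L2Pair U) where
  carrier := {u | u ∈ H1 U ∧ HasZeroTrace U Γ u}
  zero_mem' := by
    refine ⟨(H1 U).zero_mem, fun _ _ => 0, fun _ => contDiff_const, ?_, ?_, ?_⟩
    · have h : (fun x => (0 : ℝ) - (0 : L2Pair U).fst x) =ᵐ[volume.restrict U] fun _ => 0 := by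
        filter_upwards [Lp.coeFn_zero ℝ 2 (volume.restrict U)] with x hx
        change 0 - ((0 : Lp ℝ 2 (volume.restrict U)) x) = 0
        rw [hx]; simp
      simp only [eLpNorm_congr_ae h]
      simp
    · have h : (fun x => gradient (fun _ : E d => (0 : ℝ)) x - (0 : L2Pair U).snd x)
          =ᵐ[volume.restrict U] fun _ => 0 := by
        filter_upwards [Lp.coeFn_zero (E d) 2 (volume.restrict U)] with x hx
        change _ - ((0 : Lp (E d) 2 (volume.restrict U)) x) = 0
        rw [hx]; simp [gradient]
      simp only [eLpNorm_congr_ae h]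
      simp
    · simp
  add_mem' := by
    rintro u v ⟨hu, φ, hφ, h1, h2, h3⟩ ⟨hv, ψ, hψ, k1, k2, k3⟩
    refine ⟨(H1 U).add_mem hu hv, fun k x => φ k x + ψ k x, fun k => (hφ k).add (hψ k), ?_, ?_, ?_⟩
    · refine tendsto_eLpNorm_add
        (fun k => (hφ k).continuous.aestronglyMeasurable.sub (Lp.aestronglyMeasurable u.fst))
        (fun k => (hψ k).continuous.aestronglyMeasurable.sub (Lp.aestronglyMeasurable v.fst))
        (fun k => ?_) h1 k1
      filter_upwards [Lp.coeFn_add u.fst v.fst] with x hx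
      change _ - ((u.fst + v.fst : Lp ℝ 2 (volume.restrict U)) x) = _
      rw [hx]; simp only [Pi.add_apply, Pi.sub_apply]; ring
    · refine tendsto_eLpNorm_add
        (fun k => (continuous_gradient (hφ k)).aestronglyMeasurable.sub
          (Lp.aestronglyMeasurable u.snd))
        (fun k => (continuous_gradient (hψ k)).aestronglyMeasurable.sub
          (Lp.aestronglyMeasurable v.snd))
        (fun k => ?_) h2 k2
      filter_upwards [Lp.coeFn_add u.snd v.snd] with x hx
      change _ - ((u.snd + v.snd : Lp (E d) 2 (volume.restrict U)) x) = _
      rw [hx, gradient_add_apply (hφ k) (hψ k)]; simp only [Pi.add_apply, Pi.sub_apply]; abel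
    · exact tendsto_eLpNorm_add (fun k => (hφ k).continuous.aestronglyMeasurable)
        (fun k => (hψ k).continuous.aestronglyMeasurable) (fun k => Filter.EventuallyEq.rfl) h3 k3
  smul_mem' := by
    rintro c u ⟨hu, φ, hφ, h1, h2, h3⟩
    refine ⟨(H1 U).smul_mem c hu, fun k x => c * φ k x, fun k => contDiff_const.mul (hφ k),
      ?_, ?_, ?_⟩
    · refine tendsto_eLpNorm_smul c (fun k => ?_) h1
      filter_upwards [Lp.coeFn_smul c u.fst] with x hx
      change _ - ((c • u.fst : Lp ℝ 2 (volume.restrict U)) x) = _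
      rw [hx]; simp only [Pi.smul_apply, smul_eq_mul]; ring
    · refine tendsto_eLpNorm_smul c (fun k => ?_) h2
      filter_upwards [Lp.coeFn_smul c u.snd] with x hx
      change _ - ((c • u.snd : Lp (E d) 2 (volume.restrict U)) x) = _
      rw [hx, gradient_smul_apply (hφ k)]; simp only [Pi.smul_apply, smul_sub]
    · exact tendsto_eLpNorm_smul c (fun k => Filter.EventuallyEq.rfl) h3

/-! ### The coefficient and the energy form -/

/-- `A ∈ L^∞(Ω)^{d×d}` is symmetric and uniformly elliptic on `Ω` with bounds `0 < α < β`
(symmetry and the upper bound imply that the entries are bounded by `β`). -/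
structure IsElliptic {d : ℕ} (A : E d → Matrix (Fin d) (Fin d) ℝ) (Ω : Set (E d)) (α β : ℝ) :
    Prop where
  pos : 0 < α
  lt : α < β
  measurable : ∀ i j, AEStronglyMeasurable (fun x => A x i j) (volume.restrict Ω)
  symm : ∀ᵐ x ∂(volume.restrict Ω), ∀ i j, A x i j = A x j i
  lower : ∀ᵐ x ∂(volume.restrict Ω), ∀ ξ : E d,
    α * ∑ i, ξ i ^ 2 ≤ ∑ i, ∑ j, A x i j * ξ i * ξ j
  upper : ∀ᵐ x ∂(volume.restrict Ω), ∀ ξ : E d,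
    ∑ i, ∑ j, A x i j * ξ i * ξ j ≤ β * ∑ i, ξ i ^ 2

/-- `M ξ · η`. -/
def matForm {d : ℕ} (M : Matrix (Fin d) (Fin d) ℝ) (ξ η : E d) : ℝ :=
  ∑ i, ∑ j, M i j * ξ j * η i

/-- `a_U(u, v) = ∫_U A ∇u · ∇v`. -/
def energyForm {d : ℕ} (A : E d → Matrix (Fin d) (Fin d) ℝ) {U : Set (E d)} (u v : L2Pair U) : ℝ :=
  ∫ x in U, matForm (A x) (u.snd x) (v.snd x)

/-- `‖u‖_{a,U} = √(a_U(u, u))`. -/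
def energyNorm {d : ℕ} (A : E d → Matrix (Fin d) (Fin d) ℝ) {U : Set (E d)} (u : L2Pair U) : ℝ :=
  √(energyForm A u u)

/-! ### The spaces on a subdomain `U ⊆ Ω` -/

/-- `H¹_{0D}(U)`: the `v ∈ H¹(U)` with `v = 0` on `(∂U ∩ Ω) ∪ (∂U ∩ ∂Ω_D)`. -/
def H10D {d : ℕ} (Ω ΓD U : Set (E d)) : Submodule ℝ (L2Pair U) :=
  H1Zero U ((frontier U ∩ Ω) ∪ (frontier U ∩ ΓD))

/-- `H_{A,D}(U)`: the `u ∈ H¹(U)` with `a_U(u, v) = 0` for all `v ∈ H¹_{0D}(U)`. The integrability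
clause is automatic when `A` is measurable and bounded on `U`; it is there so that the set is a
subspace for every `A`. -/
def HAD {d : ℕ} (A : E d → Matrix (Fin d) (Fin d) ℝ) (Ω ΓD U : Set (E d)) :
    Submodule ℝ (L2Pair U) where
  carrier := {u | u ∈ H1 U ∧ ∀ v ∈ H10D Ω ΓD U,
    IntegrableOn (fun x => matForm (A x) (u.snd x) (v.snd x)) U ∧ energyForm A u v = 0}
  zero_mem' := by
    refine ⟨(H1 U).zero_mem, fun v _ => ?_⟩
    have h : (fun x => matForm (A x) ((0 : L2Pair U).snd x) (v.snd x))
        =ᵐ[volume.restrict U] fun _ => 0 := by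
      filter_upwards [Lp.coeFn_zero (E d) 2 (volume.restrict U)] with x hx
      change matForm (A x) ((0 : Lp (E d) 2 (volume.restrict U)) x) _ = 0
      rw [hx]; simp [matForm]
    refine ⟨(integrable_congr h).2 (integrable_zero _ _ _), ?_⟩
    rw [energyForm, integral_congr_ae h]; simp
  add_mem' := by
    rintro u w ⟨hu, hu'⟩ ⟨hw, hw'⟩
    refine ⟨(H1 U).add_mem hu hw, fun v hv => ?_⟩
    obtain ⟨i1, e1⟩ := hu' v hv
    obtain ⟨i2, e2⟩ := hw' v hv
    have h : (fun x => matForm (A x) ((u + w).snd x) (v.snd x))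
        =ᵐ[volume.restrict U] fun x => matForm (A x) (u.snd x) (v.snd x) +
          matForm (A x) (w.snd x) (v.snd x) := by
      filter_upwards [Lp.coeFn_add u.snd w.snd] with x hx
      change matForm (A x) ((u.snd + w.snd : Lp (E d) 2 (volume.restrict U)) x) _ = _
      rw [hx]; simp [matForm, mul_add, add_mul, Finset.sum_add_distrib]
    refine ⟨(integrable_congr h).2 (i1.add i2), ?_⟩
    rw [energyForm, integral_congr_ae h, integral_add i1 i2]
    rw [energyForm] at e1 e2
    rw [e1, e2, add_zero]
  smul_mem' := by
    rintro c u ⟨hu, hu'⟩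
    refine ⟨(H1 U).smul_mem c hu, fun v hv => ?_⟩
    obtain ⟨i1, e1⟩ := hu' v hv
    have h : (fun x => matForm (A x) ((c • u).snd x) (v.snd x))
        =ᵐ[volume.restrict U] fun x => c * matForm (A x) (u.snd x) (v.snd x) := by
      filter_upwards [Lp.coeFn_smul c u.snd] with x hx
      change matForm (A x) ((c • u.snd : Lp (E d) 2 (volume.restrict U)) x) _ = _
      rw [hx]; simp only [matForm, Pi.smul_apply, PiLp.smul_apply, smul_eq_mul, Finset.mul_sum]
      refine Finset.sum_congr rfl fun i _ => Finset.sum_congr rfl fun j _ => by ring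
    refine ⟨(integrable_congr h).2 (i1.const_mul c), ?_⟩
    rw [energyForm, integral_congr_ae h, integral_const_mul]
    rw [energyForm] at e1
    rw [e1, mul_zero]

/-- `H⁰_{A,D}(U)`: the `v ∈ H_{A,D}(U)` with `v = 0` on `∂U ∩ ∂Ω_D`. -/
def H0AD {d : ℕ} (A : E d → Matrix (Fin d) (Fin d) ℝ) (Ω ΓD U : Set (E d)) :
    Submodule ℝ (L2Pair U) :=
  HAD A Ω ΓD U ⊓ H1Zero U (frontier U ∩ ΓD)

/-- The properties of a partition of unity function `χ` on `Ω` attached to the subdomain `ω`. -/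
structure IsPartitionFunction {d : ℕ} (χ : E d → ℝ) (ω Ω : Set (E d)) : Prop where
  nonneg : ∀ x ∈ Ω, 0 ≤ χ x
  le_one : ∀ x ∈ Ω, χ x ≤ 1
  eq_zero : ∀ x ∈ Ω \ ω, χ x = 0
  continuousOn : ContinuousOn χ Ω
  contDiffOn : ContDiffOn ℝ 1 χ ω
  gradient_bound : ∃ C : ℝ, ∀ x ∈ ω, ‖gradient χ x‖ ≤ C

/-! ### Widths and eigenpairs

Below, `X` is a space of functions on `V`, `Y` a space of functions on `U`, and `P : X → Y` is
linear. -/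

section Width

variable {d : ℕ} (A : E d → Matrix (Fin d) (Fin d) ℝ) {U V : Set (E d)}
  {X : Submodule ℝ (L2Pair V)} {Y : Submodule ℝ (L2Pair U)}

/-- `sup_{0 ≠ u ∈ X} inf_{v ∈ Q} ‖P u - v‖_{a,U} / ‖u‖_{a,V}`, with values in `[0, ∞]`. -/
def deviation (P : X →L[ℝ] Y) (Q : Submodule ℝ Y) : ℝ≥0∞ :=
  ⨆ (u : X) (_ : u ≠ 0), ⨅ v ∈ Q,
    ENNReal.ofReal (energyNorm A ((P u - v : Y) : L2Pair U)) /
      ENNReal.ofReal (energyNorm A (u : L2Pair V))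

/-- The Kolmogorov `n`-width of `P` with respect to the energy norms: the infimum of the deviation
over the `n`-dimensional subspaces of `Y`. -/
def nWidth (P : X →L[ℝ] Y) (n : ℕ) : ℝ≥0∞ :=
  ⨅ (Q : Submodule ℝ Y) (_ : Module.rank ℝ Q = n), deviation A P Q

/-- `v ≠ 0` and `a_V(v, φ) = t a_U(P v, P φ)` for all `φ ∈ X`. -/
def IsEigenpair (P : X →L[ℝ] Y) (t : ℝ) (v : X) : Prop :=
  v ≠ 0 ∧ ∀ φ : X, energyForm A (v : L2Pair V) (φ : L2Pair V) =
    t * energyForm A (P v : L2Pair U) (P φ : L2Pair U)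

/-- `lam k`, `v k` (`k < N`, counted from `0`) enumerate the eigenvalues in increasing order, repeated
according to multiplicity, together with linearly independent eigenfunctions. `N ≤ ∞` is the number
of eigenvalues; the entries with `k ≥ N` have no meaning. -/
structure IsEigenSystem (P : X →L[ℝ] Y) (N : ℕ∞) (lam : ℕ → ℝ) (v : ℕ → X) : Prop where
  eigenpair : ∀ k : ℕ, (k : ℕ∞) < N → IsEigenpair A P (lam k) (v k)
  mono : ∀ k l : ℕ, k ≤ l → (l : ℕ∞) < N → lam k ≤ lam l
  independent : LinearIndependent ℝ (fun k : {k : ℕ // (k : ℕ∞) < N} => v k)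
  complete : ∀ (t : ℝ) (w : X), IsEigenpair A P t w →
    w ∈ Submodule.span ℝ (v '' {k : ℕ | (k : ℕ∞) < N ∧ lam k = t})

end Width

end

end MSGFEM

open MSGFEM

/-! Write `a` for the energy form on the `A`-harmonic functions of `ωs` and `c` for the energy form on
`ω`. Once `P` is known to be compact, and `a` to be coercive, the theorem is the variational
characterisation of the eigenvalues of a compact self-adjoint operator, in the generalised form
`a(v, φ) = λ c(P v, P φ)`. The Rayleigh quotient `c(P u, P u) / a(u, u)` attains its supremum on every
closed subspace (`FormPair.exists_maximizer`), its successive maximisers are the eigenvectors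
(`FormPair.EigenList.exists_eigenList`), the images of the first `n` of them approximate the image of
`P` up to `(lam n)^(-1/2)` (`FormPair.EigenList.exists_upper`), and by a dimension count in the span of
the first `n + 1` no `n`-dimensional space does better (`FormPair.EigenList.exists_lower`). When the
list has ended, the span of the images is exact, and it is enlarged to the required dimension inside
the infinite-dimensional space `H¹_{0D}(ω)`.

What remains is analytic. Functions with vanishing trace are limits of smooth functions, so each
inequality is proved for smooth functions on `ℝ^d` and passed to the limit.

* Coercivity is Friedrichs' inequality on `ωs` (`MSGFEM.IsLipschitzDomain.isControlled`). Over a portion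
  of the boundary of positive measure a trace estimate in a graph chart controls a function on a set of
  positive volume, and translations propagate this control along the connected domain.
* Compactness has two ingredients. Rellich's theorem on `ωs` (`hasFiniteApprox_univ`) is obtained by
  comparing a function with its averages over balls that are moved into the domain along a cone. A
  Caccioppoli argument bounds `P` in the `L²` norm: testing the equations of `u` and `v` with `χ² v` and
  `χ² u` removes every term with `∇u` or `∇v` from `c(χ u, χ v)`, which leaves
  `∫ (A ∇χ · ∇χ) u v` (`energyForm_mul_mul`). This is also the second form of the eigenproblem.
* The function `χ`, which is only `C¹` on `ω` and continuous across `∂ω`, is Lipschitz on `Ω` and extends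
  to a Lipschitz function on `ℝ^d` (`MSGFEM.IsPartitionFunction.exists_extension`). Mollification then
  shows that multiplication by it preserves vanishing traces and creates them on `∂ω ∩ Ω`
  (`MSGFEM.HasZeroTrace.mul`). -/

/-! ### A compact operator between two spaces with quadratic forms -/

/-- Data of an abstract generalised eigenproblem `a(v, φ) = t c(P v, P φ)`: a bounded coercive
symmetric form `a`, a bounded positive semidefinite symmetric form `c` and a compact operator `P`. -/
structure FormPair {X Y : Type*} [NormedAddCommGroup X] [NormedSpace ℝ X]
    [NormedAddCommGroup Y] [NormedSpace ℝ Y] (P : X →L[ℝ] Y) (a : X →L[ℝ] X →L[ℝ] ℝ)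
    (c : Y →L[ℝ] Y →L[ℝ] ℝ) : Prop where
  symm : ∀ u v, a u v = a v u
  coercive : ∃ m : ℝ, 0 < m ∧ ∀ u, m * ‖u‖ ^ 2 ≤ a u u
  symm' : ∀ u v, c u v = c v u
  nonneg : ∀ u, 0 ≤ c u u
  compact : IsCompactOperator P

namespace FormPair

/-- The orthogonal complement of `S` with respect to the form `a`. -/
def perp {X : Type*} [NormedAddCommGroup X] [NormedSpace ℝ X] (a : X →L[ℝ] X →L[ℝ] ℝ)
    (S : Submodule ℝ X) : Submodule ℝ X where
  carrier := {w | ∀ z ∈ S, a w z = 0}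
  zero_mem' := by intro z _; simp
  add_mem' := by intro u v hu hv z hz; simp [hu z hz, hv z hz]
  smul_mem' := by intro t u hu z hz; simp [hu z hz]

theorem mem_perp {X : Type*} [NormedAddCommGroup X] [NormedSpace ℝ X] {a : X →L[ℝ] X →L[ℝ] ℝ}
    {S : Submodule ℝ X} {w : X} : w ∈ perp a S ↔ ∀ z ∈ S, a w z = 0 := Iff.rfl

theorem isClosed_perp {X : Type*} [NormedAddCommGroup X] [NormedSpace ℝ X]
    (a : X →L[ℝ] X →L[ℝ] ℝ) (S : Submodule ℝ X) : IsClosed (perp a S : Set X) := by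
  have : (perp a S : Set X) = ⋂ z ∈ S, {w | a w z = 0} := by
    ext w; simp [mem_perp]
  rw [this]
  refine isClosed_biInter fun z _ => isClosed_eq ?_ continuous_const
  fun_prop

/-- Cauchy–Schwarz in its degenerate case: a zero of a positive semidefinite quadratic form lies in
the kernel of the form. -/
theorem eq_zero_of_nonneg {X : Type*} [AddCommGroup X] [Module ℝ X] (W : Submodule ℝ X)
    (B : X → X → ℝ) (hexp : ∀ u v (s : ℝ), B (u + s • v) (u + s • v) =
      B u u + 2 * s * B u v + s ^ 2 * B v v)
    (hnn : ∀ w ∈ W, 0 ≤ B w w) {u : X} (hu : u ∈ W) (hu0 : B u u = 0) {φ : X} (hφ : φ ∈ W) :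
    B u φ = 0 := by
  have h : ∀ s : ℝ, 0 ≤ 2 * s * B u φ + s ^ 2 * B φ φ := fun s => by
    have := hnn _ (W.add_mem hu (W.smul_mem s hφ))
    rw [hexp, hu0] at this
    linarith
  have hd := hnn φ hφ
  by_contra hne
  have h2 := h (-(B u φ) / (B φ φ + 1))
  have hp : 0 < B φ φ + 1 := by linarith
  have e : 2 * (-(B u φ) / (B φ φ + 1)) * B u φ + (-(B u φ) / (B φ φ + 1)) ^ 2 * B φ φ
      = -(B u φ) ^ 2 * (B φ φ + 2) / (B φ φ + 1) ^ 2 := by field_simp; ring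
  rw [e, div_nonneg_iff] at h2
  have : 0 < (B u φ) ^ 2 := by positivity
  rcases h2 with h2 | h2
  · nlinarith [h2.1]
  · nlinarith [h2.2, sq_pos_of_pos hp]

section

variable {X Y : Type*} [NormedAddCommGroup X] [NormedSpace ℝ X]
  [NormedAddCommGroup Y] [NormedSpace ℝ Y] {P : X →L[ℝ] Y} {a : X →L[ℝ] X →L[ℝ] ℝ}
  {c : Y →L[ℝ] Y →L[ℝ] ℝ}

theorem pos (h : FormPair P a c) {u : X} (hu : u ≠ 0) : 0 < a u u := by
  obtain ⟨m, hm, hc⟩ := h.coercive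
  have : 0 < ‖u‖ := norm_pos_iff.2 hu
  exact lt_of_lt_of_le (by positivity) (hc u)

theorem a_nonneg (h : FormPair P a c) (u : X) : 0 ≤ a u u := by
  rcases eq_or_ne u 0 with rfl | hu
  · simp
  · exact (h.pos hu).le

theorem expand (h : FormPair P a c) (u v : X) (s : ℝ) :
    a (u + s • v) (u + s • v) = a u u + 2 * s * a u v + s ^ 2 * a v v := by
  simp only [map_add, map_smul, add_apply, smul_apply,
    smul_eq_mul, h.symm v u]
  ring

theorem expand' (h : FormPair P a c) (u v : Y) (s : ℝ) :
    c (u + s • v) (u + s • v) = c u u + 2 * s * c u v + s ^ 2 * c v v := by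
  simp only [map_add, map_smul, add_apply, smul_apply,
    smul_eq_mul, h.symm' v u]
  ring

/-- On a closed subspace on which `u ↦ c(P u, P u)` is not identically zero, the Rayleigh quotient
`c(P u, P u) / a(u, u)` attains its supremum. By the parallelogram law for `a`, a maximising sequence
whose image under `P` converges is itself a Cauchy sequence. -/
theorem exists_maximizer [CompleteSpace X] (h : FormPair P a c) {W : Submodule ℝ X}
    (hW : IsClosed (W : Set X)) (hne : ∃ w ∈ W, 0 < c (P w) (P w)) :
    ∃ u ∈ W, a u u = 1 ∧ 0 < c (P u) (P u) ∧
      (∀ w ∈ W, c (P w) (P w) ≤ c (P u) (P u) * a w w) ∧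
      ∀ φ ∈ W, c (P u) (P φ) = c (P u) (P u) * a u φ := by
  obtain ⟨m, hm, hcoer⟩ := h.coercive
  set R : Set ℝ := {r | ∃ w ∈ W, a w w = 1 ∧ r = c (P w) (P w)} with hR
  obtain ⟨w0, hw0, hb0⟩ := hne
  have hw0' : w0 ≠ 0 := by rintro rfl; simp at hb0
  have hscale : ∀ w ∈ W, w ≠ 0 → c (P w) (P w) / a w w ∈ R := by
    intro w hw hw'
    have hp := h.pos hw'
    have hs := Real.mul_self_sqrt hp.le
    have hs0 : 0 < √(a w w) := Real.sqrt_pos.2 hp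
    refine ⟨(√(a w w))⁻¹ • w, W.smul_mem _ hw, ?_, ?_⟩
    · simp only [map_smul, smul_apply, smul_eq_mul]
      rw [← hs]; field_simp
      rw [Real.sqrt_sq hs0.le]
    · simp only [map_smul, smul_apply, smul_eq_mul]
      conv_lhs => rw [← hs]
      field_simp
  have hbd : BddAbove R := by
    refine ⟨‖c‖ * ‖P‖ ^ 2 / m, ?_⟩
    rintro r ⟨w, -, hw1, rfl⟩
    have h1 : c (P w) (P w) ≤ ‖c‖ * ‖P w‖ * ‖P w‖ :=
      (le_abs_self _).trans (c.le_opNorm₂ _ _)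
    have h2 : ‖P w‖ ≤ ‖P‖ * ‖w‖ := P.le_opNorm w
    have h3 : ‖w‖ ^ 2 ≤ 1 / m := by
      rw [le_div_iff₀ hm]; nlinarith [hcoer w]
    calc c (P w) (P w) ≤ ‖c‖ * ‖P w‖ * ‖P w‖ := h1
      _ ≤ ‖c‖ * (‖P‖ * ‖w‖) * (‖P‖ * ‖w‖) := by gcongr
      _ = ‖c‖ * ‖P‖ ^ 2 * ‖w‖ ^ 2 := by ring
      _ ≤ ‖c‖ * ‖P‖ ^ 2 * (1 / m) := by gcongr
      _ = _ := by ring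
  have hRne : R.Nonempty := ⟨_, hscale w0 hw0 hw0'⟩
  set μ := sSup R with hμ
  have hμpos : 0 < μ := lt_of_lt_of_le (div_pos hb0 (h.pos hw0')) (le_csSup hbd (hscale w0 hw0 hw0'))
  have hmax : ∀ w ∈ W, c (P w) (P w) ≤ μ * a w w := by
    intro w hw
    rcases eq_or_ne w 0 with rfl | hw'
    · simp
    · have := le_csSup hbd (hscale w hw hw')
      rwa [div_le_iff₀ (h.pos hw')] at this
  obtain ⟨r, -, hrt, hrm⟩ := exists_seq_tendsto_sSup hRne hbd
  choose w hwW hw1 hwr using hrm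
  have hwn : ∀ n, w n ∈ Metric.closedBall (0 : X) (√(1 / m)) := by
    intro n
    rw [mem_closedBall_zero_iff]
    apply Real.le_sqrt_of_sq_le
    rw [le_div_iff₀ hm]; nlinarith [hcoer (w n), hw1 n]
  obtain ⟨K, hK, hKs⟩ := IsCompactOperator.image_closedBall_subset_compact
    (f := (P : X →ₗ[ℝ] Y)) h.compact (√(1 / m))
  obtain ⟨y, -, k, hk, hy⟩ := hK.tendsto_subseq (x := fun n => P (w n))
    (fun n => hKs ⟨w n, hwn n, rfl⟩)
  have hcont : Continuous fun z : Y => c z z := by fun_prop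
  have hcy : c y y = μ := by
    have t1 := (hcont.tendsto y).comp hy
    have t2 : Tendsto (fun n => r (k n)) atTop (𝓝 μ) := hrt.comp hk.tendsto_atTop
    refine tendsto_nhds_unique t1 (t2.congr fun n => ?_)
    simp [hwr]
  have hpar : ∀ i j, m * ‖w i - w j‖ ^ 2 ≤ 4 - c (P (w i) + P (w j)) (P (w i) + P (w j)) / μ := by
    intro i j
    have h1 := hcoer (w i - w j)
    have h2 := hmax _ (W.add_mem (hwW i) (hwW j))
    rw [map_add] at h2
    have h3 : a (w i - w j) (w i - w j) + a (w i + w j) (w i + w j) = 4 := by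
      simp only [map_add, map_sub, add_apply, sub_apply,
        hw1]
      ring
    have h4 : c (P (w i) + P (w j)) (P (w i) + P (w j)) / μ ≤ a (w i + w j) (w i + w j) := by
      rw [div_le_iff₀ hμpos]; linarith
    linarith
  have hcau : CauchySeq (fun n => w (k n)) := by
    rw [Metric.cauchySeq_iff]
    intro ε hε
    have t1 : Tendsto (fun p : ℕ × ℕ => 4 - c (P (w (k p.1)) + P (w (k p.2)))
        (P (w (k p.1)) + P (w (k p.2))) / μ) atTop (𝓝 (4 - c (y + y) (y + y) / μ)) := by
      have hs : Tendsto (fun p : ℕ × ℕ => P (w (k p.1)) + P (w (k p.2))) atTop (𝓝 (y + y)) := by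
        rw [← prod_atTop_atTop_eq]
        exact (hy.comp tendsto_fst).add (hy.comp tendsto_snd)
      exact (((hcont.tendsto _).comp hs).div_const μ).const_sub 4
    have e0 : 4 - c (y + y) (y + y) / μ = 0 := by
      simp only [map_add, add_apply, hcy]
      field_simp; ring
    rw [e0] at t1
    have ev := t1.eventually (gt_mem_nhds (show 0 < m * ε ^ 2 by positivity))
    rw [eventually_atTop] at ev
    obtain ⟨⟨N1, N2⟩, hN⟩ := ev
    refine ⟨max N1 N2, fun i hi j hj => ?_⟩
    have := lt_of_le_of_lt (hpar (k i) (k j))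
      (hN (i, j) ⟨(le_max_left _ _).trans hi, (le_max_right _ _).trans hj⟩)
    rw [dist_eq_norm]
    have h5 : ‖w (k i) - w (k j)‖ ^ 2 < ε ^ 2 := lt_of_mul_lt_mul_left this hm.le
    exact lt_of_pow_lt_pow_left₀ 2 hε.le h5
  obtain ⟨u, hu⟩ := cauchySeq_tendsto_of_complete hcau
  have huW : u ∈ W := hW.mem_of_tendsto hu (Eventually.of_forall fun n => hwW _)
  have hau : a u u = 1 := by
    have t1 : Tendsto (fun n => a (w (k n)) (w (k n))) atTop (𝓝 (a u u)) :=
      ((by fun_prop : Continuous fun z : X => a z z).tendsto u).comp hu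
    refine tendsto_nhds_unique t1 ?_
    simp only [hw1]; exact tendsto_const_nhds
  have hPu : P u = y := tendsto_nhds_unique ((P.continuous.tendsto u).comp hu) hy
  refine ⟨u, huW, hau, by rwa [hPu, hcy], by rwa [hPu, hcy], fun φ hφ => ?_⟩
  have := eq_zero_of_nonneg W (fun u v => μ * a u v - c (P u) (P v))
    (fun u v s => by
      have e1 := h.expand u v s
      have e2 := h.expand' (P u) (P v) s
      have e3 : P (u + s • v) = P u + s • P v := by simp
      rw [e3, e1, e2]; ring)
    (fun w hw => by have := hmax w hw; linarith) huW (by rw [hau, hPu, hcy]; ring) hφ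
  rw [show c (P u) (P u) = μ by rw [hPu, hcy]]
  linarith

/-- The `a`-orthogonal projection onto a finite-dimensional subspace. -/
theorem exists_proj (h : FormPair P a c) (S : Submodule ℝ X) [FiniteDimensional ℝ S] (u : X) :
    ∃ s ∈ S, u - s ∈ perp a S := by
  let T : S →ₗ[ℝ] Module.Dual ℝ S :=
    LinearMap.mk₂ ℝ (fun s z : S => a s z) (by intros; simp) (by intros; simp) (by intros; simp)
      (by intros; simp)
  have hT : Function.Injective T := by
    rw [← LinearMap.ker_eq_bot, LinearMap.ker_eq_bot']
    intro s hs
    by_contra hne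
    have h1 : T s s = 0 := by rw [hs]; rfl
    have h2 : 0 < a (s : X) s := h.pos (by simpa using hne)
    exact h2.ne' h1
  have hT' : Function.Surjective T :=
    (LinearMap.injective_iff_surjective_of_finrank_eq_finrank
      (Subspace.dual_finrank_eq (K := ℝ) (V := S)).symm).1 hT
  obtain ⟨s, hs⟩ := hT' ((a u : X →ₗ[ℝ] ℝ).domRestrict S)
  refine ⟨s, s.2, fun z hz => ?_⟩
  have : a s z = a u z := LinearMap.congr_fun hs ⟨z, hz⟩
  simp [this]


variable (P a c) in
/-- `v ≠ 0` and `a(v, φ) = t c(P v, P φ)` for all `φ`. -/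
def IsEigen (t : ℝ) (v : X) : Prop :=
  v ≠ 0 ∧ ∀ φ : X, a v φ = t * c (P v) (P φ)

variable (P a c) in
/-- A full increasing list of length `N` of the eigenvalues, repeated according to multiplicity, with
linearly independent eigenvectors. -/
structure EigenList (N : ℕ∞) (lam : ℕ → ℝ) (v : ℕ → X) : Prop where
  eigen : ∀ k : ℕ, (k : ℕ∞) < N → IsEigen P a c (lam k) (v k)
  mono : ∀ k l : ℕ, k ≤ l → (l : ℕ∞) < N → lam k ≤ lam l
  independent : LinearIndependent ℝ (fun k : {k : ℕ // (k : ℕ∞) < N} => v k)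
  complete : ∀ (t : ℝ) (w : X), IsEigen P a c t w →
    w ∈ Submodule.span ℝ (v '' {k : ℕ | (k : ℕ∞) < N ∧ lam k = t})

theorem IsEigen.pos (h : FormPair P a c) {t : ℝ} {v : X} (hv : IsEigen P a c t v) : 0 < t := by
  have h1 := h.pos hv.1
  rw [hv.2 v] at h1
  exact pos_of_mul_pos_left h1 (h.nonneg _)

theorem IsEigen.apply (h : FormPair P a c) {t : ℝ} {v : X} (hv : IsEigen P a c t v) (φ : X) :
    c (P v) (P φ) = t⁻¹ * a v φ := by
  rw [hv.2 φ, inv_mul_cancel_left₀ (hv.pos h).ne']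

theorem IsEigen.orthogonal (h : FormPair P a c) {t s : ℝ} {v w : X} (hv : IsEigen P a c t v)
    (hw : IsEigen P a c s w) (hts : t ≠ s) : a v w = 0 := by
  have h1 := hv.2 w
  have h2 := hw.2 v
  rw [h.symm, h.symm', h1] at h2
  have h3 : (t - s) * c (P v) (P w) = 0 := by linarith
  rcases mul_eq_zero.1 h3 with h3 | h3
  · exact absurd (sub_eq_zero.1 h3) hts
  · rw [h1, h3, mul_zero]

namespace EigenList

variable {N : ℕ∞} {lam : ℕ → ℝ} {v : ℕ → X}

theorem lt_of_fin {n : ℕ} (hn : (n : ℕ∞) ≤ N) (k : Fin n) : ((k : ℕ) : ℕ∞) < N :=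
  lt_of_lt_of_le (by exact_mod_cast k.2) hn

theorem independent_fin (hl : EigenList P a c N lam v) {n : ℕ} (hn : (n : ℕ∞) ≤ N) :
    LinearIndependent ℝ (fun k : Fin n => v k) :=
  hl.independent.comp (fun k : Fin n => ⟨(k : ℕ), lt_of_fin hn k⟩)
    (fun i j hij => Fin.ext (by simpa using hij))

theorem independent_image (h : FormPair P a c) (hl : EigenList P a c N lam v) {n : ℕ}
    (hn : (n : ℕ∞) ≤ N) : LinearIndependent ℝ (fun k : Fin n => P (v k)) := by
  rw [Fintype.linearIndependent_iff]
  intro g hg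
  have hz : ∑ k : Fin n, (g k * (lam k)⁻¹) • v k = 0 := by
    by_contra hne
    refine (h.pos hne).ne' ?_
    set z := ∑ k : Fin n, (g k * (lam k)⁻¹) • v k with hzdef
    have h1 : a z z = ∑ k : Fin n, g k * c (P (v k)) (P z) := by
      conv_lhs => rw [show a z = ∑ k : Fin n, (g k * (lam k)⁻¹) • a (v k) by
        rw [hzdef]; simp only [map_sum, map_smul]]
      rw [sum_apply]
      refine Finset.sum_congr rfl fun k _ => ?_
      rw [(hl.eigen k (lt_of_fin hn k)).apply h, smul_apply, smul_eq_mul, mul_assoc]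
    have h2 : c (∑ k : Fin n, g k • P (v k)) (P z) = ∑ k : Fin n, g k * c (P (v k)) (P z) := by
      simp only [map_sum, map_smul, sum_apply, smul_apply, smul_eq_mul]
    rw [h1, ← h2, hg]; simp
  intro k
  have := Fintype.linearIndependent_iff.1 (hl.independent_fin hn) _ hz k
  exact (mul_eq_zero.1 this).resolve_right
    (inv_ne_zero ((hl.eigen k (lt_of_fin hn k)).pos h).ne')

theorem rank_span_image (h : FormPair P a c) (hl : EigenList P a c N lam v) {n : ℕ}
    (hn : (n : ℕ∞) ≤ N) :
    Module.rank ℝ (Submodule.span ℝ (Set.range fun k : Fin n => P (v k))) = n := by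
  have h1 := finrank_span_eq_card (hl.independent_image h hn)
  have := FiniteDimensional.span_of_finite ℝ (Set.finite_range fun k : Fin n => P (v k))
  rw [← Module.finrank_eq_rank, h1, Fintype.card_fin]

/-- On the span of the first `n + 1` eigenvectors the Rayleigh quotient is at least `1 / lam n`. With
`s k = √(1 / lam k - 1 / lam n)` one has
`c(P u, P u) - a(u, u) / lam n = a(∑ g k s k v k, ∑ g k s k v k)` for `u = ∑ g k v k`, because
`a(v k, v l)` vanishes unless `lam k = lam l`. -/
theorem le_of_mem_span (h : FormPair P a c) (hl : EigenList P a c N lam v) {n : ℕ}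
    (hn : (n : ℕ∞) < N) {u : X} (hu : u ∈ Submodule.span ℝ (Set.range fun k : Fin (n + 1) => v k)) :
    (lam n)⁻¹ * a u u ≤ c (P u) (P u) := by
  obtain ⟨g, rfl⟩ := (Submodule.mem_span_range_iff_exists_fun ℝ).1 hu
  have hn' : ((n + 1 : ℕ) : ℕ∞) ≤ N := by
    rw [Nat.cast_add, Nat.cast_one]; exact Order.add_one_le_of_lt hn
  have he := fun k : Fin (n + 1) => hl.eigen k (lt_of_fin hn' k)
  set s : Fin (n + 1) → ℝ := fun k => √((lam k)⁻¹ - (lam n)⁻¹) with hs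
  have hs2 : ∀ k, s k * s k = (lam k)⁻¹ - (lam n)⁻¹ := fun k => by
    refine Real.mul_self_sqrt (sub_nonneg.2 ?_)
    exact inv_anti₀ ((he k).pos h) (hl.mono k n (Nat.lt_succ_iff.1 k.2) hn)
  have key : ∀ k l : Fin (n + 1), a (v k) (v l) * ((lam k)⁻¹ - (lam n)⁻¹) = a (v k) (v l) * (s k * s l) := by
    intro k l
    by_cases hkl : lam k = lam l
    · have : s k = s l := by simp only [hs, hkl]
      rw [← this, hs2]
    · rw [(he k).orthogonal h (he l) hkl]; simp
  have h1 := h.a_nonneg (∑ k, (g k * s k) • v k)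
  have e1 : ∀ (f f' : Fin (n + 1) → ℝ), a (∑ k, f k • v k) (∑ k, f' k • v k) =
      ∑ k, ∑ l, f k * f' l * a (v k) (v l) := by
    intro f f'
    simp only [map_sum, map_smul, sum_apply, smul_apply, smul_eq_mul,
      Finset.mul_sum]
    rw [Finset.sum_comm]
    exact Finset.sum_congr rfl fun k _ => Finset.sum_congr rfl fun l _ => by ring
  have e2 : c (P (∑ k, g k • v k)) (P (∑ k, g k • v k)) =
      ∑ k, ∑ l, g k * g l * ((lam k)⁻¹ * a (v k) (v l)) := by
    simp only [map_sum, map_smul, sum_apply, smul_apply, smul_eq_mul,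
      Finset.mul_sum]
    rw [Finset.sum_comm]
    refine Finset.sum_congr rfl fun k _ => Finset.sum_congr rfl fun l _ => ?_
    rw [(he k).apply h]; ring
  rw [e1] at h1 ⊢
  rw [e2, ← sub_nonneg]
  refine h1.trans_eq ?_
  rw [Finset.mul_sum, ← Finset.sum_sub_distrib]
  refine Finset.sum_congr rfl fun k _ => ?_
  rw [Finset.mul_sum, ← Finset.sum_sub_distrib]
  refine Finset.sum_congr rfl fun l _ => ?_
  have := key k l
  linear_combination (-(g k * g l)) * this

/-- No space of dimension `n < N` approximates the image of `P` better than `(lam n)^(-1/2)`: some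
nonzero combination of the first `n + 1` eigenvectors has an image that is `c`-orthogonal to it. -/
theorem exists_lower (h : FormPair P a c) (hl : EigenList P a c N lam v) {n : ℕ}
    (hn : (n : ℕ∞) < N) (Q : Submodule ℝ Y) (hQ : Module.rank ℝ Q = n) :
    ∃ u : X, u ≠ 0 ∧ ∀ q ∈ Q, (lam n)⁻¹ * a u u ≤ c (P u - q) (P u - q) := by
  have hn' : ((n + 1 : ℕ) : ℕ∞) ≤ N := by
    rw [Nat.cast_add, Nat.cast_one]; exact Order.add_one_le_of_lt hn
  set S := Submodule.span ℝ (Set.range fun k : Fin (n + 1) => v k) with hS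
  have hSf : Module.finrank ℝ S = n + 1 := by
    rw [hS, finrank_span_eq_card (hl.independent_fin hn'), Fintype.card_fin]
  have : FiniteDimensional ℝ S := FiniteDimensional.span_of_finite ℝ (Set.finite_range _)
  have : FiniteDimensional ℝ Q := Module.finite_of_rank_eq_nat hQ
  let T : S →ₗ[ℝ] Module.Dual ℝ Q :=
    LinearMap.mk₂ ℝ (fun (s : S) (q : Q) => c (P s) q) (by intros; simp) (by intros; simp)
      (by intros; simp) (by intros; simp)
  have hker : LinearMap.ker T ≠ ⊥ := by
    apply LinearMap.ker_ne_bot_of_finrank_lt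
    rw [Subspace.dual_finrank_eq, hSf, Module.finrank_eq_of_rank_eq hQ]; omega
  obtain ⟨u, hu, hu0⟩ := (Submodule.ne_bot_iff _).1 hker
  refine ⟨u, by simpa using hu0, fun q hq => ?_⟩
  have h1 : c (P u) q = 0 := LinearMap.congr_fun (LinearMap.mem_ker.1 hu) ⟨q, hq⟩
  have h2 := h.expand' (P u) q (-1)
  have h3 := hl.le_of_mem_span h hn u.2
  have h4 : P u + (-1 : ℝ) • q = P u - q := by rw [neg_one_smul, sub_eq_add_neg]
  rw [h4, h1] at h2
  have := h.nonneg q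
  linarith

/-- The images of the first `n` eigenvectors approximate the image of `P` up to `μ^(1/2)`, where
`μ = 1 / lam n`, or `μ = 0` when the list has ended: on the `a`-orthogonal complement of these
eigenvectors a maximiser of the Rayleigh quotient is again an eigenvector, so it comes later in the
list. -/
theorem exists_upper [CompleteSpace X] (h : FormPair P a c) (hl : EigenList P a c N lam v) {n : ℕ}
    (hn : (n : ℕ∞) ≤ N) (u : X) :
    ∃ q ∈ Submodule.span ℝ (Set.range fun k : Fin n => P (v k)),
      ((n : ℕ∞) < N → c (P u - q) (P u - q) ≤ (lam n)⁻¹ * a u u) ∧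
      (N ≤ n → c (P u - q) (P u - q) ≤ 0) := by
  set S := Submodule.span ℝ (Set.range fun k : Fin n => v k) with hS
  have : FiniteDimensional ℝ S := FiniteDimensional.span_of_finite ℝ (Set.finite_range _)
  have he := fun k : Fin n => hl.eigen k (lt_of_fin hn k)
  obtain ⟨s, hs, hsu⟩ := h.exists_proj S u
  have hPs : P s ∈ Submodule.span ℝ (Set.range fun k : Fin n => P (v k)) := by
    have h1 : P s ∈ S.map (P : X →ₗ[ℝ] Y) := ⟨s, hs, rfl⟩
    rw [hS, Submodule.map_span, ← Set.range_comp] at h1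
    exact h1
  refine ⟨P s, hPs, ?_⟩
  rw [← map_sub]
  have haw : a (u - s) (u - s) ≤ a u u := by
    have h1 := h.expand (u - s) s 1
    have h2 := h.a_nonneg s
    rw [one_smul, sub_add_cancel, hsu s hs] at h1
    linarith
  by_cases hb : ∃ w ∈ perp a S, 0 < c (P w) (P w)
  · obtain ⟨e, heW, he1, hμ, hmax, hEL⟩ := h.exists_maximizer (isClosed_perp a S) hb
    set μ := c (P e) (P e) with hμdef
    have hSe : ∀ z ∈ S, c (P e) (P z) = 0 := by
      intro z hz
      obtain ⟨g, rfl⟩ := (Submodule.mem_span_range_iff_exists_fun ℝ).1 hz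
      simp only [map_sum, map_smul, smul_eq_mul]
      refine Finset.sum_eq_zero fun k _ => ?_
      rw [h.symm', (he k).apply h, h.symm, heW _ (Submodule.subset_span ⟨k, rfl⟩)]
      simp
    have hee : IsEigen P a c μ⁻¹ e := by
      refine ⟨by rintro rfl; simp at he1, fun φ => ?_⟩
      obtain ⟨z, hz, hzφ⟩ := h.exists_proj S φ
      have h1 := hEL _ hzφ
      rw [map_sub, map_sub, map_sub, heW z hz, hSe z hz, sub_zero, sub_zero] at h1
      rw [h1, inv_mul_cancel_left₀ hμ.ne']
    -- `e` is `a`-orthogonal to `S`, so its expansion involves an eigenvector outside `S`.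
    have hk : ∃ k : ℕ, (k : ℕ∞) < N ∧ lam k = μ⁻¹ ∧ n ≤ k := by
      by_contra! hcon
      have h1 : e ∈ S := by
        refine Submodule.span_mono ?_ (hl.complete _ _ hee)
        rintro _ ⟨k, ⟨hk, hk'⟩, rfl⟩
        exact ⟨⟨k, hcon k hk hk'⟩, rfl⟩
      have := heW e h1
      rw [he1] at this
      exact one_ne_zero this
    obtain ⟨k, hkN, hkμ, hnk⟩ := hk
    refine ⟨fun hnN => ?_, fun hNn => ?_⟩
    · have h1 := hl.mono n k hnk hkN
      have h2 : μ ≤ (lam n)⁻¹ := by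
        rw [← inv_inv μ, ← hkμ]
        exact inv_anti₀ ((hl.eigen n hnN).pos h) h1
      refine (hmax _ hsu).trans ?_
      exact mul_le_mul h2 haw (h.a_nonneg _) (hμ.le.trans h2)
    · exact absurd (lt_of_lt_of_le hkN hNn) (not_lt.2 (by exact_mod_cast hnk))
  · push Not at hb
    have h0 := hb _ hsu
    refine ⟨fun hnN => h0.trans ?_, fun _ => h0⟩
    exact mul_nonneg (inv_nonneg.2 ((hl.eigen n hnN).pos h).le) (h.a_nonneg u)

/-- An increasing list of all eigenvalues exists. It is built greedily: the next eigenvector maximises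
the Rayleigh quotient on the `a`-orthogonal complement of the previous ones, and the list ends when
the quotient vanishes there. -/
theorem exists_eigenList [CompleteSpace X] (h : FormPair P a c) :
    ∃ (N : ℕ∞) (lam : ℕ → ℝ) (v : ℕ → X), EigenList P a c N lam v := by
  have hex : ∀ S : Submodule ℝ X, ∃ u : X, (∃ w ∈ perp a S, 0 < c (P w) (P w)) →
      u ∈ perp a S ∧ a u u = 1 ∧ 0 < c (P u) (P u) ∧
      (∀ w ∈ perp a S, c (P w) (P w) ≤ c (P u) (P u) * a w w) ∧
      ∀ φ ∈ perp a S, c (P u) (P φ) = c (P u) (P u) * a u φ := by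
    intro S
    by_cases hb : ∃ w ∈ perp a S, 0 < c (P w) (P w)
    · obtain ⟨u, hu⟩ := h.exists_maximizer (isClosed_perp a S) hb
      exact ⟨u, fun _ => hu⟩
    · exact ⟨0, fun hb' => absurd hb' hb⟩
  choose m hm using hex
  obtain ⟨S, hS0, hS1⟩ : ∃ S : ℕ → Submodule ℝ X, S 0 = ⊥ ∧
      ∀ k, S (k + 1) = S k ⊔ Submodule.span ℝ {m (S k)} :=
    ⟨fun k => Nat.rec ⊥ (fun _ T => T ⊔ Submodule.span ℝ {m T}) k, rfl, fun _ => rfl⟩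
  set v : ℕ → X := fun k => m (S k) with hv
  have hSv : ∀ k, S k = Submodule.span ℝ (v '' Set.Iio k) := by
    intro k
    induction k with
    | zero => simp [hS0]
    | succ k ih =>
      have : Set.Iio (k + 1) = Set.Iio k ∪ {k} := by ext j; simp
      rw [hS1, this, Set.image_union, Submodule.span_union, ← ih, Set.image_singleton]
  have hperp : ∀ k w, (∀ j < k, a w (v j) = 0) → w ∈ perp a (S k) := by
    intro k w hw z hz
    rw [hSv] at hz
    refine Submodule.span_induction (p := fun z _ => a w z = 0) ?_ (by simp)
      (fun x y _ _ hx hy => by simp [hx, hy]) (fun s x _ hx => by simp [hx]) hz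
    rintro _ ⟨j, hj, rfl⟩
    exact hw j hj
  have hvS : ∀ j k, j < k → v j ∈ S k := fun j k hjk => by
    rw [hSv]; exact Submodule.subset_span ⟨j, hjk, rfl⟩
  have hSmono : ∀ j k, j ≤ k → S j ≤ S k := fun j k hjk => by
    rw [hSv, hSv]; exact Submodule.span_mono (Set.image_mono fun i hi => lt_of_lt_of_le hi hjk)
  have hpmono : ∀ j k, j ≤ k → perp a (S k) ≤ perp a (S j) := fun j k hjk w hw z hz =>
    hw z (hSmono j k hjk hz)
  -- The construction continues at step `k` as long as `alive k` holds.
  set alive : ℕ → Prop := fun k => ∃ w ∈ perp a (S k), 0 < c (P w) (P w) with halive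
  have hanti : ∀ j k, j ≤ k → alive k → alive j := fun j k hjk ⟨w, hw, hw'⟩ =>
    ⟨w, hpmono j k hjk hw, hw'⟩
  obtain ⟨N, hN⟩ : ∃ N : ℕ∞, ∀ k : ℕ, (k : ℕ∞) < N ↔ alive k := by
    classical
    by_cases hall : ∀ k, alive k
    · exact ⟨⊤, fun k => ⟨fun _ => hall k, fun _ => ENat.natCast_lt_top k⟩⟩
    · push Not at hall
      refine ⟨(Nat.find hall : ℕ), fun k => ?_⟩
      rw [Nat.cast_lt]
      refine ⟨fun hk => not_not.1 (Nat.find_min hall hk), fun hk => ?_⟩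
      by_contra hcon
      exact Nat.find_spec hall (hanti _ _ (not_lt.1 hcon) hk)
  set lam : ℕ → ℝ := fun k => (c (P (v k)) (P (v k)))⁻¹ with hlam
  have hprop := fun k (hk : alive k) => hm (S k) hk
  have horth : ∀ j k, j < k → alive k → a (v k) (v j) = 0 := fun j k hjk hk =>
    (hprop k hk).1 _ (hvS j k hjk)
  have horth' : ∀ j k, j ≠ k → alive j → alive k → a (v k) (v j) = 0 := by
    intro j k hjk hj hk
    rcases lt_or_gt_of_ne hjk with hlt | hlt
    · exact horth j k hlt hk
    · rw [h.symm]; exact horth k j hlt hj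
  have hfd : ∀ k, FiniteDimensional ℝ ↥(S k) := fun k => by
    rw [hSv]; exact FiniteDimensional.span_of_finite ℝ ((Set.finite_Iio k).image v)
  have heig : ∀ k, alive k → IsEigen P a c (lam k) (v k) := by
    intro k
    induction k using Nat.strong_induction_on with
    | _ k ih =>
      intro hk
      obtain ⟨hkW, hk1, hkμ, hkmax, hkEL⟩ := hprop k hk
      refine ⟨fun h0 => ?_, fun φ => ?_⟩
      · have h1 : a (v k) (v k) = 1 := hk1
        rw [h0] at h1; simp at h1
      · have := hfd k
        obtain ⟨z, hz, hzφ⟩ := h.exists_proj (S k) φ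
        have hcz : c (P (v k)) (P z) = 0 := by
          rw [hSv] at hz
          refine Submodule.span_induction (p := fun z _ => c (P (v k)) (P z) = 0) ?_ (by simp)
            (fun x y _ _ hx hy => by simp [hx, hy]) (fun s x _ hx => by simp [hx]) hz
          rintro _ ⟨j, hj, rfl⟩
          rw [h.symm', (ih j hj (hanti j k (le_of_lt hj) hk)).apply h, h.symm, horth j k hj hk,
            mul_zero]
        have h1 := hkEL _ hzφ
        have h2 : a (v k) z = 0 := hkW z hz
        change c (P (v k)) (P (φ - z)) = c (P (v k)) (P (v k)) * a (v k) (φ - z) at h1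
        rw [map_sub, map_sub, map_sub, h2, hcz, sub_zero, sub_zero] at h1
        rw [h1, hlam, inv_mul_cancel_left₀ hkμ.ne']
  -- If the list is infinite, the eigenvalues are unbounded, since `P` is compact.
  have hunb : ∀ t : ℝ, 0 < t → ∃ n : ℕ, (n : ℕ∞) ≤ N ∧ (alive n → t < lam n) := by
    intro t ht
    rcases eq_or_ne N ⊤ with htop | htop
    · by_contra! hcon
      have hall : ∀ k, alive k := fun k => (hN k).1 (by rw [htop]; exact ENat.natCast_lt_top k)
      have hle : ∀ k, lam k ≤ t := fun k => (hcon k (by rw [htop]; exact le_top)).2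
      obtain ⟨m0, hm0, hcoer⟩ := h.coercive
      have h1 : ∀ k, a (v k) (v k) = 1 := fun k => (hprop k (hall k)).2.1
      have hvn : ∀ n, v n ∈ Metric.closedBall (0 : X) (√(1 / m0)) := by
        intro n
        rw [mem_closedBall_zero_iff]
        apply Real.le_sqrt_of_sq_le
        rw [le_div_iff₀ hm0]; nlinarith [hcoer (v n), h1 n]
      obtain ⟨K, hK, hKs⟩ := IsCompactOperator.image_closedBall_subset_compact
        (f := (P : X →ₗ[ℝ] Y)) h.compact (√(1 / m0))
      obtain ⟨y, -, k, hk, hy⟩ := hK.tendsto_subseq (x := fun n => P (v n))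
        (fun n => hKs ⟨v n, hvn n, rfl⟩)
      have hcont : Continuous fun z : Y => c z z := by fun_prop
      have ht1 : Tendsto (fun n => c (P (v (k (n + 1))) - P (v (k n)))
          (P (v (k (n + 1))) - P (v (k n)))) atTop (𝓝 (c (y - y) (y - y))) :=
        (hcont.tendsto _).comp ((hy.comp (tendsto_add_atTop_nat 1)).sub hy)
      rw [sub_self, map_zero] at ht1
      have hge : ∀ i j, i ≠ j → 2 * t⁻¹ ≤ c (P (v i) - P (v j)) (P (v i) - P (v j)) := by
        intro i j hij
        have e1 := h.expand' (P (v i)) (P (v j)) (-1)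
        rw [neg_one_smul, ← sub_eq_add_neg, (heig i (hall i)).apply h,
          (heig i (hall i)).apply h, (heig j (hall j)).apply h, h1, h1,
          horth' j i hij.symm (hall j) (hall i)] at e1
        have e2 : ∀ k, t⁻¹ ≤ (lam k)⁻¹ := fun k => inv_anti₀ ((heig k (hall k)).pos h) (hle k)
        have := e2 i
        have := e2 j
        rw [e1]; linarith
      have h3 := ge_of_tendsto' ht1 (fun n => hge (k (n + 1)) (k n) (hk (Nat.lt_succ_self n)).ne')
      have : 0 < t⁻¹ := inv_pos.2 ht
      linarith
    · obtain ⟨n, rfl⟩ := ENat.ne_top_iff_exists.1 htop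
      exact ⟨n, le_rfl, fun hn => absurd ((hN n).2 hn) (lt_irrefl _)⟩
  refine ⟨N, lam, v, fun k hk => heig k ((hN k).1 hk), fun k l hkl hl => ?_, ?_, ?_⟩
  · have hl' := (hN l).1 hl
    have hk' := hanti k l hkl hl'
    have h1 := (hprop k hk').2.2.2.1 (v l) (hpmono k l hkl (hprop l hl').1)
    rw [show a (v l) (v l) = 1 from (hprop l hl').2.1, mul_one] at h1
    exact inv_anti₀ (hprop l hl').2.2.1 h1
  · rw [linearIndependent_iff']
    intro s g hg i hi
    have h1 : a (∑ j ∈ s, g j • v j) (v i) = g i := by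
      simp only [map_sum, map_smul, sum_apply, smul_apply, smul_eq_mul]
      rw [Finset.sum_eq_single i]
      · rw [show a (v i) (v i) = 1 from (hprop i ((hN i).1 i.2)).2.1, mul_one]
      · intro j _ hji
        rw [horth' i j (fun h0 => hji (Subtype.ext h0.symm)) ((hN i).1 i.2) ((hN j).1 j.2),
          mul_zero]
      · intro h0; exact absurd hi h0
    rw [hg] at h1
    simpa using h1.symm
  · intro t w hw
    obtain ⟨n, hnN, hnt⟩ := hunb t (hw.pos h)
    set F : Submodule ℝ X := Submodule.span ℝ (v '' {k | k < n ∧ lam k = t}) with hF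
    have hfin : FiniteDimensional ℝ F := FiniteDimensional.span_of_finite ℝ
      (((Set.finite_Iio n).subset fun k hk => hk.1).image v)
    have hal : ∀ k, k < n → alive k := fun k hk =>
      (hN k).1 (lt_of_lt_of_le (by exact_mod_cast hk) hnN)
    obtain ⟨z, hz, hzw⟩ := h.exists_proj F w
    have hFle : F ≤ Submodule.span ℝ (v '' {k : ℕ | (k : ℕ∞) < N ∧ lam k = t}) :=
      Submodule.span_mono (Set.image_mono fun k hk => ⟨(hN k).2 (hal k hk.1), hk.2⟩)
    have hFeig : ∀ z ∈ F, ∀ φ, a z φ = t * c (P z) (P φ) := by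
      intro z hz φ
      refine Submodule.span_induction (p := fun z _ => a z φ = t * c (P z) (P φ)) ?_ (by simp)
        (fun x y _ _ hx hy => by
          simp only [map_add, add_apply, hx, hy]; ring)
        (fun s x _ hx => by
          simp only [map_smul, smul_apply, smul_eq_mul, hx]; ring) hz
      rintro _ ⟨k, ⟨hk, hkt⟩, rfl⟩
      rw [← hkt]; exact (heig k (hal k hk)).2 φ
    -- A nonzero `w - z` would be an eigenvector for `t` orthogonal to the first `n` ones, whose
    -- Rayleigh quotient `1 / t` exceeds the maximum `1 / lam n`.
    suffices w - z = 0 by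
      rw [sub_eq_zero] at this
      rw [this]; exact hFle hz
    by_contra hne
    have hwe : IsEigen P a c t (w - z) := by
      refine ⟨hne, fun φ => ?_⟩
      simp only [map_sub, sub_apply, hw.2 φ, hFeig z hz φ]; ring
    have hwp : w - z ∈ perp a (S n) := by
      refine hperp n _ fun j hj => ?_
      by_cases hjt : lam j = t
      · exact hzw _ (Submodule.subset_span ⟨j, ⟨hj, hjt⟩, rfl⟩)
      · exact hwe.orthogonal h (heig j (hal j hj)) (Ne.symm hjt)
    have hpos : 0 < c (P (w - z)) (P (w - z)) := by
      rw [hwe.apply h]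
      exact mul_pos (inv_pos.2 (hw.pos h)) (h.pos hne)
    have hn : alive n := ⟨_, hwp, hpos⟩
    have h1 := (hprop n hn).2.2.2.1 _ hwp
    rw [hwe.apply h] at h1
    have h2 : t⁻¹ ≤ (lam n)⁻¹ := by
      rw [show (lam n)⁻¹ = c (P (v n)) (P (v n)) from inv_inv _]
      exact le_of_mul_le_mul_right h1 (h.pos hne)
    have h3 := hnt hn
    exact absurd (inv_strictAnti₀ (hw.pos h) h3) (not_lt.2 h2)

end EigenList

end

end FormPair

/-! ### Translation estimates for smooth functions -/

/-- The squared `L²(S)` norm, with values in `[0, ∞]`. -/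
noncomputable def sqInt {d : ℕ} {F : Type*} [NormedAddCommGroup F] (f : E d → F) (S : Set (E d)) :
    ℝ≥0∞ :=
  ∫⁻ x in S, ‖f x‖ₑ ^ 2

theorem ennreal_add_sq_le (x y : ℝ≥0∞) : (x + y) ^ 2 ≤ 2 * x ^ 2 + 2 * y ^ 2 := by
  have h := ENNReal.rpow_add_le_mul_rpow_add_rpow x y (p := 2) (by norm_num)
  have e : (2 : ℝ≥0∞) ^ ((2 : ℝ) - 1) = 2 := by norm_num
  rw [e] at h
  simpa [mul_add] using h

theorem enorm_sq_le_of_sub {F : Type*} [NormedAddCommGroup F] (x y : F) :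
    ‖x‖ₑ ^ 2 ≤ 2 * ‖y‖ₑ ^ 2 + 2 * ‖y - x‖ₑ ^ 2 := by
  refine le_trans ?_ (ennreal_add_sq_le _ _)
  gcongr
  calc ‖x‖ₑ = ‖y - (y - x)‖ₑ := by rw [sub_sub_cancel]
    _ ≤ _ := enorm_sub_le

theorem sq_lintegral_le {X : Type*} [MeasurableSpace X] {μ : Measure X} {f : X → ℝ≥0∞}
    (hf : AEMeasurable f μ) : (∫⁻ x, f x ∂μ) ^ 2 ≤ μ Set.univ * ∫⁻ x, f x ^ 2 ∂μ := by
  have h := ENNReal.lintegral_mul_le_Lp_mul_Lq μ (Real.HolderConjugate.two_two) hf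
    (aemeasurable_const (b := (1 : ℝ≥0∞)))
  simp only [Pi.mul_apply, mul_one, ENNReal.one_rpow, lintegral_const, one_mul] at h
  have h2 : ∀ z : ℝ≥0∞, (z ^ (1 / 2 : ℝ)) ^ 2 = z := fun z => by
    rw [← ENNReal.rpow_natCast, ← ENNReal.rpow_mul]; norm_num
  calc (∫⁻ x, f x ∂μ) ^ 2 ≤ ((∫⁻ x, f x ^ (2 : ℝ) ∂μ) ^ (1 / 2 : ℝ) * μ Set.univ ^ (1 / 2 : ℝ)) ^ 2 := by
        gcongr
    _ = _ := by rw [mul_pow, h2, h2, mul_comm]; simp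

section

variable {d : ℕ}

theorem enorm_fderiv_apply_le (φ : E d → ℝ) (x w : E d) :
    ‖fderiv ℝ φ x w‖ₑ ≤ ‖gradient φ x‖ₑ * ‖w‖ₑ := by
  have h1 : ‖fderiv ℝ φ x w‖ ≤ ‖gradient φ x‖ * ‖w‖ := by
    have : ‖gradient φ x‖ = ‖fderiv ℝ φ x‖ := by
      rw [← toDual_gradient, LinearIsometryEquiv.norm_map]
    rw [this]
    exact (fderiv ℝ φ x).le_opNorm w
  rw [enorm_eq_nnnorm, enorm_eq_nnnorm, enorm_eq_nnnorm, ← ENNReal.coe_mul]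
  exact_mod_cast h1

theorem measurable_enorm_gradient_sq {φ : E d → ℝ} (hφ : ContDiff ℝ (⊤ : ℕ∞) φ) :
    Measurable fun x => ‖gradient φ x‖ₑ ^ 2 :=
  (continuous_gradient hφ).enorm.measurable.pow_const 2

/-- The fundamental theorem of calculus along a segment, followed by the Cauchy–Schwarz inequality. -/
theorem enorm_sub_sq_le {φ : E d → ℝ} (hφ : ContDiff ℝ (⊤ : ℕ∞) φ) (x w : E d) {s h : ℝ}
    (hs : 0 ≤ s) (hsh : s ≤ h) :
    ‖φ (x + s • w) - φ x‖ₑ ^ 2 ≤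
      ENNReal.ofReal h * (‖w‖ₑ ^ 2 * ∫⁻ τ in Set.Ioc 0 h, ‖gradient φ (x + τ • w)‖ₑ ^ 2) := by
  have hd : ∀ τ : ℝ, HasDerivAt (fun τ => φ (x + τ • w)) (fderiv ℝ φ (x + τ • w) w) τ := by
    intro τ
    have h1 : HasDerivAt (fun τ : ℝ => x + τ • w) w τ := by
      simpa using ((hasDerivAt_id τ).smul_const w).const_add x
    exact ((hφ.differentiable (by simp)) _).hasFDerivAt.comp_hasDerivAt τ h1
  have hl : Continuous fun τ : ℝ => x + τ • w := by fun_prop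
  have hc : Continuous fun τ : ℝ => fderiv ℝ φ (x + τ • w) w :=
    ((hφ.continuous_fderiv (by simp)).comp hl).clm_apply continuous_const
  have hF := intervalIntegral.integral_eq_sub_of_hasDerivAt (a := 0) (b := s)
    (fun τ _ => hd τ) (hc.intervalIntegrable _ _)
  simp only [zero_smul, add_zero] at hF
  have hg : Measurable fun τ : ℝ => ‖gradient φ (x + τ • w)‖ₑ :=
    (((continuous_gradient hφ).comp hl).enorm).measurable
  have h1 : ‖φ (x + s • w) - φ x‖ₑ ≤ ‖w‖ₑ * ∫⁻ τ in Set.Ioc 0 h, ‖gradient φ (x + τ • w)‖ₑ := by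
    rw [← hF, intervalIntegral.integral_of_le hs]
    refine (enorm_integral_le_lintegral_enorm _).trans ?_
    rw [← lintegral_const_mul _ hg]
    refine (lintegral_mono_set (Set.Ioc_subset_Ioc_right hsh)).trans (lintegral_mono fun τ => ?_)
    rw [mul_comm]
    exact enorm_fderiv_apply_le φ _ w
  calc ‖φ (x + s • w) - φ x‖ₑ ^ 2
      ≤ (‖w‖ₑ * ∫⁻ τ in Set.Ioc 0 h, ‖gradient φ (x + τ • w)‖ₑ) ^ 2 := by gcongr
    _ = ‖w‖ₑ ^ 2 * (∫⁻ τ in Set.Ioc 0 h, ‖gradient φ (x + τ • w)‖ₑ) ^ 2 := by rw [mul_pow]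
    _ ≤ ‖w‖ₑ ^ 2 * (ENNReal.ofReal h *
          ∫⁻ τ in Set.Ioc 0 h, ‖gradient φ (x + τ • w)‖ₑ ^ 2) := by
        gcongr
        refine (sq_lintegral_le hg.aemeasurable).trans ?_
        simp
    _ = _ := by ring

theorem setLIntegral_shift_le {F : E d → ℝ≥0∞} {S U : Set (E d)} (hS : MeasurableSet S)
    (hU : MeasurableSet U) (c : E d) (h : ∀ x ∈ S, x + c ∈ U) :
    ∫⁻ x in S, F (x + c) ≤ ∫⁻ x in U, F x := by
  calc ∫⁻ x in S, F (x + c) ≤ ∫⁻ x in S, U.indicator F (x + c) :=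
        setLIntegral_mono' hS fun x hx => by rw [Set.indicator_of_mem (h x hx)]
    _ ≤ ∫⁻ x, U.indicator F (x + c) := setLIntegral_le_lintegral _ _
    _ = ∫⁻ x, U.indicator F x := lintegral_add_right_eq_self _ c
    _ = ∫⁻ x in U, F x := lintegral_indicator hU _

/-- The `L²` modulus of continuity of a function along a translation that stays in `U` is controlled
by its gradient on `U`. -/
theorem sqInt_shift_sub_le {φ : E d → ℝ} (hφ : ContDiff ℝ (⊤ : ℕ∞) φ) {S U : Set (E d)}
    (hS : MeasurableSet S) (hU : MeasurableSet U) (w : E d)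
    (h : ∀ x ∈ S, ∀ τ ∈ Set.Ioc (0 : ℝ) 1, x + τ • w ∈ U) :
    ∫⁻ x in S, ‖φ (x + w) - φ x‖ₑ ^ 2 ≤ ‖w‖ₑ ^ 2 * sqInt (gradient φ) U := by
  have hm : Measurable fun p : E d × ℝ => ‖gradient φ (p.1 + p.2 • w)‖ₑ ^ 2 :=
    (measurable_enorm_gradient_sq hφ).comp (by fun_prop)
  calc ∫⁻ x in S, ‖φ (x + w) - φ x‖ₑ ^ 2
      ≤ ∫⁻ x in S, ‖w‖ₑ ^ 2 * ∫⁻ τ in Set.Ioc (0 : ℝ) 1, ‖gradient φ (x + τ • w)‖ₑ ^ 2 := by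
        refine lintegral_mono fun x => ?_
        simpa using enorm_sub_sq_le hφ x w zero_le_one le_rfl
    _ = ‖w‖ₑ ^ 2 * ∫⁻ x in S, ∫⁻ τ in Set.Ioc (0 : ℝ) 1, ‖gradient φ (x + τ • w)‖ₑ ^ 2 :=
        lintegral_const_mul _ hm.lintegral_prod_right'
    _ = ‖w‖ₑ ^ 2 * ∫⁻ τ in Set.Ioc (0 : ℝ) 1, ∫⁻ x in S, ‖gradient φ (x + τ • w)‖ₑ ^ 2 := by
        rw [lintegral_lintegral_swap hm.aemeasurable]
    _ ≤ ‖w‖ₑ ^ 2 * ∫⁻ τ in Set.Ioc (0 : ℝ) 1, sqInt (gradient φ) U := by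
        gcongr ‖w‖ₑ ^ 2 * ?_
        exact setLIntegral_mono' measurableSet_Ioc fun τ hτ =>
          setLIntegral_shift_le (F := fun x => ‖gradient φ x‖ₑ ^ 2) hS hU (τ • w)
            fun x hx => h x hx τ hτ
    _ = _ := by simp

/-- A translation inside `U` transports `L²` bounds. -/
theorem sqInt_le_of_shift {φ : E d → ℝ} (hφ : ContDiff ℝ (⊤ : ℕ∞) φ) {S S' U : Set (E d)}
    (hS : MeasurableSet S) (hS' : MeasurableSet S') (hU : MeasurableSet U) (w : E d)
    (h : ∀ x ∈ S, ∀ τ ∈ Set.Ioc (0 : ℝ) 1, x + τ • w ∈ U) (h' : ∀ x ∈ S, x + w ∈ S') :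
    sqInt φ S ≤ 2 * sqInt φ S' + 2 * (‖w‖ₑ ^ 2 * sqInt (gradient φ) U) := by
  calc sqInt φ S ≤ ∫⁻ x in S, (2 * ‖φ (x + w)‖ₑ ^ 2 + 2 * ‖φ (x + w) - φ x‖ₑ ^ 2) :=
        lintegral_mono fun x => enorm_sq_le_of_sub _ _
    _ = 2 * (∫⁻ x in S, ‖φ (x + w)‖ₑ ^ 2) + 2 * ∫⁻ x in S, ‖φ (x + w) - φ x‖ₑ ^ 2 := by
        have hc : Continuous fun x => φ (x + w) := hφ.continuous.comp (by fun_prop)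
        have hc2 : Continuous fun x => φ (x + w) - φ x := hc.sub hφ.continuous
        rw [lintegral_add_left (by exact (hc.enorm.measurable.pow_const 2).const_mul 2),
          lintegral_const_mul _ (hc.enorm.measurable.pow_const 2),
          lintegral_const_mul _ (hc2.enorm.measurable.pow_const 2)]
    _ ≤ _ := by
        gcongr
        · exact setLIntegral_shift_le (F := fun x => ‖φ x‖ₑ ^ 2) hS hS' w h'
        · exact sqInt_shift_sub_le hφ hS hU w h

theorem sqInt_mono {F : Type*} [NormedAddCommGroup F] (f : E d → F) {S T : Set (E d)}
    (h : S ⊆ T) : sqInt f S ≤ sqInt f T := lintegral_mono_set h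

theorem sqInt_union_le {F : Type*} [NormedAddCommGroup F] (f : E d → F) (S T : Set (E d)) :
    sqInt f (S ∪ T) ≤ sqInt f S + sqInt f T := lintegral_union_le _ _ _

/-! ### The cone property -/

/-- Near each point of its closure, `U` is stable under small displacements in the directions of a
ball. -/
def HasConeProperty (U : Set (E d)) : Prop :=
  ∀ x₀ ∈ closure U, ∃ (ν : E d) (κ h r : ℝ), ‖ν‖ ≤ 1 ∧ 0 < κ ∧ κ ≤ 1 ∧ 0 < h ∧ 0 < r ∧
    ∀ x ∈ U ∩ Metric.ball x₀ r, ∀ w ∈ Metric.closedBall ν κ, ∀ t ∈ Set.Icc (0 : ℝ) h, x + t • w ∈ U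

theorem MSGFEM.HasLipschitzBoundary.hasConeProperty {U : Set (E d)} (hL : HasLipschitzBoundary U)
    (hU : IsOpen U) : HasConeProperty U := by
  intro x₀ hx₀
  by_cases hx : x₀ ∈ U
  · obtain ⟨r, hr, hrU⟩ := Metric.isOpen_iff.1 hU x₀ hx
    refine ⟨0, 1, r / 2, r / 2, by simp, one_pos, le_rfl, by positivity, by positivity, ?_⟩
    rintro y ⟨-, hy⟩ w hw t ⟨ht0, ht1⟩
    apply hrU
    rw [Metric.mem_ball, dist_eq_norm] at hy ⊢
    rw [mem_closedBall_zero_iff] at hw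
    have h2 : ‖t • w‖ ≤ r / 2 := by
      rw [norm_smul, Real.norm_of_nonneg ht0]
      nlinarith [norm_nonneg w]
    calc ‖y + t • w - x₀‖ = ‖(y - x₀) + t • w‖ := by congr 1; abel
      _ ≤ ‖y - x₀‖ + ‖t • w‖ := norm_add_le _ _
      _ < r := by linarith
  · have hfr : x₀ ∈ frontier U := ⟨hx₀, by rwa [hU.interior_eq]⟩
    obtain ⟨ν, K, g, r, hν, hg, hr, hy⟩ := hL x₀ hfr
    -- The aperture `κ` is chosen so that `2 K κ ≤ 1 - κ`.
    set κ : ℝ := 1 / (2 * K + 1) with hκ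
    have hK : (0 : ℝ) ≤ K := K.2
    have hκ0 : 0 < κ := by positivity
    have hκ1 : κ ≤ 1 := by rw [hκ, div_le_one (by positivity)]; linarith
    have hκK : 2 * K * κ = 1 - κ := by rw [hκ]; field_simp; ring
    refine ⟨ν, κ, r / 4, r / 4, hν.le, hκ0, hκ1, by positivity, by positivity, ?_⟩
    rintro y ⟨hyU, hyb⟩ w hw t ⟨ht0, ht1⟩
    rw [Metric.mem_ball, dist_eq_norm] at hyb
    rw [Metric.mem_closedBall, dist_eq_norm] at hw
    have hwn : ‖w‖ ≤ 2 := by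
      calc ‖w‖ = ‖(w - ν) + ν‖ := by rw [sub_add_cancel]
        _ ≤ ‖w - ν‖ + ‖ν‖ := norm_add_le _ _
        _ ≤ 2 := by rw [hν]; linarith
    have hb1 : y ∈ Metric.ball x₀ r := by
      rw [Metric.mem_ball, dist_eq_norm]; linarith
    have hb2 : y + t • w ∈ Metric.ball x₀ r := by
      rw [Metric.mem_ball, dist_eq_norm]
      have h2 : ‖t • w‖ ≤ r / 2 := by
        rw [norm_smul, Real.norm_of_nonneg ht0]
        nlinarith [norm_nonneg w]
      calc ‖y + t • w - x₀‖ = ‖(y - x₀) + t • w‖ := by congr 1; abel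
        _ ≤ ‖y - x₀‖ + ‖t • w‖ := norm_add_le _ _
        _ < r := by linarith
    rw [hy _ hb2]
    have h1 := (hy _ hb1).1 hyU
    have hin : inner ℝ ν w ≥ 1 - κ := by
      have e1 : inner ℝ ν w = inner ℝ ν (w - ν) + 1 := by
        rw [inner_sub_right, real_inner_self_eq_norm_sq, hν]; ring
      have e2 := abs_real_inner_le_norm ν (w - ν)
      rw [hν, one_mul] at e2
      have := neg_abs_le (inner ℝ ν (w - ν))
      rw [e1]; linarith
    have hproj : ‖w - inner ℝ ν w • ν‖ ≤ 2 * κ := by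
      have e1 : w - inner ℝ ν w • ν = (w - ν) - inner ℝ ν (w - ν) • ν := by
        rw [inner_sub_right, real_inner_self_eq_norm_sq, hν, sub_smul]; simp
      have e2 := abs_real_inner_le_norm ν (w - ν)
      rw [hν, one_mul] at e2
      rw [e1]
      refine (norm_sub_le _ _).trans ?_
      rw [norm_smul, hν, Real.norm_eq_abs]; linarith
    have hgl : g (y + t • w - inner ℝ ν (y + t • w) • ν) ≤
        g (y - inner ℝ ν y • ν) + K * (t * (2 * κ)) := by
      have e1 := hg.dist_le_mul (y + t • w - inner ℝ ν (y + t • w) • ν) (y - inner ℝ ν y • ν)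
      rw [Real.dist_eq, dist_eq_norm] at e1
      have e2 : y + t • w - inner ℝ ν (y + t • w) • ν - (y - inner ℝ ν y • ν) =
          t • (w - inner ℝ ν w • ν) := by
        rw [inner_add_right, inner_smul_right, add_smul, smul_sub, mul_smul]; abel
      rw [e2, norm_smul, Real.norm_of_nonneg ht0] at e1
      have e3 := le_abs_self (g (y + t • w - inner ℝ ν (y + t • w) • ν) - g (y - inner ℝ ν y • ν))
      have e4 : (K : ℝ) * (t * ‖w - inner ℝ ν w • ν‖) ≤ K * (t * (2 * κ)) := by gcongr
      linarith
    rw [inner_add_right, inner_smul_right]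
    rw [inner_add_right, inner_smul_right] at hgl
    have : K * (t * (2 * κ)) = t * (1 - κ) := by rw [← hκK]; ring
    nlinarith

theorem lintegral_shift_sub_le {φ : E d → ℝ} (hφ : ContDiff ℝ (⊤ : ℕ∞) φ) {S U W : Set (E d)}
    (hS : MeasurableSet S) (hU : MeasurableSet U) (hW : MeasurableSet W) {R : ℝ≥0∞}
    (hR : ∀ w ∈ W, ‖w‖ₑ ≤ R)
    (h : ∀ x ∈ S, ∀ w ∈ W, ∀ τ ∈ Set.Ioc (0 : ℝ) 1, x + τ • w ∈ U) :
    ∫⁻ x in S, ∫⁻ w in W, ‖φ (x + w) - φ x‖ₑ ^ 2 ≤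
      volume W * (R ^ 2 * sqInt (gradient φ) U) := by
  have hc := hφ.continuous
  have hm : Continuous fun p : E d × E d => φ (p.1 + p.2) - φ p.1 := by fun_prop
  rw [lintegral_lintegral_swap (hm.enorm.measurable.pow_const 2).aemeasurable]
  calc ∫⁻ w in W, ∫⁻ x in S, ‖φ (x + w) - φ x‖ₑ ^ 2
      ≤ ∫⁻ w in W, R ^ 2 * sqInt (gradient φ) U := by
        refine setLIntegral_mono' hW fun w hw => ?_
        refine (sqInt_shift_sub_le hφ hS hU w fun x hx τ hτ => h x hx w hw τ hτ).trans ?_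
        gcongr
        exact hR w hw
    _ = _ := by rw [setLIntegral_const, mul_comm]

/-! ### A Poincaré inequality by propagation along the domain -/

/-- The squared `L²(S)` norm of smooth functions is bounded by a multiple of `N`. -/
def IsControlled (N : (E d → ℝ) → ℝ≥0∞) (S : Set (E d)) : Prop :=
  ∃ C : NNReal, ∀ φ : E d → ℝ, ContDiff ℝ (⊤ : ℕ∞) φ → sqInt φ S ≤ C * N φ

theorem IsControlled.mono {N : (E d → ℝ) → ℝ≥0∞} {S T : Set (E d)} (h : IsControlled N T)
    (hST : S ⊆ T) : IsControlled N S := by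
  obtain ⟨C, hC⟩ := h
  exact ⟨C, fun φ hφ => (sqInt_mono φ hST).trans (hC φ hφ)⟩

theorem IsControlled.union {N : (E d → ℝ) → ℝ≥0∞} {S T : Set (E d)} (hS : IsControlled N S)
    (hT : IsControlled N T) : IsControlled N (S ∪ T) := by
  obtain ⟨C, hC⟩ := hS
  obtain ⟨D, hD⟩ := hT
  refine ⟨C + D, fun φ hφ => (sqInt_union_le φ S T).trans ?_⟩
  rw [ENNReal.coe_add, add_mul]
  exact add_le_add (hC φ hφ) (hD φ hφ)

theorem IsControlled.of_shift {N : (E d → ℝ) → ℝ≥0∞} {S S' U : Set (E d)}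
    (hN : ∀ φ, sqInt (gradient φ) U ≤ N φ) (h' : IsControlled N S') (hS : MeasurableSet S)
    (hS' : MeasurableSet S') (hU : MeasurableSet U) (w : E d)
    (h1 : ∀ x ∈ S, ∀ τ ∈ Set.Ioc (0 : ℝ) 1, x + τ • w ∈ U) (h2 : ∀ x ∈ S, x + w ∈ S') :
    IsControlled N S := by
  obtain ⟨C, hC⟩ := h'
  refine ⟨2 * C + 2 * ‖w‖₊ ^ 2, fun φ hφ => ?_⟩
  refine (sqInt_le_of_shift hφ hS hS' hU w h1 h2).trans ?_
  calc 2 * sqInt φ S' + 2 * (‖w‖ₑ ^ 2 * sqInt (gradient φ) U)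
      ≤ 2 * (C * N φ) + 2 * (‖w‖ₑ ^ 2 * N φ) := by
        gcongr
        · exact hC φ hφ
        · exact hN φ
    _ = _ := by
      rw [enorm_eq_nnnorm]; push_cast; ring

/-- If smooth functions are controlled by `N` on a ball of the connected set `U`, and `N` dominates
the Dirichlet integral over `U`, then they are controlled on all of `U`: the points with a controlled
neighbourhood form an open and closed subset of `U`, and the cone property moves a neighbourhood of a
boundary point into the interior. -/
theorem isControlled_of_ball {N : (E d → ℝ) → ℝ≥0∞} {U : Set (E d)} (hU : IsOpen U)
    (hUc : IsPreconnected U) (hUb : Bornology.IsBounded U) (hcone : HasConeProperty U)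
    (hN : ∀ φ, sqInt (gradient φ) U ≤ N φ)
    (h : ∃ x ∈ U, ∃ r > 0, IsControlled N (U ∩ Metric.ball x r)) : IsControlled N U := by
  set G : Set (E d) := {x | ∃ r > 0, IsControlled N (U ∩ Metric.ball x r)} with hG
  have hGo : IsOpen G := by
    rw [Metric.isOpen_iff]
    rintro x ⟨r, hr, hc⟩
    refine ⟨r / 2, by positivity, fun y hy => ⟨r / 2, by positivity, hc.mono ?_⟩⟩
    refine Set.inter_subset_inter_right _ (Metric.ball_subset_ball' ?_)
    rw [Metric.mem_ball] at hy; linarith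
  have hUG : U ⊆ G := by
    refine hUc.subset_of_closure_inter_subset hGo ?_ ?_
    · obtain ⟨x, hx, hr⟩ := h
      exact ⟨x, hx, hr⟩
    · rintro x ⟨hxG, hxU⟩
      obtain ⟨R, hR, hRU⟩ := Metric.isOpen_iff.1 hU x hxU
      obtain ⟨y, ⟨r, hr, hc⟩, hxy⟩ := Metric.mem_closure_iff.1 hxG (R / 2) (by positivity)
      refine ⟨min r (R / 2), by positivity, ?_⟩
      have hb : ∀ z ∈ U ∩ Metric.ball x (min r (R / 2)), ∀ τ ∈ Set.Ioc (0 : ℝ) 1,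
          z + τ • (y - x) ∈ U := by
        rintro z ⟨-, hz⟩ τ ⟨hτ0, hτ1⟩
        apply hRU
        rw [Metric.mem_ball, dist_eq_norm] at hz ⊢
        have h1 : ‖τ • (y - x)‖ ≤ ‖y - x‖ := by
          rw [norm_smul, Real.norm_of_nonneg hτ0.le]
          nlinarith [norm_nonneg (y - x)]
        rw [dist_comm, dist_eq_norm] at hxy
        have h2 := min_le_right r (R / 2)
        calc ‖z + τ • (y - x) - x‖ = ‖(z - x) + τ • (y - x)‖ := by congr 1; abel
          _ ≤ ‖z - x‖ + ‖τ • (y - x)‖ := norm_add_le _ _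
          _ < R := by linarith
      refine hc.of_shift hN (hU.measurableSet.inter measurableSet_ball)
        (hU.measurableSet.inter measurableSet_ball) hU.measurableSet (y - x) hb ?_
      intro z hz
      refine ⟨by simpa using hb z hz 1 (by simp), ?_⟩
      have h1 := hz.2
      rw [Metric.mem_ball, dist_eq_norm] at h1 ⊢
      rw [show z + (y - x) - y = z - x by abel]
      exact lt_of_lt_of_le h1 (min_le_left _ _)
  have hcl : closure U ⊆ G := by
    intro x hx
    obtain ⟨ν, κ, h, r, -, hκ, -, hh, hr, hC⟩ := hcone x hx
    have hxU : x + h • ν ∈ U := by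
      obtain ⟨y, hyU, hxy⟩ := Metric.mem_closure_iff.1 hx (min r (h * κ)) (by positivity)
      have h1 := hC y ⟨hyU, by
        rw [Metric.mem_ball, dist_comm]; exact hxy.trans_le (min_le_left _ _)⟩
        (ν + h⁻¹ • (x - y)) (by
          rw [Metric.mem_closedBall, dist_eq_norm, add_sub_cancel_left, norm_smul,
            Real.norm_of_nonneg (inv_nonneg.2 hh.le), ← dist_eq_norm, inv_mul_le_iff₀ hh]
          exact hxy.le.trans (min_le_right _ _)) h ⟨hh.le, le_rfl⟩
      rwa [smul_add, smul_inv_smul₀ hh.ne',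
        show y + (h • ν + (x - y)) = x + h • ν by abel] at h1
    obtain ⟨r', hr', hc⟩ := hUG hxU
    refine ⟨min r r', by positivity, ?_⟩
    have hb : ∀ z ∈ U ∩ Metric.ball x (min r r'), ∀ τ ∈ Set.Ioc (0 : ℝ) 1, z + τ • (h • ν) ∈ U := by
      rintro z ⟨hzU, hz⟩ τ ⟨hτ0, hτ1⟩
      rw [smul_smul]
      exact hC z ⟨hzU, Metric.ball_subset_ball (min_le_left _ _) hz⟩ ν
        (Metric.mem_closedBall_self hκ.le) _ ⟨by positivity, by nlinarith⟩
    refine hc.of_shift hN (hU.measurableSet.inter measurableSet_ball)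
      (hU.measurableSet.inter measurableSet_ball) hU.measurableSet (h • ν) hb ?_
    intro z hz
    refine ⟨by simpa using hb z hz 1 (by simp), ?_⟩
    have h1 := hz.2
    rw [Metric.mem_ball, dist_eq_norm] at h1 ⊢
    rw [add_sub_add_right_eq_sub]
    exact lt_of_lt_of_le h1 (min_le_right _ _)
  have hfin : IsControlled N (U ∩ closure U) := by
    refine hUb.isCompact_closure.induction_on (p := fun s => IsControlled N (U ∩ s)) ?_ ?_ ?_ ?_
    · exact ⟨0, fun φ _ => by simp [sqInt]⟩
    · exact fun s t hst ht => ht.mono (Set.inter_subset_inter_right _ hst)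
    · intro s t hs ht
      rw [Set.inter_union_distrib_left]
      exact hs.union ht
    · intro x hx
      obtain ⟨r, hr, hc⟩ := hcl hx
      exact ⟨Metric.ball x r, mem_nhdsWithin_of_mem_nhds (Metric.ball_mem_nhds x hr), hc⟩
  rwa [Set.inter_eq_left.2 subset_closure] at hfin

/-- Control on a set of positive measure implies control on some ball, by averaging over all
translations from points of the set to points of the ball. -/
theorem exists_isControlled_ball {N : (E d → ℝ) → ℝ≥0∞} {U D : Set (E d)} (hU : IsOpen U)
    (hN : ∀ φ, sqInt (gradient φ) U ≤ N φ) (hD : MeasurableSet D) (hDU : D ⊆ U)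
    (hDpos : volume D ≠ 0) (hDc : IsControlled N D) :
    ∃ x ∈ U, ∃ r > 0, IsControlled N (U ∩ Metric.ball x r) := by
  obtain ⟨x, hxD, hx⟩ := exists_mem_forall_mem_nhdsWithin_pos_measure hDpos
  obtain ⟨R, hR, hRU⟩ := Metric.isOpen_iff.1 hU x (hDU hxD)
  refine ⟨x, hDU hxD, R / 4, by positivity, ?_⟩
  set D' := D ∩ Metric.ball x (R / 4) with hD'
  have hD'm : MeasurableSet D' := hD.inter measurableSet_ball
  have hD'pos : volume D' ≠ 0 :=
    (hx _ (inter_mem_nhdsWithin _ (Metric.ball_mem_nhds x (by positivity)))).ne'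
  have hD'fin : volume D' ≠ ∞ :=
    ne_top_of_le_ne_top measure_ball_lt_top.ne (measure_mono (Set.inter_subset_right))
  set B := U ∩ Metric.ball x (R / 4) with hB
  have hBm : MeasurableSet B := hU.measurableSet.inter measurableSet_ball
  have hBfin : volume B ≠ ∞ :=
    ne_top_of_le_ne_top measure_ball_lt_top.ne (measure_mono (Set.inter_subset_right))
  set W := Metric.ball (0 : E d) (R / 2) with hW
  have hWfin : volume W ≠ ∞ := measure_ball_lt_top.ne
  obtain ⟨C, hC⟩ := hDc
  refine ⟨((volume D')⁻¹ * (2 * volume B * C + 2 * (volume W * ENNReal.ofReal (R / 2) ^ 2))).toNNReal,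
    fun φ hφ => ?_⟩
  rw [ENNReal.coe_toNNReal (by finiteness), mul_assoc,
    ← ENNReal.mul_le_iff_le_inv hD'pos hD'fin]
  have hc := hφ.continuous
  have hm1 : Continuous fun p : E d × E d => φ p.2 := by fun_prop
  calc volume D' * sqInt φ B = ∫⁻ y in D', ∫⁻ z in B, ‖φ z‖ₑ ^ 2 := by
        rw [setLIntegral_const, mul_comm]; rfl
    _ ≤ ∫⁻ y in D', (2 * volume B * ‖φ y‖ₑ ^ 2 + 2 * ∫⁻ w in W, ‖φ (y + w) - φ y‖ₑ ^ 2) := by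
        refine setLIntegral_mono' hD'm fun y hy => ?_
        calc ∫⁻ z in B, ‖φ z‖ₑ ^ 2 ≤ ∫⁻ z in B, (2 * ‖φ y‖ₑ ^ 2 + 2 * ‖φ z - φ y‖ₑ ^ 2) := by
              refine lintegral_mono fun z => ?_
              have := enorm_sq_le_of_sub (φ z) (φ y)
              rwa [enorm_sub_rev] at this
          _ = 2 * volume B * ‖φ y‖ₑ ^ 2 + 2 * ∫⁻ z in B, ‖φ z - φ y‖ₑ ^ 2 := by
              have hc3 : Continuous fun z => φ z - φ y := by fun_prop
              rw [lintegral_add_left measurable_const, setLIntegral_const,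
                lintegral_const_mul _ (hc3.enorm.measurable.pow_const 2)]
              ring
          _ ≤ _ := by
              gcongr 2 * volume B * ‖φ y‖ₑ ^ 2 + 2 * ?_
              have h1 := setLIntegral_shift_le (F := fun w => ‖φ (y + w) - φ y‖ₑ ^ 2) hBm
                (measurableSet_ball (x := (0 : E d)) (ε := R / 2)) (-y) (fun z hz => by
                  have e1 := hz.2
                  have e2 := hy.2
                  rw [Metric.mem_ball] at e1 e2
                  rw [mem_ball_zero_iff, ← sub_eq_add_neg, ← dist_eq_norm]
                  linarith [dist_triangle_right z y x])
              simpa using h1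
    _ = 2 * volume B * sqInt φ D' + 2 * ∫⁻ y in D', ∫⁻ w in W, ‖φ (y + w) - φ y‖ₑ ^ 2 := by
        have hm : Continuous fun p : E d × E d => φ (p.1 + p.2) - φ p.1 := by fun_prop
        rw [lintegral_add_left ((hc.enorm.measurable.pow_const 2).const_mul _),
          lintegral_const_mul _ (hc.enorm.measurable.pow_const 2),
          lintegral_const_mul _ ((hm.enorm.measurable.pow_const 2).lintegral_prod_right')]
        rfl
    _ ≤ 2 * volume B * (C * N φ) +
          2 * (volume W * (ENNReal.ofReal (R / 2) ^ 2 * N φ)) := by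
        gcongr
        · exact (sqInt_mono φ Set.inter_subset_left).trans (hC φ hφ)
        · refine (lintegral_shift_sub_le hφ hD'm hU.measurableSet measurableSet_ball
            (R := ENNReal.ofReal (R / 2)) ?_ ?_).trans ?_
          · intro w hw
            rw [mem_ball_zero_iff] at hw
            rw [← ofReal_norm]
            exact ENNReal.ofReal_le_ofReal hw.le
          · rintro y ⟨-, hy⟩ w hw τ ⟨hτ0, hτ1⟩
            apply hRU
            rw [Metric.mem_ball, dist_eq_norm] at hy ⊢
            rw [mem_ball_zero_iff] at hw
            have h1 : ‖τ • w‖ ≤ ‖w‖ := by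
              rw [norm_smul, Real.norm_of_nonneg hτ0.le]
              nlinarith [norm_nonneg w]
            calc ‖y + τ • w - x‖ = ‖(y - x) + τ • w‖ := by congr 1; abel
              _ ≤ ‖y - x‖ + ‖τ • w‖ := norm_add_le _ _
              _ < R := by linarith
          · gcongr
            exact hN φ
    _ = _ := by ring

/-! ### Compactness in `L²` of sets bounded in `H¹` -/

/-- On `U ∩ s`, up to a small multiple of the Dirichlet integral, the `L²` norm is controlled by
finitely many integral functionals. -/
def HasFiniteApprox (U s : Set (E d)) : Prop :=
  ∀ η : NNReal, 0 < η → ∃ (T : Finset (Set (E d))) (C : NNReal),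
    (∀ B ∈ T, MeasurableSet B ∧ B ⊆ U) ∧ ∀ φ : E d → ℝ, ContDiff ℝ (⊤ : ℕ∞) φ →
      sqInt φ (U ∩ s) ≤ η * sqInt (gradient φ) U + C * ∑ B ∈ T, ‖∫ x in B, φ x‖ₑ ^ 2

theorem HasFiniteApprox.union {U s t : Set (E d)} (hs : HasFiniteApprox U s)
    (ht : HasFiniteApprox U t) : HasFiniteApprox U (s ∪ t) := by
  classical
  intro η hη
  obtain ⟨T1, C1, hT1, h1⟩ := hs (η / 2) (by positivity)
  obtain ⟨T2, C2, hT2, h2⟩ := ht (η / 2) (by positivity)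
  refine ⟨T1 ∪ T2, C1 + C2, fun B hB => ?_, fun φ hφ => ?_⟩
  · rcases Finset.mem_union.1 hB with hB | hB
    · exact hT1 B hB
    · exact hT2 B hB
  · rw [Set.inter_union_distrib_left]
    have e : (η : ℝ≥0∞) = ((η / 2 : NNReal) : ℝ≥0∞) + ((η / 2 : NNReal) : ℝ≥0∞) := by
      rw [← ENNReal.coe_add, add_halves]
    calc sqInt φ (U ∩ s ∪ U ∩ t) ≤ sqInt φ (U ∩ s) + sqInt φ (U ∩ t) := sqInt_union_le _ _ _
      _ ≤ _ := add_le_add (h1 φ hφ) (h2 φ hφ)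
      _ ≤ (((η / 2 : NNReal) : ℝ≥0∞) * sqInt (gradient φ) U +
            C1 * ∑ B ∈ T1 ∪ T2, ‖∫ x in B, φ x‖ₑ ^ 2) +
          (((η / 2 : NNReal) : ℝ≥0∞) * sqInt (gradient φ) U +
            C2 * ∑ B ∈ T1 ∪ T2, ‖∫ x in B, φ x‖ₑ ^ 2) := by
          gcongr
          · exact Finset.subset_union_left
          · exact Finset.subset_union_right
      _ = _ := by rw [e, ENNReal.coe_add]; ring

/-- Near `x₀` a function is compared with its averages over finitely many small balls, each obtained
by moving a point of a finite net into the domain along the cone. -/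
theorem hasFiniteApprox_ball {U : Set (E d)} (hU : IsOpen U) (hcone : HasConeProperty U) {x₀ : E d}
    (hx₀ : x₀ ∈ closure U) : ∃ r > 0, HasFiniteApprox U (Metric.ball x₀ r) := by
  classical
  obtain ⟨ν, κ, h, r, hν, hκ, hκ1, hh, hr, hC⟩ := hcone x₀ hx₀
  refine ⟨r, hr, fun η hη => ?_⟩
  obtain ⟨t, ht0, hth, htη⟩ : ∃ t : ℝ, 0 < t ∧ t ≤ h ∧ 2 ^ (d + 3) * t ^ 2 ≤ (η : ℝ) := by
    have hη' : (0 : ℝ) < η := hη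
    refine ⟨min h (√(η / 2 ^ (d + 3))), by positivity, min_le_left _ _, ?_⟩
    calc (2 : ℝ) ^ (d + 3) * (min h (√((η : ℝ) / 2 ^ (d + 3)))) ^ 2
        ≤ (2 : ℝ) ^ (d + 3) * (√((η : ℝ) / 2 ^ (d + 3))) ^ 2 := by
          gcongr; exact min_le_right _ _
      _ = (η : ℝ) := by rw [Real.sq_sqrt (by positivity)]; field_simp
  set S := U ∩ Metric.ball x₀ r with hS
  have hSm : MeasurableSet S := hU.measurableSet.inter measurableSet_ball
  have hSfin : volume S ≠ ∞ :=
    ne_top_of_le_ne_top measure_ball_lt_top.ne (measure_mono (Set.inter_subset_right))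
  have hSb : TotallyBounded S :=
    (isCompact_closedBall x₀ r).totallyBounded.subset
      (Set.inter_subset_right.trans Metric.ball_subset_closedBall)
  obtain ⟨F, hFS, hFfin, hFcov⟩ := Metric.finite_approx_of_totallyBounded hSb (t * κ / 2) (by positivity)
  set b := volume (Metric.ball (0 : E d) (t * κ / 2)) with hb
  have hb0 : b ≠ 0 := (Metric.measure_ball_pos _ _ (by positivity)).ne'
  have hbfin : b ≠ ∞ := measure_ball_lt_top.ne
  set W := Metric.ball (t • ν) (t * κ) with hW
  have hWb : volume W = 2 ^ d * b := by
    rw [hb, hW, Measure.addHaar_ball_of_pos volume (t • ν) (by positivity : 0 < t * κ),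
      Measure.addHaar_ball_of_pos volume (0 : E d) (by positivity : 0 < t * κ / 2), ← mul_assoc, finrank_euclideanSpace_fin]
    congr 1
    rw [show t * κ = 2 * (t * κ / 2) by ring, mul_pow, ENNReal.ofReal_mul (by positivity),
      ENNReal.ofReal_pow (by norm_num)]
    norm_num
  let Bf : E d → Set (E d) := fun y => Metric.ball (y + t • ν) (t * κ / 2)
  have hvolB : ∀ y, volume (Bf y) = b := fun y => by
    simp only [Bf, hb, Measure.addHaar_ball_center]
  have hsm : ∀ w ∈ W, t⁻¹ • w ∈ Metric.closedBall ν κ := by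
    intro w hw
    rw [hW, Metric.mem_ball, dist_eq_norm] at hw
    rw [Metric.mem_closedBall, dist_eq_norm,
      show t⁻¹ • w - ν = t⁻¹ • (w - t • ν) by rw [smul_sub, inv_smul_smul₀ ht0.ne'], norm_smul,
      Real.norm_of_nonneg (inv_nonneg.2 ht0.le), inv_mul_le_iff₀ ht0]
    exact hw.le
  have hWU : ∀ x ∈ S, ∀ w ∈ W, ∀ τ ∈ Set.Ioc (0 : ℝ) 1, x + τ • w ∈ U := by
    rintro x hx w hw τ ⟨hτ0, hτ1⟩
    have h1 := hC x hx _ (hsm w hw) (τ * t) ⟨by positivity, by nlinarith⟩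
    rwa [smul_smul, mul_assoc, mul_inv_cancel₀ ht0.ne', mul_one] at h1
  have hBW : ∀ x y, x ∈ Metric.ball y (t * κ / 2) → ∀ z ∈ Bf y, z - x ∈ W := by
    intro x y hxy z hz
    simp only [Bf] at hz
    rw [Metric.mem_ball, dist_eq_norm] at hxy hz
    rw [hW, Metric.mem_ball, dist_eq_norm]
    calc ‖z - x - t • ν‖ = ‖(z - (y + t • ν)) - (x - y)‖ := by congr 1; abel
      _ ≤ ‖z - (y + t • ν)‖ + ‖x - y‖ := norm_sub_le _ _
      _ < t * κ := by linarith
  have hWn : ∀ w ∈ W, ‖w‖ₑ ≤ ENNReal.ofReal (2 * t) := by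
    intro w hw
    rw [hW, Metric.mem_ball, dist_eq_norm] at hw
    rw [← ofReal_norm]
    refine ENNReal.ofReal_le_ofReal ?_
    have e1 : ‖t • ν‖ ≤ t := by
      rw [norm_smul, Real.norm_of_nonneg ht0.le]; nlinarith
    calc ‖w‖ = ‖(w - t • ν) + t • ν‖ := by rw [sub_add_cancel]
      _ ≤ ‖w - t • ν‖ + ‖t • ν‖ := norm_add_le _ _
      _ ≤ 2 * t := by nlinarith
  refine ⟨hFfin.toFinset.image Bf, (b⁻¹ ^ 2 * (2 * volume S)).toNNReal, ?_, fun φ hφ => ?_⟩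
  · intro B hB
    obtain ⟨y, hy, rfl⟩ := Finset.mem_image.1 hB
    have hyS := hFS (hFfin.mem_toFinset.1 hy)
    refine ⟨measurableSet_ball, fun z hz => ?_⟩
    have h1 := hWU y hyS _ (hBW y y (Metric.mem_ball_self (by positivity)) z hz) 1 (by simp)
    simpa using h1
  rw [ENNReal.coe_toNNReal (by finiteness)]
  have hc := hφ.continuous
  set q := ∑ B ∈ hFfin.toFinset.image Bf, ‖∫ x in B, φ x‖ₑ ^ 2 with hq
  -- `b φ(x) = ∫_B φ - ∫_B (φ - φ(x))`, where the ball `B` comes from the net point nearest to `x`;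
  -- the second term is estimated over the larger set `x + W`, which does not depend on the net.
  have hpt : ∀ x ∈ S, b ^ 2 * ‖φ x‖ₑ ^ 2 ≤
      2 * q + 2 * (b * ∫⁻ w in W, ‖φ (x + w) - φ x‖ₑ ^ 2) := by
    intro x hx
    obtain ⟨y, hyF, hxy⟩ := Set.mem_iUnion₂.1 (hFcov hx)
    have hcz : Continuous fun z => φ z - φ x := by fun_prop
    have hint : IntegrableOn φ (Bf y) :=
      (hc.continuousOn.integrableOn_compact (isCompact_closedBall (y + t • ν) (t * κ / 2))).mono_set
        Metric.ball_subset_closedBall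
    have h0 : b * ‖φ x‖ₑ ≤ ‖∫ z in Bf y, φ z‖ₑ + ∫⁻ z in Bf y, ‖φ z - φ x‖ₑ := by
      have e1 : ∫ z in Bf y, (φ z - φ x) = (∫ z in Bf y, φ z) - b.toReal * φ x := by
        rw [integral_sub hint (integrable_const_iff.2 (Or.inr ⟨by
          rw [Measure.restrict_apply_univ, hvolB]; exact hbfin.lt_top⟩)), setIntegral_const,
          smul_eq_mul, measureReal_def, hvolB]
      have e2 : ‖b.toReal * φ x‖ₑ = b * ‖φ x‖ₑ := by
        rw [enorm_mul, Real.enorm_of_nonneg ENNReal.toReal_nonneg, ENNReal.ofReal_toReal hbfin]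
      rw [← e2, show b.toReal * φ x = (∫ z in Bf y, φ z) - ∫ z in Bf y, (φ z - φ x) by
        rw [e1]; ring]
      refine (enorm_sub_le).trans ?_
      gcongr
      exact enorm_integral_le_lintegral_enorm _
    calc b ^ 2 * ‖φ x‖ₑ ^ 2 = (b * ‖φ x‖ₑ) ^ 2 := by rw [mul_pow]
      _ ≤ (‖∫ z in Bf y, φ z‖ₑ + ∫⁻ z in Bf y, ‖φ z - φ x‖ₑ) ^ 2 := by gcongr
      _ ≤ 2 * ‖∫ z in Bf y, φ z‖ₑ ^ 2 + 2 * (∫⁻ z in Bf y, ‖φ z - φ x‖ₑ) ^ 2 :=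
          ennreal_add_sq_le _ _
      _ ≤ _ := by
          gcongr
          · exact Finset.single_le_sum (f := fun B => ‖∫ x in B, φ x‖ₑ ^ 2) (fun _ _ => zero_le)
              (Finset.mem_image_of_mem Bf (hFfin.mem_toFinset.2 hyF))
          · refine (sq_lintegral_le hcz.enorm.measurable.aemeasurable).trans ?_
            rw [Measure.restrict_apply_univ, hvolB]
            gcongr b * ?_
            have h1 := setLIntegral_shift_le (F := fun w => ‖φ (x + w) - φ x‖ₑ ^ 2)
              (measurableSet_ball (x := y + t • ν) (ε := t * κ / 2))
              (measurableSet_ball (x := t • ν) (ε := t * κ)) (-x) (fun z hz => by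
                rw [← sub_eq_add_neg]; exact hBW x y hxy z hz)
            simpa using h1
  have hm : Continuous fun p : E d × E d => φ (p.1 + p.2) - φ p.1 := by fun_prop
  have hkey : b ^ 2 * sqInt φ S ≤ b ^ 2 * (η * sqInt (gradient φ) U + b⁻¹ ^ 2 * (2 * volume S) * q) := by
    calc b ^ 2 * sqInt φ S = ∫⁻ x in S, b ^ 2 * ‖φ x‖ₑ ^ 2 :=
          (lintegral_const_mul _ (hc.enorm.measurable.pow_const 2)).symm
      _ ≤ ∫⁻ x in S, (2 * q + 2 * (b * ∫⁻ w in W, ‖φ (x + w) - φ x‖ₑ ^ 2)) :=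
          setLIntegral_mono' hSm hpt
      _ = 2 * q * volume S + 2 * (b * ∫⁻ x in S, ∫⁻ w in W, ‖φ (x + w) - φ x‖ₑ ^ 2) := by
          have hm' := (hm.enorm.measurable.pow_const 2).lintegral_prod_right' (ν := volume.restrict W)
          rw [lintegral_add_left measurable_const, setLIntegral_const,
            lintegral_const_mul _ (hm'.const_mul b), lintegral_const_mul _ hm']
      _ ≤ 2 * q * volume S + 2 * (b * (2 ^ d * b *
            (ENNReal.ofReal (2 * t) ^ 2 * sqInt (gradient φ) U))) := by
          gcongr
          rw [← hWb]
          exact lintegral_shift_sub_le hφ hSm hU.measurableSet measurableSet_ball hWn hWU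
      _ = b ^ 2 * (ENNReal.ofReal (2 ^ (d + 3) * t ^ 2) * sqInt (gradient φ) U) +
            2 * volume S * q := by
          rw [ENNReal.ofReal_mul (by norm_num), ENNReal.ofReal_mul (by positivity),
            ENNReal.ofReal_pow ht0.le, ENNReal.ofReal_pow (by norm_num)]
          norm_num
          ring
      _ ≤ b ^ 2 * (η * sqInt (gradient φ) U) + 2 * volume S * q := by
          gcongr
          exact ENNReal.ofReal_le_of_le_toReal (by simpa using htη)
      _ = b ^ 2 * (η * sqInt (gradient φ) U) + (b ^ 2 * b⁻¹ ^ 2) * (2 * volume S * q) := by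
          rw [← mul_pow, ENNReal.mul_inv_cancel hb0 hbfin, one_pow, one_mul]
      _ = _ := by ring
  exact (ENNReal.mul_le_mul_iff_right (pow_ne_zero 2 hb0) (ENNReal.pow_ne_top hbfin)).1 hkey

/-- Rellich's theorem for smooth functions on a bounded set with the cone property. -/
theorem hasFiniteApprox_univ {U : Set (E d)} (hU : IsOpen U) (hUb : Bornology.IsBounded U)
    (hcone : HasConeProperty U) : HasFiniteApprox U Set.univ := by
  have hmono : ∀ s t : Set (E d), U ∩ s ⊆ t → HasFiniteApprox U t → HasFiniteApprox U s := by
    intro s t hst ht η hη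
    obtain ⟨T, C, hT, h⟩ := ht η hη
    refine ⟨T, C, hT, fun φ hφ => (sqInt_mono φ ?_).trans (h φ hφ)⟩
    exact fun x hx => ⟨hx.1, hst hx⟩
  have hfin : HasFiniteApprox U (closure U) := by
    refine hUb.isCompact_closure.induction_on (p := fun s => HasFiniteApprox U s) ?_ ?_ ?_ ?_
    · exact fun η _ => ⟨∅, 0, by simp, fun φ _ => by simp [sqInt]⟩
    · exact fun s t hst ht => hmono s t (Set.inter_subset_right.trans hst) ht
    · exact fun s t hs ht => hs.union ht
    · intro x hx
      obtain ⟨r, hr, hc⟩ := hasFiniteApprox_ball hU hcone hx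
      exact ⟨Metric.ball x r, mem_nhdsWithin_of_mem_nhds (Metric.ball_mem_nhds x hr), hc⟩
  exact hmono _ _ (Set.inter_subset_left.trans subset_closure) hfin

end

section

/-! ### Graph charts, surface measure and a trace estimate -/

/-- Cartesian coordinates adapted to a unit vector `ν`, and a Lipschitz function `g` on the hyperplane
orthogonal to `ν`: the map `e` parametrises that hyperplane by `ℝ^(d-1)`, and `π` is the projection
along `ν` in this parametrisation. -/
structure GraphChart (d : ℕ) where
  ν : E d
  e : (Fin (d - 1) → ℝ) →L[ℝ] E d
  π : E d →L[ℝ] (Fin (d - 1) → ℝ)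
  g : E d → ℝ
  K : NNReal
  lip : LipschitzWith K g
  dim : 1 ≤ d
  norm : ‖ν‖ = 1
  inner_e : ∀ y, inner ℝ ν (e y) = 0
  π_e : ∀ y, π (e y) = y
  π_ν : π ν = 0
  e_π : ∀ x, e (π x) = x - inner ℝ ν x • ν

theorem exists_graphChart {d : ℕ} {ν : E d} {g : E d → ℝ} {K : NNReal} (hν : ‖ν‖ = 1)
    (hg : LipschitzWith K g) : ∃ c : GraphChart d, c.ν = ν ∧ c.g = g := by
  have hd : 1 ≤ d := by
    by_contra! h
    obtain rfl : d = 0 := by omega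
    rw [Subsingleton.elim ν 0] at hν
    simp at hν
  obtain ⟨n, rfl⟩ : ∃ n, d = n + 1 := ⟨d - 1, by omega⟩
  have hν0 : ν ≠ 0 := by rintro rfl; simp at hν
  let F : Submodule ℝ (E (n + 1)) := (Submodule.span ℝ {ν})ᗮ
  have hfin : Module.finrank ℝ F = n := by
    have : Fact (Module.finrank ℝ (E (n + 1)) = n + 1) := ⟨finrank_euclideanSpace_fin⟩
    exact Submodule.finrank_orthogonal_span_singleton hν0
  let q : F ≃L[ℝ] (Fin (n + 1 - 1) → ℝ) := ContinuousLinearEquiv.ofFinrankEq (by simp [hfin])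
  let p : E (n + 1) →L[ℝ] E (n + 1) :=
    ContinuousLinearMap.id ℝ _ - (innerSL ℝ ν).smulRight ν
  have hpx : ∀ x, p x = x - inner ℝ ν x • ν := fun x => by simp [p]
  have hnn : inner ℝ ν ν = (1 : ℝ) := by rw [real_inner_self_eq_norm_sq, hν]; norm_num
  have hp : ∀ x, p x ∈ F := fun x => by
    rw [Submodule.mem_orthogonal_singleton_iff_inner_right, hpx, inner_sub_right, inner_smul_right,
      hnn]
    ring
  let π : E (n + 1) →L[ℝ] (Fin (n + 1 - 1) → ℝ) :=
    (q : F →L[ℝ] (Fin (n + 1 - 1) → ℝ)).comp (p.codRestrict F hp)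
  let e : (Fin (n + 1 - 1) → ℝ) →L[ℝ] E (n + 1) :=
    F.subtypeL.comp (q.symm : (Fin (n + 1 - 1) → ℝ) →L[ℝ] F)
  have he : ∀ y, inner ℝ ν (e y) = 0 := fun y =>
    Submodule.mem_orthogonal_singleton_iff_inner_right.1 (q.symm y).2
  refine ⟨⟨ν, e, π, g, K, hg, hd, hν, he, ?_, ?_, ?_⟩, rfl, rfl⟩
  · intro y
    have : p.codRestrict F hp (e y) = q.symm y := by
      apply Subtype.ext
      change p (e y) = e y
      rw [hpx, he, zero_smul, sub_zero]
    change q (p.codRestrict F hp (e y)) = y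
    rw [this, ContinuousLinearEquiv.apply_symm_apply]
  · have : p.codRestrict F hp ν = 0 := by
      apply Subtype.ext
      change p ν = 0
      rw [hpx, hnn, one_smul, sub_self]
    change q (p.codRestrict F hp ν) = 0
    rw [this, map_zero]
  · intro x
    change ((q.symm (q (p.codRestrict F hp x)) : F) : E (n + 1)) = _
    rw [ContinuousLinearEquiv.symm_apply_apply]
    exact hpx x

namespace GraphChart

variable {d : ℕ} (c : GraphChart d)

/-- The graph of `g`. -/
def graph : Set (E d) := {x | c.g (x - inner ℝ c.ν x • c.ν) = inner ℝ c.ν x}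

/-- The parametrisation of the graph of `g`. -/
noncomputable def γ (y : Fin (d - 1) → ℝ) : E d := c.e y + c.g (c.e y) • c.ν

theorem inner_ν : inner ℝ c.ν c.ν = (1 : ℝ) := by
  rw [real_inner_self_eq_norm_sq, c.norm]; norm_num

theorem γ_π {x : E d} (hx : x ∈ c.graph) : c.γ (c.π x) = x := by
  rw [γ, c.e_π, show c.g (x - inner ℝ c.ν x • c.ν) = inner ℝ c.ν x from hx, sub_add_cancel]

theorem π_γ_add (y : Fin (d - 1) → ℝ) (s : ℝ) : c.π (c.γ y + s • c.ν) = y := by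
  simp [γ, c.π_e, c.π_ν]

theorem inner_γ_add (y : Fin (d - 1) → ℝ) (s : ℝ) :
    inner ℝ c.ν (c.γ y + s • c.ν) = c.g (c.e y) + s := by
  simp [γ, inner_add_right, inner_smul_right, c.inner_e, c.norm]

theorem continuous_γ : Continuous c.γ := by
  have := c.lip.continuous
  unfold γ; fun_prop

theorem exists_lipschitz_γ : ∃ L : NNReal, LipschitzWith L c.γ := by
  have h1 : LipschitzWith ‖c.e‖₊ c.e := c.e.lipschitz
  have h2 : LipschitzWith (‖(ContinuousLinearMap.id ℝ ℝ).smulRight c.ν‖₊ * (c.K * ‖c.e‖₊))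
      (fun y => (ContinuousLinearMap.id ℝ ℝ).smulRight c.ν (c.g (c.e y))) :=
    (ContinuousLinearMap.lipschitz _).comp (c.lip.comp h1)
  exact ⟨_, h1.add h2⟩

theorem cast_dim (c : GraphChart d) : ((d : ℝ) - 1) = (Fintype.card (Fin (d - 1)) : ℝ) := by
  rw [Fintype.card_fin, Nat.cast_sub c.dim, Nat.cast_one]

/-- On the graph the surface measure is bounded by a multiple of Lebesgue measure of the parameters,
since the parametrisation is Lipschitz. -/
theorem hausdorffMeasure_le : ∃ C : NNReal, ∀ S ⊆ c.graph,
    Measure.hausdorffMeasure ((d : ℝ) - 1) S ≤ C * volume (c.γ ⁻¹' S) := by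
  obtain ⟨L, hL⟩ := c.exists_lipschitz_γ
  refine ⟨L ^ (Fintype.card (Fin (d - 1)) : ℝ), fun S hS => ?_⟩
  have h1 : S ⊆ c.γ '' (c.γ ⁻¹' S) := fun x hx =>
    ⟨c.π x, by rw [Set.mem_preimage, c.γ_π (hS hx)]; exact hx, c.γ_π (hS hx)⟩
  refine (measure_mono h1).trans ?_
  rw [c.cast_dim]
  refine (hL.hausdorffMeasure_image_le (Nat.cast_nonneg _) _).trans ?_
  rw [hausdorffMeasure_pi_real, ENNReal.coe_rpow_of_nonneg _ (Nat.cast_nonneg _)]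

/-- The converse bound, since the projection is Lipschitz. -/
theorem volume_le : ∃ C : NNReal, ∀ S : Set (E d),
    volume (c.γ ⁻¹' S) ≤ C * Measure.hausdorffMeasure ((d : ℝ) - 1) S := by
  refine ⟨‖c.π‖₊ ^ (Fintype.card (Fin (d - 1)) : ℝ), fun S => ?_⟩
  have h1 : c.γ ⁻¹' S ⊆ c.π '' S := fun y hy =>
    ⟨c.γ y, hy, by simpa using c.π_γ_add y 0⟩
  refine (measure_mono h1).trans ?_
  rw [c.cast_dim, ← hausdorffMeasure_pi_real, ENNReal.coe_rpow_of_nonneg _ (Nat.cast_nonneg _)]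
  exact c.π.lipschitz.hausdorffMeasure_image_le (Nat.cast_nonneg _) _

/-- In the coordinates `(y, s) ↦ γ y + s ν` Lebesgue measure is a constant multiple of product
measure: these coordinates are the composition of a shear and a linear isomorphism. -/
theorem exists_lintegral_eq : ∃ k : NNReal, k ≠ 0 ∧ ∀ F : E d → ℝ≥0∞, Measurable F →
    ∫⁻ p : (Fin (d - 1) → ℝ) × ℝ, F (c.γ p.1 + p.2 • c.ν) = k * ∫⁻ x, F x := by
  let L : ((Fin (d - 1) → ℝ) × ℝ) ≃L[ℝ] E d := ContinuousLinearEquiv.equivOfInverse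
    (c.e.comp (ContinuousLinearMap.fst ℝ _ _) +
      (ContinuousLinearMap.snd ℝ _ _).smulRight c.ν)
    (c.π.prod (innerSL ℝ c.ν))
    (fun p => by
      ext1
      · simp [c.π_e, c.π_ν]
      · simp [inner_add_right, inner_smul_right, c.inner_e, c.norm])
    (fun x => by simp [c.e_π])
  have hL : ∀ p, L p = c.e p.1 + p.2 • c.ν := fun p => rfl
  have hvol : (volume : Measure ((Fin (d - 1) → ℝ) × ℝ)).IsAddHaarMeasure :=
    inferInstanceAs ((volume : Measure (Fin (d - 1) → ℝ)).prod (volume : Measure ℝ)).IsAddHaarMeasure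
  have hmap : (Measure.map L volume).IsAddHaarMeasure := L.isAddHaarMeasure_map volume
  have hsm := Measure.isAddLeftInvariant_eq_smul (Measure.map L volume) (volume : Measure (E d))
  refine ⟨_, (Measure.addHaarScalarFactor_pos_of_isAddHaarMeasure (Measure.map L volume)
    (volume : Measure (E d))).ne', fun F hF => ?_⟩
  have hsk : MeasurePreserving (fun p : (Fin (d - 1) → ℝ) × ℝ => (p.1, c.g (c.e p.1) + p.2))
      (volume.prod volume) (volume.prod volume) := by
    refine (MeasurePreserving.id volume).skew_product (g := fun y s => c.g (c.e y) + s) ?_ ?_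
    · have := c.lip.continuous
      exact Continuous.measurable (by unfold Function.uncurry; fun_prop)
    · exact ae_of_all _ fun y => map_add_left_eq_self volume _
  have hFL : Measurable fun p => F (L p) := hF.comp L.continuous.measurable
  calc ∫⁻ p : (Fin (d - 1) → ℝ) × ℝ, F (c.γ p.1 + p.2 • c.ν)
      = ∫⁻ p : (Fin (d - 1) → ℝ) × ℝ, F (L (p.1, c.g (c.e p.1) + p.2)) := by
        refine lintegral_congr fun p => ?_
        rw [hL, γ, add_smul, add_assoc]
    _ = ∫⁻ p, F (L p) := hsk.lintegral_comp hFL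
    _ = ∫⁻ x, F x ∂(Measure.map L volume) := (lintegral_map hF L.continuous.measurable).symm
    _ = _ := by
        conv_lhs => rw [hsm]
        rw [lintegral_smul_measure]; rfl

/-- A trace estimate. If the points of the portion `Γ` of the graph can be moved into `U` along `ν`,
then the region swept out has positive volume, and on it functions are controlled by their values on
`Γ` and their gradient on `U`. -/
theorem exists_controlled {Γ U : Set (E d)} (hΓ : MeasurableSet Γ) (hΓg : Γ ⊆ c.graph)
    {h : ℝ} (hh : 0 < h) (hΓU : ∀ x ∈ Γ, ∀ s ∈ Set.Ioc 0 h, x + s • c.ν ∈ U)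
    (hpos : Measure.hausdorffMeasure ((d : ℝ) - 1) Γ ≠ 0) :
    ∃ D ⊆ U, MeasurableSet D ∧ volume D ≠ 0 ∧ IsControlled (fun φ => sqInt (gradient φ) U +
      ∫⁻ x in Γ, ‖φ x‖ₑ ^ 2 ∂(Measure.hausdorffMeasure ((d : ℝ) - 1))) D := by
  set A := c.γ ⁻¹' Γ with hA
  have hAm : MeasurableSet A := c.continuous_γ.measurable hΓ
  set D : Set (E d) := {x | c.π x ∈ A ∧ inner ℝ c.ν x - c.g (c.e (c.π x)) ∈ Set.Ioc 0 h} with hD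
  have hgc := c.lip.continuous
  have hDm : MeasurableSet D := by
    refine MeasurableSet.inter (c.π.continuous.measurable hAm) ?_
    have : Continuous fun x : E d => inner ℝ c.ν x - c.g (c.e (c.π x)) := by fun_prop
    exact this.measurable measurableSet_Ioc
  have hDU : D ⊆ U := by
    rintro x ⟨hx1, hx2⟩
    have := hΓU _ hx1 _ hx2
    rwa [γ, c.e_π, sub_smul, show ∀ a b c : E d, a - b + c + (b - c) = a by intros; abel] at this
  have hΘ : ∀ y s, c.γ y + s • c.ν ∈ D ↔ y ∈ A ∧ s ∈ Set.Ioc 0 h := by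
    intro y s
    rw [hD, Set.mem_ofPred_eq, c.π_γ_add, c.inner_γ_add, add_sub_cancel_left]
  obtain ⟨k, hk0, hk⟩ := c.exists_lintegral_eq
  -- Integration over `D` in the coordinates of the chart.
  have hint : ∀ F : E d → ℝ≥0∞, Measurable F →
      ∫⁻ y in A, ∫⁻ s in Set.Ioc 0 h, F (c.γ y + s • c.ν) = k * ∫⁻ x in D, F x := by
    intro F hF
    rw [← lintegral_indicator hDm, ← hk _ (hF.indicator hDm)]
    have hcγ := c.continuous_γ
    have hmeas : Measurable fun p : (Fin (d - 1) → ℝ) × ℝ =>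
        D.indicator F (c.γ p.1 + p.2 • c.ν) :=
      (hF.indicator hDm).comp (by fun_prop)
    rw [Measure.volume_eq_prod, lintegral_prod _ hmeas.aemeasurable, ← lintegral_indicator hAm]
    refine lintegral_congr fun y => ?_
    by_cases hy : y ∈ A
    · rw [Set.indicator_of_mem hy, ← lintegral_indicator measurableSet_Ioc]
      refine lintegral_congr fun s => ?_
      by_cases hs : s ∈ Set.Ioc 0 h
      · rw [Set.indicator_of_mem hs, Set.indicator_of_mem ((hΘ y s).2 ⟨hy, hs⟩)]
      · rw [Set.indicator_of_notMem hs, Set.indicator_of_notMem fun h0 => hs ((hΘ y s).1 h0).2]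
    · rw [Set.indicator_of_notMem hy]
      refine (lintegral_eq_zero_of_ae_eq_zero (ae_of_all _ fun s => ?_)).symm
      exact Set.indicator_of_notMem (fun h0 => hy ((hΘ y s).1 h0).1) _
  have hk0' : (k : ℝ≥0∞) ≠ 0 := by exact_mod_cast hk0
  refine ⟨D, hDU, hDm, ?_, ?_⟩
  · intro h0
    have h1 := hint (fun _ => 1) measurable_const
    simp only [lintegral_const, Measure.restrict_apply_univ, h0, one_mul, mul_zero] at h1
    obtain ⟨C, hC⟩ := c.hausdorffMeasure_le
    rcases mul_eq_zero.1 h1 with h2 | h2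
    · rw [Real.volume_Ioc, sub_zero, ENNReal.ofReal_eq_zero] at h2
      linarith
    · have h3 := hC Γ hΓg
      rw [← hA, h2, mul_zero] at h3
      exact hpos (le_antisymm h3 zero_le)
  · obtain ⟨C, hC⟩ := c.volume_le
    set H := ENNReal.ofReal h with hH
    refine ⟨((k : ℝ≥0∞)⁻¹ * (2 * H * C + 2 * H * (H * k))).toNNReal, fun φ hφ => ?_⟩
    rw [ENNReal.coe_toNNReal (by finiteness), mul_assoc,
      ← ENNReal.mul_le_iff_le_inv hk0' ENNReal.coe_ne_top]
    have hc := hφ.continuous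
    have hcγ := c.continuous_γ
    set I := ∫⁻ x in Γ, ‖φ x‖ₑ ^ 2 ∂(Measure.hausdorffMeasure ((d : ℝ) - 1)) with hI
    have htr : ∫⁻ y in A, ‖φ (c.γ y)‖ₑ ^ 2 ≤ C * I := by
      have hm : Measurable fun x => ‖φ x‖ₑ ^ 2 := hc.enorm.measurable.pow_const 2
      rw [← lintegral_map (f := fun x => ‖φ x‖ₑ ^ 2) hm hcγ.measurable, hI,
        ← lintegral_const_mul _ hm]
      have hle : Measure.map c.γ (volume.restrict A) ≤
          C • (Measure.hausdorffMeasure ((d : ℝ) - 1)).restrict Γ := by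
        refine Measure.le_iff.2 fun s hs => ?_
        rw [Measure.map_apply hcγ.measurable hs, Measure.restrict_apply (hcγ.measurable hs),
          Measure.smul_apply, Measure.restrict_apply hs, hA, ← Set.preimage_inter]
        exact hC _
      refine (lintegral_mono' hle le_rfl).trans ?_
      rw [lintegral_smul_measure, lintegral_const_mul _ hm]
      rfl
    have hgm := measurable_enorm_gradient_sq hφ
    have hgm2 : Measurable fun p : (Fin (d - 1) → ℝ) × ℝ =>
        ‖gradient φ (c.γ p.1 + p.2 • c.ν)‖ₑ ^ 2 := hgm.comp (by fun_prop)
    have hm1 : Measurable fun y => ‖φ (c.γ y)‖ₑ ^ 2 :=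
      (hc.comp hcγ).enorm.measurable.pow_const 2
    calc k * sqInt φ D = ∫⁻ y in A, ∫⁻ s in Set.Ioc 0 h, ‖φ (c.γ y + s • c.ν)‖ₑ ^ 2 :=
          (hint _ (hc.enorm.measurable.pow_const 2)).symm
      _ ≤ ∫⁻ y in A, (2 * H * ‖φ (c.γ y)‖ₑ ^ 2 +
            2 * H * (H * ∫⁻ τ in Set.Ioc 0 h, ‖gradient φ (c.γ y + τ • c.ν)‖ₑ ^ 2)) := by
          refine lintegral_mono fun y => ?_
          calc ∫⁻ s in Set.Ioc 0 h, ‖φ (c.γ y + s • c.ν)‖ₑ ^ 2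
              ≤ ∫⁻ s in Set.Ioc 0 h, (2 * ‖φ (c.γ y)‖ₑ ^ 2 +
                  2 * (H * ∫⁻ τ in Set.Ioc 0 h, ‖gradient φ (c.γ y + τ • c.ν)‖ₑ ^ 2)) := by
                refine setLIntegral_mono' measurableSet_Ioc fun s hs => ?_
                refine (enorm_sq_le_of_sub _ (φ (c.γ y))).trans ?_
                gcongr 2 * ‖φ (c.γ y)‖ₑ ^ 2 + 2 * ?_
                rw [enorm_sub_rev]
                refine (enorm_sub_sq_le hφ (c.γ y) c.ν hs.1.le hs.2).trans ?_
                have : ‖c.ν‖ₑ = 1 := by rw [← ofReal_norm, c.norm]; simp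
                rw [this, one_pow, one_mul]
            _ = _ := by
                rw [setLIntegral_const, Real.volume_Ioc, sub_zero]
                ring
      _ = 2 * H * (∫⁻ y in A, ‖φ (c.γ y)‖ₑ ^ 2) + 2 * H * (H * ∫⁻ y in A, ∫⁻ τ in Set.Ioc 0 h,
            ‖gradient φ (c.γ y + τ • c.ν)‖ₑ ^ 2) := by
          have hm' := hgm2.lintegral_prod_right' (ν := volume.restrict (Set.Ioc 0 h))
          rw [lintegral_add_left (hm1.const_mul _), lintegral_const_mul _ hm1,
            lintegral_const_mul _ (hm'.const_mul H), lintegral_const_mul _ hm']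
      _ ≤ 2 * H * (C * I) + 2 * H * (H * (k * sqInt (gradient φ) U)) := by
          rw [hint _ hgm]
          gcongr
          exact sqInt_mono _ hDU
      _ ≤ 2 * H * (C * (sqInt (gradient φ) U + I)) +
            2 * H * (H * (k * (sqInt (gradient φ) U + I))) := by
          gcongr
          · exact le_add_self
          · exact le_self_add
      _ = _ := by ring

end GraphChart

/-- Near a boundary point the boundary lies on the graph of a chart, and the points of the boundary
can be moved into the domain along `ν`. -/
theorem MSGFEM.HasLipschitzBoundary.exists_chart {d : ℕ} {U : Set (E d)}
    (hL : HasLipschitzBoundary U) (hU : IsOpen U) {x₀ : E d} (hx₀ : x₀ ∈ frontier U) :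
    ∃ (c : GraphChart d) (r : ℝ), 0 < r ∧ frontier U ∩ Metric.ball x₀ r ⊆ c.graph ∧
      ∀ x ∈ frontier U ∩ Metric.ball x₀ r, ∀ s ∈ Set.Ioc 0 r, x + s • c.ν ∈ U := by
  obtain ⟨ν, K, g, r, hν, hg, hr, hy⟩ := hL x₀ hx₀
  obtain ⟨c, rfl, rfl⟩ := exists_graphChart hν hg
  have hgc := hg.continuous
  have hgraph : frontier U ∩ Metric.ball x₀ r ⊆ c.graph := by
    rintro x ⟨hxf, hxb⟩
    have hxU : x ∉ U := by
      have := hxf.2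
      rwa [hU.interior_eq] at this
    have h1 : inner ℝ c.ν x ≤ c.g (x - inner ℝ c.ν x • c.ν) := by
      by_contra! h
      exact hxU ((hy x hxb).2 h)
    refine le_antisymm ?_ h1
    by_contra! h
    have hopen : IsOpen {z : E d | inner ℝ c.ν z < c.g (z - inner ℝ c.ν z • c.ν)} :=
      isOpen_lt (by fun_prop) (by fun_prop)
    obtain ⟨z, ⟨hz1, hz2⟩, hzU⟩ := mem_closure_iff.1 hxf.1 _ (hopen.inter Metric.isOpen_ball)
      ⟨h, hxb⟩
    exact absurd ((hy z hz2).1 hzU) (not_lt.2 (le_of_lt hz1))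
  refine ⟨c, r / 2, by positivity, ?_, ?_⟩
  · exact (Set.inter_subset_inter_right _ (Metric.ball_subset_ball (by linarith))).trans hgraph
  · rintro x ⟨hxf, hxb⟩ s ⟨hs0, hs1⟩
    have hxb' : x ∈ Metric.ball x₀ r := Metric.ball_subset_ball (by linarith) hxb
    have hb2 : x + s • c.ν ∈ Metric.ball x₀ r := by
      rw [Metric.mem_ball, dist_eq_norm] at hxb ⊢
      have h2 : ‖s • c.ν‖ ≤ r / 2 := by
        rw [norm_smul, Real.norm_of_nonneg hs0.le, c.norm]; linarith
      calc ‖x + s • c.ν - x₀‖ = ‖(x - x₀) + s • c.ν‖ := by congr 1; abel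
        _ ≤ ‖x - x₀‖ + ‖s • c.ν‖ := norm_add_le _ _
        _ < r := by linarith
    rw [hy _ hb2]
    have h1 : c.g (x - inner ℝ c.ν x • c.ν) = inner ℝ c.ν x := hgraph ⟨hxf, hxb'⟩
    have h2 : x + s • c.ν - inner ℝ c.ν (x + s • c.ν) • c.ν = x - inner ℝ c.ν x • c.ν := by
      rw [inner_add_right, inner_smul_right, c.inner_ν, mul_one, add_smul]; abel
    rw [h2, h1, inner_add_right, inner_smul_right, c.inner_ν]
    linarith

/-- The boundary of a bounded Lipschitz set has finite surface measure. -/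
theorem MSGFEM.HasLipschitzBoundary.hausdorffMeasure_frontier_lt_top {d : ℕ} {U : Set (E d)}
    (hL : HasLipschitzBoundary U) (hU : IsOpen U) (hUb : Bornology.IsBounded U) :
    Measure.hausdorffMeasure ((d : ℝ) - 1) (frontier U) < ∞ := by
  have hcomp : IsCompact (frontier U) :=
    hUb.isCompact_closure.of_isClosed_subset isClosed_frontier frontier_subset_closure
  refine hcomp.measure_lt_top_of_nhdsWithin fun x hx => ?_
  obtain ⟨c, r, hr, hg, -⟩ := hL.exists_chart hU hx
  refine ⟨frontier U ∩ Metric.ball x r, inter_mem_nhdsWithin _ (Metric.ball_mem_nhds x hr), ?_⟩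
  obtain ⟨C, hC⟩ := c.hausdorffMeasure_le
  refine (hC _ hg).trans_lt (ENNReal.mul_lt_top ENNReal.coe_lt_top ?_)
  have hsub : c.γ ⁻¹' (frontier U ∩ Metric.ball x r) ⊆ c.π '' Metric.ball x r := fun y hy =>
    ⟨c.γ y, hy.2, by simpa using c.π_γ_add y 0⟩
  exact (measure_mono hsub).trans_lt (c.π.lipschitz.isBounded_image Metric.isBounded_ball).measure_lt_top

/-- Friedrichs' inequality for smooth functions on a Lipschitz domain, relative to a measurable portion
of the boundary of positive surface measure. -/
theorem MSGFEM.IsLipschitzDomain.isControlled {d : ℕ} {U Γ : Set (E d)} (hU : IsLipschitzDomain U)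
    (hΓ : MeasurableSet Γ) (hΓU : Γ ⊆ frontier U)
    (hpos : Measure.hausdorffMeasure ((d : ℝ) - 1) Γ ≠ 0) :
    IsControlled (fun φ => sqInt (gradient φ) U +
      ∫⁻ x in Γ, ‖φ x‖ₑ ^ 2 ∂(Measure.hausdorffMeasure ((d : ℝ) - 1))) U := by
  obtain ⟨x₀, hx₀, hx⟩ := exists_mem_forall_mem_nhdsWithin_pos_measure hpos
  obtain ⟨c, r, hr, hg, hs⟩ := hU.lipschitz.exists_chart hU.isOpen (hΓU hx₀)
  have hsub : Γ ∩ Metric.ball x₀ r ⊆ frontier U ∩ Metric.ball x₀ r :=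
    Set.inter_subset_inter_left _ hΓU
  obtain ⟨D, hDU, hDm, hD0, hDc⟩ := c.exists_controlled (hΓ.inter measurableSet_ball)
    (hsub.trans hg) hr (fun x hx => hs x (hsub hx))
    (hx _ (inter_mem_nhdsWithin _ (Metric.ball_mem_nhds x₀ hr))).ne'
  have hN : ∀ φ : E d → ℝ, sqInt (gradient φ) U ≤ sqInt (gradient φ) U +
      ∫⁻ x in Γ, ‖φ x‖ₑ ^ 2 ∂(Measure.hausdorffMeasure ((d : ℝ) - 1)) := fun _ => le_self_add
  refine isControlled_of_ball hU.isOpen hU.isConnected.isPreconnected hU.isBounded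
    (hU.lipschitz.hasConeProperty hU.isOpen) hN ?_
  refine exists_isControlled_ball hU.isOpen hN hDm hDU hD0 ?_
  obtain ⟨C, hC⟩ := hDc
  refine ⟨C, fun φ hφ => (hC φ hφ).trans ?_⟩
  dsimp only
  gcongr
  exact Set.inter_subset_left

/-! ### Lipschitz continuity of the partition function -/

/-- Along a segment contained in `Ω` the function `χ` is Lipschitz with the bound of its gradient on
`ω` as constant: past the last zero of `χ` the segment stays in `ω`. -/
theorem MSGFEM.IsPartitionFunction.sub_le {χ : E d → ℝ} {ω Ω : Set (E d)}
    (hχ : IsPartitionFunction χ ω Ω) (hω : IsOpen ω) {C : ℝ} (hC0 : 0 ≤ C)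
    (hC : ∀ x ∈ ω, ‖gradient χ x‖ ≤ C) {x w : E d}
    (hseg : ∀ τ ∈ Set.Icc (0 : ℝ) 1, x + τ • w ∈ Ω) : χ (x + w) - χ x ≤ C * ‖w‖ := by
  set f : ℝ → ℝ := fun τ => χ (x + τ • w) with hf
  have hfc : ContinuousOn f (Set.Icc 0 1) :=
    hχ.continuousOn.comp (by fun_prop) hseg
  have hω' : ∀ τ ∈ Set.Icc (0 : ℝ) 1, f τ ≠ 0 → x + τ • w ∈ ω := fun τ hτ h0 => by
    by_contra hn
    exact h0 (hχ.eq_zero _ ⟨hseg τ hτ, hn⟩)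
  have hd : ∀ τ : ℝ, x + τ • w ∈ ω → HasDerivAt f (fderiv ℝ χ (x + τ • w) w) τ := by
    intro τ hτ
    have h1 : HasDerivAt (fun τ : ℝ => x + τ • w) w τ := by
      simpa using ((hasDerivAt_id τ).smul_const w).const_add x
    have h2 : DifferentiableAt ℝ χ (x + τ • w) :=
      ((hχ.contDiffOn.differentiableOn (by simp)) _ hτ).differentiableAt (hω.mem_nhds hτ)
    exact h2.hasFDerivAt.comp_hasDerivAt τ h1
  have hb : ∀ τ : ℝ, x + τ • w ∈ ω → fderiv ℝ χ (x + τ • w) w ≤ C * ‖w‖ := by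
    intro τ hτ
    have h1 : ‖fderiv ℝ χ (x + τ • w)‖ ≤ C := by
      rw [← toDual_gradient, LinearIsometryEquiv.norm_map]; exact hC _ hτ
    calc fderiv ℝ χ (x + τ • w) w ≤ ‖fderiv ℝ χ (x + τ • w) w‖ := le_abs_self _
      _ ≤ ‖fderiv ℝ χ (x + τ • w)‖ * ‖w‖ := ContinuousLinearMap.le_opNorm _ _
      _ ≤ _ := by gcongr
  have hf0 : f 0 = χ x := by simp [hf]
  have hf1 : f 1 = χ (x + w) := by simp [hf]
  have hmvt : ∀ s ∈ Set.Ico (0 : ℝ) 1, (∀ τ ∈ Set.Ioo s 1, f τ ≠ 0) → f 1 - f s ≤ C * ‖w‖ := by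
    rintro s ⟨hs0, hs1⟩ hne
    have hin : ∀ τ ∈ Set.Ioo s 1, x + τ • w ∈ ω := fun τ hτ =>
      hω' τ ⟨hs0.trans hτ.1.le, hτ.2.le⟩ (hne τ hτ)
    obtain ⟨τ, hτ, hτe⟩ := exists_hasDerivAt_eq_slope f (fun τ => fderiv ℝ χ (x + τ • w) w) hs1
      (hfc.mono (Set.Icc_subset_Icc_left hs0)) (fun τ hτ => hd τ (hin τ hτ))
    have h1 := hb τ (hin τ hτ)
    rw [hτe, div_le_iff₀ (by linarith)] at h1
    have : 0 ≤ C * ‖w‖ := by positivity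
    nlinarith
  rw [← hf0, ← hf1]
  by_cases h1 : f 1 = 0
  · have h2 : 0 ≤ f 0 := hχ.nonneg _ (hseg 0 (by simp))
    have : 0 ≤ C * ‖w‖ := by positivity
    linarith
  set Z : Set ℝ := {τ ∈ Set.Icc (0 : ℝ) 1 | f τ = 0} with hZ
  by_cases hZne : Z.Nonempty
  · have hZc : IsCompact Z := by
      refine isCompact_Icc.of_isClosed_subset ?_ (Set.sep_subset _ _)
      exact hfc.preimage_isClosed_of_isClosed isClosed_Icc isClosed_singleton
    obtain ⟨s, ⟨hs, hs0⟩, hsmax⟩ := hZc.exists_isGreatest hZne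
    have hs1 : s ≠ 1 := by rintro rfl; exact h1 hs0
    have h2 := hmvt s ⟨hs.1, lt_of_le_of_ne hs.2 hs1⟩ fun τ hτ h0 =>
      absurd (hsmax ⟨⟨hs.1.trans hτ.1.le, hτ.2.le⟩, h0⟩) (not_le.2 hτ.1)
    have h3 : 0 ≤ f 0 := hχ.nonneg _ (hseg 0 (by simp))
    linarith
  · exact hmvt 0 (by simp) fun τ hτ h0 => hZne ⟨τ, ⟨hτ.1.le, hτ.2.le⟩, h0⟩

/-- The estimate along segments is turned into a Lipschitz estimate on `Ω` by the cone property and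
compactness; pairs of points at a distance bounded from below are no obstacle, as `0 ≤ χ ≤ 1`. -/
theorem MSGFEM.IsPartitionFunction.exists_lipschitzOn {χ : E d → ℝ} {ω Ω : Set (E d)}
    (hχ : IsPartitionFunction χ ω Ω) (hω : IsOpen ω)
    (hcone : HasConeProperty Ω) (hΩb : Bornology.IsBounded Ω) :
    ∃ K : NNReal, LipschitzOnWith K χ Ω := by
  obtain ⟨C, hC0, hC⟩ : ∃ C : ℝ, 0 ≤ C ∧ ∀ x ∈ ω, ‖gradient χ x‖ ≤ C := by
    obtain ⟨C, hC⟩ := hχ.gradient_bound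
    exact ⟨max C 0, le_max_right _ _, fun x hx => (hC x hx).trans (le_max_left _ _)⟩
  -- Two nearby points are joined through a common point of their cones.
  have hloc : ∀ x₀ ∈ closure Ω, ∃ r > 0, ∃ L : ℝ, ∀ x ∈ Ω ∩ Metric.ball x₀ r,
      ∀ y ∈ Ω ∩ Metric.ball x₀ r, χ y - χ x ≤ L * dist x y := by
    intro x₀ hx₀
    obtain ⟨ν, κ, h, r, hν, hκ, hκ1, hh, hr, hcn⟩ := hcone x₀ hx₀
    refine ⟨min r (h * κ / 2), by positivity, C * (3 / κ), ?_⟩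
    rintro x ⟨hx, hxb⟩ y ⟨hy, hyb⟩
    have hxr : x ∈ Metric.ball x₀ r := Metric.ball_subset_ball (min_le_left _ _) hxb
    have hyr : y ∈ Metric.ball x₀ r := Metric.ball_subset_ball (min_le_left _ _) hyb
    have hdist : dist x y ≤ h * κ := by
      have e1 := (Metric.mem_ball.1 hxb).trans_le (min_le_right _ _)
      have e2 := (Metric.mem_ball.1 hyb).trans_le (min_le_right _ _)
      linarith [dist_triangle_right x y x₀]
    set t := dist x y / κ with ht
    have htκ : t * κ = dist x y := by rw [ht]; field_simp
    have ht0 : 0 ≤ t := by positivity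
    have hth : t ≤ h := by rw [ht, div_le_iff₀ hκ]; exact hdist
    rcases eq_or_lt_of_le ht0 with h0 | htpos
    · rw [← h0, zero_mul] at htκ
      rw [dist_eq_zero.1 htκ.symm]; simp
    set w := ν + t⁻¹ • (y - x) with hw
    have hwν : w ∈ Metric.closedBall ν κ := by
      rw [Metric.mem_closedBall, dist_eq_norm, hw, add_sub_cancel_left, norm_smul,
        Real.norm_of_nonneg (inv_nonneg.2 ht0), inv_mul_le_iff₀ htpos, ← dist_eq_norm, dist_comm,
        htκ]
    have hmid : x + t • w = y + t • ν := by
      rw [hw, smul_add, smul_inv_smul₀ htpos.ne']; abel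
    have h1 := hχ.sub_le hω hC0 hC (x := x) (w := t • w) fun τ hτ => by
      rw [smul_smul]
      exact hcn x ⟨hx, hxr⟩ w hwν _ ⟨mul_nonneg hτ.1 ht0, by nlinarith [hτ.1, hτ.2]⟩
    have h2 := hχ.sub_le hω hC0 hC (x := y + t • ν) (w := -(t • ν)) fun τ hτ => by
      have := hcn y ⟨hy, hyr⟩ ν (Metric.mem_closedBall_self hκ.le) ((1 - τ) * t)
        ⟨mul_nonneg (by linarith [hτ.2]) ht0, by nlinarith [hτ.1, hτ.2]⟩
      rwa [show y + t • ν + τ • -(t • ν) = y + ((1 - τ) * t) • ν by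
        rw [mul_smul, sub_smul, one_smul, smul_neg]; abel]
    rw [norm_neg, add_neg_cancel_right] at h2
    rw [hmid] at h1
    have e1 : ‖t • w‖ ≤ 2 * t := by
      have e3 : ‖w‖ ≤ 2 := by
        rw [Metric.mem_closedBall, dist_eq_norm] at hwν
        calc ‖w‖ = ‖(w - ν) + ν‖ := by rw [sub_add_cancel]
          _ ≤ ‖w - ν‖ + ‖ν‖ := norm_add_le _ _
          _ ≤ 2 := by linarith
      rw [norm_smul, Real.norm_of_nonneg ht0]; nlinarith
    have e2 : ‖t • ν‖ ≤ t := by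
      rw [norm_smul, Real.norm_of_nonneg ht0]; nlinarith
    calc χ y - χ x ≤ C * ‖t • w‖ + C * ‖t • ν‖ := by linarith
      _ ≤ C * (2 * t) + C * t := by gcongr
      _ = _ := by rw [ht]; ring
  have hfin : ∃ L : ℝ, ∃ δ > 0, ∀ x ∈ Ω ∩ closure Ω, ∀ y ∈ Ω, dist x y < δ →
      χ y - χ x ≤ L * dist x y := by
    refine hΩb.isCompact_closure.induction_on (p := fun s => ∃ L : ℝ, ∃ δ > 0, ∀ x ∈ Ω ∩ s,
      ∀ y ∈ Ω, dist x y < δ → χ y - χ x ≤ L * dist x y) ?_ ?_ ?_ ?_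
    · exact ⟨0, 1, one_pos, by simp⟩
    · rintro s t hst ⟨L, δ, hδ, h⟩
      exact ⟨L, δ, hδ, fun x hx => h x ⟨hx.1, hst hx.2⟩⟩
    · rintro s t ⟨L, δ, hδ, h⟩ ⟨L', δ', hδ', h'⟩
      refine ⟨max L L', min δ δ', by positivity, ?_⟩
      rintro x ⟨hx, hxs | hxt⟩ y hy hxy
      · refine (h x ⟨hx, hxs⟩ y hy (hxy.trans_le (min_le_left _ _))).trans ?_
        gcongr; exact le_max_left _ _
      · refine (h' x ⟨hx, hxt⟩ y hy (hxy.trans_le (min_le_right _ _))).trans ?_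
        gcongr; exact le_max_right _ _
    · intro x₀ hx₀
      obtain ⟨r, hr, L, h⟩ := hloc x₀ hx₀
      refine ⟨Metric.ball x₀ (r / 2), mem_nhdsWithin_of_mem_nhds
        (Metric.ball_mem_nhds _ (by positivity)), L, r / 2, by positivity, ?_⟩
      rintro x ⟨hx, hxb⟩ y hy hxy
      rw [Metric.mem_ball] at hxb
      refine h x ⟨hx, ?_⟩ y ⟨hy, ?_⟩
      · rw [Metric.mem_ball]; linarith
      · rw [Metric.mem_ball]
        linarith [dist_triangle_left y x₀ x]
  obtain ⟨L, δ, hδ, h⟩ := hfin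
  set M := max L (1 / δ) with hM
  have hM0 : 0 ≤ M := le_max_of_le_right (by positivity)
  have key : ∀ x ∈ Ω, ∀ y ∈ Ω, χ y - χ x ≤ M * dist x y := by
    intro x hx y hy
    rcases lt_or_ge (dist x y) δ with hlt | hge
    · refine (h x ⟨hx, subset_closure hx⟩ y hy hlt).trans ?_
      gcongr; exact le_max_left _ _
    · have e1 := hχ.le_one y hy
      have e2 := hχ.nonneg x hx
      have e3 : 1 ≤ 1 / δ * dist x y := by
        rw [one_div, ← div_eq_inv_mul, le_div_iff₀ hδ]; linarith
      have e4 : 1 / δ * dist x y ≤ M * dist x y := by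
        gcongr; exact le_max_right _ _
      linarith
  refine ⟨⟨M, hM0⟩, LipschitzOnWith.of_dist_le_mul fun x hx y hy => ?_⟩
  rw [Real.dist_eq, abs_le]
  have h1 := key x hx y hy
  have h2 := key y hy x hx
  rw [dist_comm] at h2
  constructor
  · change -(M * dist x y) ≤ _; linarith
  · change _ ≤ M * dist x y; linarith

/-- The partition function extends from `Ω` to a Lipschitz function on the whole space with values in
`[0, 1]`. -/
theorem MSGFEM.IsPartitionFunction.exists_extension {χ : E d → ℝ} {ω Ω : Set (E d)}
    (hχ : IsPartitionFunction χ ω Ω) (hω : IsOpen ω) (hΩ : IsLipschitzDomain Ω) :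
    ∃ (K : NNReal) (θ : E d → ℝ), LipschitzWith K θ ∧ (∀ x, 0 ≤ θ x) ∧ (∀ x, θ x ≤ 1) ∧
      Set.EqOn θ χ Ω := by
  obtain ⟨K, hK⟩ := hχ.exists_lipschitzOn hω (hΩ.lipschitz.hasConeProperty hΩ.isOpen) hΩ.isBounded
  obtain ⟨g, hg, hgχ⟩ := hK.extend_real
  refine ⟨K, fun x => max 0 (min 1 (g x)), (hg.const_min 1).const_max 0, fun x => le_max_left _ _,
    fun x => max_le zero_le_one (min_le_left _ _), fun x hx => ?_⟩
  have e1 := hχ.le_one x hx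
  have e2 := hχ.nonneg x hx
  simp only []
  rw [← hgχ hx, min_eq_right e1, max_eq_right e2]

/-! ### Mollification of Lipschitz functions -/

theorem measurable_gradient (θ : E d → ℝ) : Measurable (gradient θ) :=
  (InnerProductSpace.toDual ℝ (E d)).symm.continuous.measurable.comp (measurable_fderiv ℝ θ)

theorem norm_gradient_le_of_lipschitz {θ : E d → ℝ} {K : NNReal} (hθ : LipschitzWith K θ) (x : E d) :
    ‖gradient θ x‖ ≤ K := by
  have := norm_fderiv_le_of_lipschitz ℝ hθ (x₀ := x)
  rwa [← toDual_gradient, LinearIsometryEquiv.norm_map] at this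

/-- A Lipschitz function is the uniform limit of smooth functions whose gradients are bounded and
converge almost everywhere to its gradient. -/
theorem exists_smooth_approx {θ : E d → ℝ} {K : NNReal} (hθ : LipschitzWith K θ) :
    ∃ ψ : ℕ → E d → ℝ, (∀ j, ContDiff ℝ (⊤ : ℕ∞) (ψ j)) ∧
      (∀ j x, ‖ψ j x - θ x‖ ≤ K * (1 / ((j : ℝ) + 1))) ∧ (∀ j x, ‖gradient (ψ j) x‖ ≤ K) ∧
      ∀ᵐ x, Tendsto (fun j => gradient (ψ j) x) atTop (𝓝 (gradient θ x)) := by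
  let ρ : ℕ → ContDiffBump (0 : E d) := fun j =>
    { rIn := 1 / ((j : ℝ) + 1) / 2
      rOut := 1 / ((j : ℝ) + 1)
      rIn_pos := by positivity
      rIn_lt_rOut := half_lt_self (by positivity) }
  have hmd : Measurable (fderiv ℝ θ) := measurable_fderiv ℝ θ
  have hbd : ∀ x, ‖fderiv ℝ θ x‖ ≤ K := fun x => norm_fderiv_le_of_lipschitz ℝ hθ
  have hli : LocallyIntegrable (fderiv ℝ θ) (volume : Measure (E d)) :=
    (locallyIntegrable_const (K : ℝ)).mono hmd.aestronglyMeasurable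
      (ae_of_all _ fun x => by simpa using hbd x)
  let ψ : ℕ → E d → ℝ := fun j =>
    convolution ((ρ j).normed volume) θ (ContinuousLinearMap.lsmul ℝ ℝ) volume
  have hψ : ∀ j, ContDiff ℝ (⊤ : ℕ∞) (ψ j) := fun j =>
    (ρ j).hasCompactSupport_normed.contDiff_convolution_left _ (ρ j).contDiff_normed
      hθ.continuous.locallyIntegrable
  have hd : ∀ j x, HasFDerivAt (ψ j) (convolution ((ρ j).normed volume) (fderiv ℝ θ)
      (ContinuousLinearMap.lsmul ℝ ℝ) volume x) x := by
    intro j x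
    have hc := hθ.continuous
    have hρc : Continuous ((ρ j).normed volume) := (ρ j).continuous_normed
    refine (hasFDerivAt_integral_of_dominated_loc_of_lip (𝕜 := ℝ) (μ := (volume : Measure (E d)))
      (F := fun x z => (ρ j).normed volume z • θ (x - z))
      (F' := fun z => (ρ j).normed volume z • fderiv ℝ θ (x - z))
      (bound := fun z => (ρ j).normed volume z * K) (s := Set.univ) univ_mem ?_ ?_ ?_ ?_ ?_ ?_).2
    · exact Eventually.of_forall fun y =>
        Continuous.aestronglyMeasurable (by fun_prop)
    · refine Continuous.integrable_of_hasCompactSupport (by fun_prop) ?_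
      exact (ρ j).hasCompactSupport_normed.smul_right
    · refine hρc.aestronglyMeasurable.smul ?_
      exact (hmd.comp (measurable_const.sub measurable_id)).aestronglyMeasurable
    · refine ae_of_all _ fun z => LipschitzOnWith.of_dist_le_mul fun y _ y' _ => ?_
      have h1 := hθ.dist_le_mul (y - z) (y' - z)
      rw [dist_sub_right] at h1
      have h2 := (ρ j).nonneg_normed (μ := volume) z
      rw [dist_smul₀, Real.norm_of_nonneg h2, Real.coe_nnabs, abs_of_nonneg (by positivity)]
      nlinarith
    · exact (ρ j).integrable_normed.mul_const _
    · have h1 := (Measure.measurePreserving_sub_left (volume : Measure (E d)) x).quasiMeasurePreserving.ae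
        hθ.ae_differentiableAt
      filter_upwards [h1] with z hz
      have h2 : HasFDerivAt (fun y : E d => y - z) (ContinuousLinearMap.id ℝ (E d)) x :=
        (hasFDerivAt_id x).sub_const z
      exact ((hz.hasFDerivAt.comp x h2)).const_smul ((ρ j).normed volume z)
  refine ⟨ψ, hψ, ?_, ?_, ?_⟩
  · intro j x
    rw [← dist_eq_norm]
    refine (ρ j).dist_normed_convolution_le hθ.continuous.aestronglyMeasurable fun y hy => ?_
    refine (hθ.dist_le_mul y x).trans ?_
    gcongr
    exact (Metric.mem_ball.1 hy).le
  · intro j x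
    refine norm_gradient_le_of_lipschitz (LipschitzWith.of_dist_le_mul fun x y => ?_) x
    have hint : ∀ x, Integrable (fun z => (ρ j).normed volume z * θ (x - z)) := fun x => by
      have hc := hθ.continuous
      have hρc : Continuous ((ρ j).normed volume) := (ρ j).continuous_normed
      refine Continuous.integrable_of_hasCompactSupport (by fun_prop) ?_
      exact (ρ j).hasCompactSupport_normed.mul_right
    have e : ψ j x - ψ j y = ∫ z, (ρ j).normed volume z * (θ (x - z) - θ (y - z)) := by
      simp only [mul_sub]
      rw [integral_sub (hint x) (hint y)]; rfl
    rw [Real.dist_eq, e]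
    have h3 : ∀ z, ‖(ρ j).normed volume z * (θ (x - z) - θ (y - z))‖ ≤
        (ρ j).normed volume z * (K * dist x y) := by
      intro z
      have h2 := (ρ j).nonneg_normed (μ := volume) z
      rw [norm_mul, Real.norm_of_nonneg h2, ← dist_eq_norm]
      gcongr
      simpa using hθ.dist_le_mul (x - z) (y - z)
    refine (norm_integral_le_of_norm_le ((ρ j).integrable_normed.mul_const _) (ae_of_all _ h3)).trans ?_
    rw [integral_mul_const, (ρ j).integral_normed, one_mul]
  · have ht : Tendsto (fun j => (ρ j).rOut) atTop (𝓝 0) := tendsto_one_div_add_atTop_nhds_zero_nat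
    have h1 := ContDiffBump.ae_convolution_tendsto_right_of_locallyIntegrable (φ := ρ) (K := 2) ht
      (Eventually.of_forall fun j => by simp only [ρ]; linarith) hli
    filter_upwards [h1] with x hx
    refine (((InnerProductSpace.toDual ℝ (E d)).symm.continuous.tendsto _).comp hx).congr fun j => ?_
    simp only [Function.comp_apply, gradient, (hd j x).fderiv]

/-! ### Approximation by smooth functions -/

theorem eLpNorm_two_sq {X F : Type*} [MeasurableSpace X] [NormedAddCommGroup F] {μ : Measure X}
    (f : X → F) : eLpNorm f 2 μ ^ 2 = ∫⁻ x, ‖f x‖ₑ ^ 2 ∂μ := by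
  have h := eLpNorm_nnreal_pow_eq_lintegral (f := f) (μ := μ) (p := 2) (by norm_num)
  simpa using h

theorem tendsto_eLpNorm_two_zero {X F : Type*} [MeasurableSpace X] [NormedAddCommGroup F]
    {μ : Measure X} {f : ℕ → X → F}
    (h : Tendsto (fun k => ∫⁻ x, ‖f k x‖ₑ ^ 2 ∂μ) atTop (𝓝 0)) :
    Tendsto (fun k => eLpNorm (f k) 2 μ) atTop (𝓝 0) := by
  have h1 := ((ENNReal.continuous_rpow_const (y := (1 / 2 : ℝ))).tendsto 0).comp h
  rw [ENNReal.zero_rpow_of_pos (by norm_num)] at h1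
  refine h1.congr fun k => ?_
  rw [Function.comp_apply, ← eLpNorm_two_sq, ← ENNReal.rpow_natCast, ← ENNReal.rpow_mul]
  norm_num

theorem gradient_mul_apply {φ ψ : E d → ℝ} (hφ : ContDiff ℝ (⊤ : ℕ∞) φ)
    (hψ : ContDiff ℝ (⊤ : ℕ∞) ψ) (x : E d) :
    gradient (fun y => ψ y * φ y) x = ψ x • gradient φ x + φ x • gradient ψ x := by
  have h1 : DifferentiableAt ℝ φ x := (hφ.differentiable (by simp)) x
  have h2 : DifferentiableAt ℝ ψ x := (hψ.differentiable (by simp)) x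
  simp only [gradient]
  rw [fderiv_fun_mul h2 h1, map_add, map_smul, map_smul]

/-- The product of a Lipschitz function and a smooth function is approximated by smooth functions, in
`H¹(U)` and in `L²` of a portion of the boundary. -/
theorem exists_smooth_approx_mul {θ φ : E d → ℝ} {K : NNReal} (hθ : LipschitzWith K θ)
    (hφ : ContDiff ℝ (⊤ : ℕ∞) φ) {U Γ : Set (E d)} (hU : MeasurableSet U)
    (hUb : Bornology.IsBounded U) (hΓ : MeasurableSet Γ) (hΓU : Γ ⊆ closure U) {μ : Measure (E d)}
    (hμ : μ Γ ≠ ∞) : ∃ ψ : ℕ → E d → ℝ, (∀ j, ContDiff ℝ (⊤ : ℕ∞) (ψ j)) ∧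
      Tendsto (fun j => eLpNorm (fun x => ψ j x - θ x * φ x) 2 (volume.restrict U)) atTop (𝓝 0) ∧
      Tendsto (fun j => eLpNorm (fun x => gradient (ψ j) x -
        (θ x • gradient φ x + φ x • gradient θ x)) 2 (volume.restrict U)) atTop (𝓝 0) ∧
      Tendsto (fun j => eLpNorm (fun x => ψ j x - θ x * φ x) 2 (μ.restrict Γ)) atTop (𝓝 0) := by
  obtain ⟨ψ, hψ, hψ1, hψ2, hψ3⟩ := exists_smooth_approx hθ
  obtain ⟨M, hM⟩ := hUb.isCompact_closure.exists_bound_of_continuousOn hφ.continuous.continuousOn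
  obtain ⟨M', hM'⟩ := hUb.isCompact_closure.exists_bound_of_continuousOn
    (continuous_gradient hφ).continuousOn
  have hcl : ∀ x ∈ U, x ∈ closure U := fun x hx => subset_closure hx
  have hvol : volume U ≠ ∞ := hUb.measure_lt_top.ne
  have ht0 : Tendsto (fun j : ℕ => (K : ℝ) * (1 / ((j : ℝ) + 1))) atTop (𝓝 0) := by
    simpa using tendsto_one_div_add_atTop_nhds_zero_nat.const_mul (K : ℝ)
  -- A uniform bound tending to zero gives convergence in `L²` of a finite measure.
  have hunif : ∀ {F : Type} [NormedAddCommGroup F] (f : ℕ → E d → F) (ν : Measure (E d))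
      (S : Set (E d)) (_ : MeasurableSet S) (_ : ν S ≠ ∞) (m : ℝ),
      (∀ j, ∀ x ∈ S, ‖f j x‖ ≤ K * (1 / ((j : ℝ) + 1)) * m) →
      Tendsto (fun j => eLpNorm (f j) 2 (ν.restrict S)) atTop (𝓝 0) := by
    intro F _ f ν S hS hνS m hf
    have h1 : Tendsto (fun j : ℕ => (ν.restrict S) Set.univ ^ ((2 : ℝ≥0∞).toReal⁻¹) *
        ENNReal.ofReal ((K : ℝ) * (1 / ((j : ℝ) + 1)) * m)) atTop (𝓝 0) := by
      have h2 := ENNReal.tendsto_ofReal (ht0.mul_const m)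
      rw [zero_mul, ENNReal.ofReal_zero] at h2
      have h3 := ENNReal.Tendsto.const_mul (a := (ν.restrict S) Set.univ ^ ((2 : ℝ≥0∞).toReal⁻¹)) h2
        (Or.inr (by rw [Measure.restrict_apply_univ]; finiteness))
      simpa using h3
    refine tendsto_of_tendsto_of_tendsto_of_le_of_le tendsto_const_nhds h1 (fun _ => zero_le)
      fun j => ?_
    exact eLpNorm_le_of_ae_bound (ae_restrict_of_forall_mem hS (hf j))
  have hb1 : ∀ j, ∀ x ∈ closure U, ‖ψ j x * φ x - θ x * φ x‖ ≤ K * (1 / ((j : ℝ) + 1)) * M := by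
    intro j x hx
    rw [← sub_mul, norm_mul]
    exact mul_le_mul (hψ1 j x) (hM x hx) (norm_nonneg _) (by positivity)
  refine ⟨fun j x => ψ j x * φ x, fun j => (hψ j).mul hφ, ?_, ?_, ?_⟩
  · exact hunif _ _ U hU hvol M fun j x hx => hb1 j x (hcl x hx)
  · have hs1 : Tendsto (fun j => eLpNorm (fun x => (ψ j x - θ x) • gradient φ x) 2
        (volume.restrict U)) atTop (𝓝 0) := by
      refine hunif _ _ U hU hvol M' fun j x hx => ?_
      rw [norm_smul]
      exact mul_le_mul (hψ1 j x) (hM' x (hcl x hx)) (norm_nonneg _) (by positivity)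
    have hm : ∀ j, Measurable fun x => φ x • (gradient (ψ j) x - gradient θ x) := fun j =>
      hφ.continuous.measurable.smul
        ((continuous_gradient (hψ j)).measurable.sub (measurable_gradient θ))
    have hs2 : Tendsto (fun j => eLpNorm (fun x => φ x • (gradient (ψ j) x - gradient θ x)) 2
        (volume.restrict U)) atTop (𝓝 0) := by
      refine tendsto_eLpNorm_two_zero ?_
      have hdc := tendsto_lintegral_of_dominated_convergence (μ := volume.restrict U)
        (F := fun j x => ‖φ x • (gradient (ψ j) x - gradient θ x)‖ₑ ^ 2) (f := fun _ => 0)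
        (fun _ => ENNReal.ofReal (M * (K + K)) ^ 2)
        (fun j => (hm j).enorm.pow_const 2)
        (fun j => ae_restrict_of_forall_mem hU fun x hx => by
          dsimp only
          gcongr
          rw [← ofReal_norm, norm_smul]
          refine ENNReal.ofReal_le_ofReal ?_
          refine mul_le_mul (hM x (hcl x hx)) ?_ (norm_nonneg _)
            ((norm_nonneg _).trans (hM x (hcl x hx)))
          exact (norm_sub_le _ _).trans
            (add_le_add (hψ2 j x) (norm_gradient_le_of_lipschitz hθ x)))
        (by
          rw [lintegral_const, Measure.restrict_apply_univ]; finiteness)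
        (by
          refine ae_restrict_of_ae ?_
          filter_upwards [hψ3] with x hx
          have h1 := ((hx.sub_const (gradient θ x)).const_smul (φ x)).enorm
          rw [sub_self, smul_zero, enorm_zero] at h1
          have h2 := ((ENNReal.continuous_pow 2).tendsto (0 : ℝ≥0∞)).comp h1
          simpa [Function.comp_def] using h2)
      simpa using hdc
    refine tendsto_eLpNorm_add (fun j => ?_) (fun j => (hm j).aestronglyMeasurable)
      (fun j => ae_of_all _ fun x => ?_) hs1 hs2
    · exact (((hψ j).continuous.sub hθ.continuous).smul (continuous_gradient hφ)).aestronglyMeasurable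
    · dsimp only
      rw [gradient_mul_apply hφ (hψ j), sub_smul, smul_sub]; abel
  · exact hunif _ _ Γ hΓ hμ M fun j x hx => hb1 j x (hΓU hx)

/-- Vanishing of the trace, with a single smooth function for each accuracy. -/
theorem hasZeroTrace_iff {U Γ : Set (E d)} {u : L2Pair U} :
    HasZeroTrace U Γ u ↔ ∀ ε : ℝ≥0∞, 0 < ε → ∃ φ : E d → ℝ, ContDiff ℝ (⊤ : ℕ∞) φ ∧
      eLpNorm (fun x => φ x - u.fst x) 2 (volume.restrict U) ≤ ε ∧
      eLpNorm (fun x => gradient φ x - u.snd x) 2 (volume.restrict U) ≤ ε ∧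
      eLpNorm φ 2 ((Measure.hausdorffMeasure ((d : ℝ) - 1)).restrict Γ) ≤ ε := by
  constructor
  · rintro ⟨φ, hφ, h1, h2, h3⟩ ε hε
    obtain ⟨k, k1, k2, k3⟩ := (((h1.eventually_le_const hε).and ((h2.eventually_le_const hε).and
      (h3.eventually_le_const hε)))).exists
    exact ⟨φ k, hφ k, k1, k2, k3⟩
  · intro h
    choose φ hφ h1 h2 h3 using fun k : ℕ => h ((k : ℝ≥0∞) + 1)⁻¹ (by simp [ENNReal.inv_pos])
    have ht : Tendsto (fun k : ℕ => ((k : ℝ≥0∞) + 1)⁻¹) atTop (𝓝 0) := by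
      have := (tendsto_add_atTop_iff_nat 1).2 ENNReal.tendsto_inv_nat_nhds_zero
      simpa using this
    exact ⟨φ, hφ,
      tendsto_of_tendsto_of_tendsto_of_le_of_le tendsto_const_nhds ht (fun _ => zero_le) h1,
      tendsto_of_tendsto_of_tendsto_of_le_of_le tendsto_const_nhds ht (fun _ => zero_le) h2,
      tendsto_of_tendsto_of_tendsto_of_le_of_le tendsto_const_nhds ht (fun _ => zero_le) h3⟩

/-- Multiplication by a bounded Lipschitz function preserves vanishing traces, and creates them where
the factor vanishes. -/
theorem MSGFEM.HasZeroTrace.mul {U V ΓU ΓV : Set (E d)} {θ : E d → ℝ} {K : NNReal}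
    (hθ : LipschitzWith K θ) (hθ1 : ∀ x, ‖θ x‖ ≤ 1) (hU : MeasurableSet U) (hUV : U ⊆ V)
    (hUb : Bornology.IsBounded U) (hΓU : MeasurableSet ΓU) (hΓV : MeasurableSet ΓV)
    (hΓcl : ΓU ⊆ closure U) (hfin : Measure.hausdorffMeasure ((d : ℝ) - 1) ΓU ≠ ∞)
    (hΓ : ∀ x ∈ ΓU, θ x = 0 ∨ x ∈ ΓV) {u : L2Pair V} (hu : HasZeroTrace V ΓV u) {w : L2Pair U}
    (hw1 : w.fst =ᵐ[volume.restrict U] fun x => θ x * u.fst x)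
    (hw2 : w.snd =ᵐ[volume.restrict U] fun x => θ x • u.snd x + u.fst x • gradient θ x) :
    HasZeroTrace U ΓU w := by
  rw [hasZeroTrace_iff] at hu ⊢
  intro ε hε
  rcases eq_or_ne ε ∞ with rfl | hε'
  · exact ⟨fun _ => 0, contDiff_const, le_top, le_top, le_top⟩
  -- The error in the gradient is at most `δ` (mollification of `θ`) plus `δ + K δ` (product rule).
  set δ : ℝ≥0∞ := ε / (2 + K) with hδ
  have hδ0 : 0 < δ := ENNReal.div_pos hε.ne' (by finiteness)
  have hδε : δ + (δ + K * δ) = ε := by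
    rw [show δ + (δ + K * δ) = (2 + K) * δ by ring, hδ,
      ENNReal.mul_div_cancel (by simp) (by finiteness)]
  obtain ⟨φ, hφ, h1, h2, h3⟩ := hu δ hδ0
  obtain ⟨ψ, hψ, k1, k2, k3⟩ := exists_smooth_approx_mul hθ hφ hU hUb hΓU hΓcl hfin
  obtain ⟨j, j1, j2, j3⟩ := (((k1.eventually_le_const hδ0).and ((k2.eventually_le_const hδ0).and
      (k3.eventually_le_const hδ0)))).exists
  have hμ : volume.restrict U ≤ volume.restrict V := Measure.restrict_mono hUV le_rfl
  have hm1 : AEStronglyMeasurable (fun x => φ x - u.fst x) (volume.restrict U) :=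
    (hφ.continuous.aestronglyMeasurable.sub (Lp.aestronglyMeasurable u.fst)).mono_measure hμ
  have hm2 : AEStronglyMeasurable (fun x => gradient φ x - u.snd x) (volume.restrict U) :=
    ((continuous_gradient hφ).aestronglyMeasurable.sub (Lp.aestronglyMeasurable u.snd)).mono_measure hμ
  have hmθ : Measurable (gradient θ) := measurable_gradient θ
  have hθm : AEStronglyMeasurable θ (volume.restrict U) := hθ.continuous.aestronglyMeasurable
  have d1 := (eLpNorm_mono_measure (fun x => φ x - u.fst x) hμ (p := 2)).trans h1
  have d2 := (eLpNorm_mono_measure (fun x => gradient φ x - u.snd x) hμ (p := 2)).trans h2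
  have hθφm : ∀ μ : Measure (E d), AEStronglyMeasurable (fun x => θ x * φ x) μ := fun μ =>
    (hθ.continuous.mul hφ.continuous).aestronglyMeasurable
  refine ⟨ψ j, hψ j, ?_, ?_, ?_⟩
  · have e : (fun x => ψ j x - w.fst x) =ᵐ[volume.restrict U]
        (fun x => ψ j x - θ x * φ x) + fun x => θ x * (φ x - u.fst x) := by
      filter_upwards [hw1] with x hx
      rw [hx, Pi.add_apply]; ring
    rw [eLpNorm_congr_ae e]
    refine (eLpNorm_add_le ((hψ j).continuous.aestronglyMeasurable.sub (hθφm _))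
      (hθm.mul hm1) (by norm_num)).trans ?_
    calc _ ≤ δ + δ := by
          refine add_le_add j1 (le_trans ?_ d1)
          refine eLpNorm_mono fun x => ?_
          rw [Pi.mul_apply, norm_mul]
          exact mul_le_of_le_one_left (norm_nonneg _) (hθ1 x)
      _ ≤ ε := by rw [← hδε]; gcongr; exact le_self_add
  · have e : (fun x => gradient (ψ j) x - w.snd x) =ᵐ[volume.restrict U]
        (fun x => gradient (ψ j) x - (θ x • gradient φ x + φ x • gradient θ x)) +
        ((fun x => θ x • (gradient φ x - u.snd x)) +
          fun x => (φ x - u.fst x) • gradient θ x) := by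
      filter_upwards [hw2] with x hx
      simp only [hx, Pi.add_apply, smul_sub, sub_smul]; abel
    rw [eLpNorm_congr_ae e]
    have hA : AEStronglyMeasurable (fun x => θ x • (gradient φ x - u.snd x)) (volume.restrict U) :=
      hθm.smul hm2
    have hB : AEStronglyMeasurable (fun x => (φ x - u.fst x) • gradient θ x) (volume.restrict U) :=
      hm1.smul hmθ.aestronglyMeasurable
    have hC : AEStronglyMeasurable (fun x => gradient (ψ j) x -
        (θ x • gradient φ x + φ x • gradient θ x)) (volume.restrict U) :=
      (continuous_gradient (hψ j)).aestronglyMeasurable.sub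
        ((hθ.continuous.smul (continuous_gradient hφ)).aestronglyMeasurable.add
          (hφ.continuous.aestronglyMeasurable.smul hmθ.aestronglyMeasurable))
    refine (eLpNorm_add_le hC (hA.add hB) (by norm_num)).trans ?_
    rw [← hδε]
    refine add_le_add j2 ((eLpNorm_add_le hA hB (by norm_num)).trans (add_le_add ?_ ?_))
    · refine (eLpNorm_mono fun x => ?_).trans d2
      rw [norm_smul]
      exact mul_le_of_le_one_left (norm_nonneg _) (hθ1 x)
    · refine le_trans ?_ (mul_le_mul_right d1 (K : ℝ≥0∞))
      refine eLpNorm_le_nnreal_smul_eLpNorm_of_ae_le_mul (ae_of_all _ fun x => ?_) 2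
      have h5 := norm_gradient_le_of_lipschitz hθ x
      rw [nnnorm_smul, mul_comm]
      gcongr
      exact_mod_cast h5
  · have e : ψ j = (fun x => ψ j x - θ x * φ x) + fun x => θ x * φ x := by
      funext x; simp
    rw [e]
    refine (eLpNorm_add_le ((hψ j).continuous.aestronglyMeasurable.sub (hθφm _)) (hθφm _)
      (by norm_num)).trans ?_
    calc _ ≤ δ + δ := by
          refine add_le_add j3 (le_trans ?_ h3)
          rw [← ENNReal.pow_le_pow_left_iff two_ne_zero, eLpNorm_two_sq, eLpNorm_two_sq]
          calc ∫⁻ x in ΓU, ‖θ x * φ x‖ₑ ^ 2 ∂(Measure.hausdorffMeasure ((d : ℝ) - 1))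
              ≤ ∫⁻ x in ΓU, ΓV.indicator (fun x => ‖φ x‖ₑ ^ 2) x
                  ∂(Measure.hausdorffMeasure ((d : ℝ) - 1)) := by
                refine setLIntegral_mono' hΓU fun x hx => ?_
                rcases hΓ x hx with h0 | h0
                · simp [h0]
                · rw [Set.indicator_of_mem h0]
                  gcongr
                  rw [enorm_mul]
                  refine mul_le_of_le_one_left zero_le ?_
                  rw [← ofReal_norm, ENNReal.ofReal_le_one]
                  exact hθ1 x
            _ = ∫⁻ x in ΓV ∩ ΓU, ‖φ x‖ₑ ^ 2 ∂(Measure.hausdorffMeasure ((d : ℝ) - 1)) := by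
                rw [lintegral_indicator hΓV, Measure.restrict_restrict hΓV]
            _ ≤ _ := lintegral_mono_set Set.inter_subset_left
      _ ≤ ε := by rw [← hδε]; gcongr; exact le_self_add

/-! ### Bounded multipliers between `L²` spaces -/

/-- A bounded measurable field of linear maps acts on square integrable functions. -/
theorem exists_multiplier {F G : Type*} [NormedAddCommGroup F] [NormedSpace ℝ F]
    [NormedAddCommGroup G] [NormedSpace ℝ G] {X : Type*} [MeasurableSpace X] {μ ν : Measure X}
    (hμν : μ ≤ ν) {L : X → F →L[ℝ] G} (hL : AEStronglyMeasurable L μ) {C : ℝ}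
    (hC0 : 0 ≤ C) (hC : ∀ᵐ x ∂μ, ‖L x‖ ≤ C) :
    ∃ T : Lp F 2 ν →L[ℝ] Lp G 2 μ, ∀ f, T f =ᵐ[μ] fun x => L x (f x) := by
  have hle : ∀ f : Lp F 2 ν, ∀ᵐ x ∂μ, ‖L x (f x)‖ ≤ C * ‖f x‖ := fun f => by
    filter_upwards [hC] with x hx
    exact (L x).le_of_opNorm_le hx _
  have hf : ∀ f : Lp F 2 ν, MemLp (fun x => L x (f x)) 2 μ := fun f =>
    ((Lp.memLp f).mono_measure hμν).of_le_mul
      ((ContinuousLinearMap.id ℝ (F →L[ℝ] G)).aestronglyMeasurable_comp₂ hL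
        ((Lp.aestronglyMeasurable f).mono_measure hμν)) (hle f)
  have hac := Measure.absolutelyContinuous_of_le hμν
  let T : Lp F 2 ν →ₗ[ℝ] Lp G 2 μ :=
    { toFun := fun f => (hf f).toLp _
      map_add' := fun f g => by
        refine Lp.ext ?_
        filter_upwards [(hf (f + g)).coeFn_toLp, (hf f).coeFn_toLp, (hf g).coeFn_toLp,
          Lp.coeFn_add ((hf f).toLp _) ((hf g).toLp _), hac.ae_le (Lp.coeFn_add f g)]
          with x h1 h2 h3 h4 h5
        rw [h1, h4, Pi.add_apply, h2, h3, h5, Pi.add_apply, map_add]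
      map_smul' := fun c f => by
        refine Lp.ext ?_
        filter_upwards [(hf (c • f)).coeFn_toLp, (hf f).coeFn_toLp,
          Lp.coeFn_smul c ((hf f).toLp _), hac.ae_le (Lp.coeFn_smul c f)] with x h1 h2 h3 h4
        rw [RingHom.id_apply, h1, h3, Pi.smul_apply, h2, h4, Pi.smul_apply, map_smul] }
  refine ⟨T.mkContinuous C fun f => ?_, fun f => (hf f).coeFn_toLp⟩
  have h1 : eLpNorm (fun x => L x (f x)) 2 μ ≤ ENNReal.ofReal C * eLpNorm f 2 ν :=
    (eLpNorm_le_mul_eLpNorm_of_ae_le_mul (hle f) 2).trans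
      (mul_le_mul_right (eLpNorm_mono_measure f hμν) _)
  change ‖(hf f).toLp _‖ ≤ _
  rw [Lp.norm_toLp, Lp.norm_def]
  calc _ ≤ (ENNReal.ofReal C * eLpNorm f 2 ν).toReal :=
        ENNReal.toReal_mono (by finiteness [Lp.eLpNorm_ne_top f]) h1
    _ = _ := by rw [ENNReal.toReal_mul, ENNReal.toReal_ofReal hC0]

/-- Multiplication by a bounded Lipschitz function, with the gradient given by the product rule. -/
theorem exists_mulPair {θ : E d → ℝ} {K : NNReal} (hθ : LipschitzWith K θ) (hθ1 : ∀ x, ‖θ x‖ ≤ 1)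
    {U V : Set (E d)} (hUV : U ⊆ V) : ∃ M : L2Pair V →L[ℝ] L2Pair U, ∀ u : L2Pair V,
      ((M u).fst =ᵐ[volume.restrict U] fun x => θ x * u.fst x) ∧
      ((M u).snd =ᵐ[volume.restrict U] fun x => θ x • u.snd x + u.fst x • gradient θ x) := by
  have hμ : volume.restrict U ≤ volume.restrict V := Measure.restrict_mono hUV le_rfl
  have hθm : AEStronglyMeasurable θ (volume.restrict U) := hθ.continuous.aestronglyMeasurable
  have hscal : ∀ F : Type, ∀ [NormedAddCommGroup F] [NormedSpace ℝ F],
      ∃ T : Lp F 2 (volume.restrict V) →L[ℝ] Lp F 2 (volume.restrict U),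
        ∀ f, T f =ᵐ[volume.restrict U] fun x => (θ x • ContinuousLinearMap.id ℝ F) (f x) :=
    fun F _ _ => exists_multiplier hμ (hθm.smul_const _) zero_le_one (ae_of_all _ fun x => by
      rw [norm_smul]
      exact mul_le_one₀ (hθ1 x) (norm_nonneg _) ContinuousLinearMap.norm_id_le)
  obtain ⟨T₁, hT₁⟩ := hscal ℝ
  obtain ⟨T₂, hT₂⟩ := hscal (E d)
  obtain ⟨T₃, hT₃⟩ := exists_multiplier (F := ℝ) (G := E d) hμ
    (L := fun x => ContinuousLinearMap.toSpanSingleton ℝ (gradient θ x)) (C := K)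
    ((ContinuousLinearMap.toSpanSingletonCLE (𝕜 := ℝ) (E := E d)).continuous.comp_aestronglyMeasurable
      (measurable_gradient θ).aestronglyMeasurable) K.2 (ae_of_all _ fun x => by
        rw [ContinuousLinearMap.norm_toSpanSingleton]
        exact norm_gradient_le_of_lipschitz hθ x)
  let p := WithLp.fstL 2 ℝ (Lp ℝ 2 (volume.restrict V)) (Lp (E d) 2 (volume.restrict V))
  let q := WithLp.sndL 2 ℝ (Lp ℝ 2 (volume.restrict V)) (Lp (E d) 2 (volume.restrict V))
  refine ⟨(WithLp.prodContinuousLinearEquiv 2 ℝ (Lp ℝ 2 (volume.restrict U))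
    (Lp (E d) 2 (volume.restrict U))).symm.toContinuousLinearMap ∘L
    ((T₁ ∘L p).prod (T₂ ∘L q + T₃ ∘L p)), fun u => ⟨?_, ?_⟩⟩
  · filter_upwards [hT₁ u.fst] with x hx
    change T₁ u.fst x = _
    rw [hx]; simp
  · filter_upwards [hT₂ u.snd, hT₃ u.fst, Lp.coeFn_add (T₂ u.snd) (T₃ u.fst)] with x h1 h2 h3
    change (T₂ u.snd + T₃ u.fst : Lp (E d) 2 (volume.restrict U)) x = _
    rw [h3, Pi.add_apply, h1, h2]; simp

/-! ### Smooth functions as elements of `H¹(U)` -/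

theorem memLp_of_continuous {F : Type*} [NormedAddCommGroup F] {U : Set (E d)} (hU : MeasurableSet U)
    (hUb : Bornology.IsBounded U) {f : E d → F} (hf : Continuous f) :
    MemLp f 2 (volume.restrict U) := by
  obtain ⟨M, hM⟩ := hUb.isCompact_closure.exists_bound_of_continuousOn hf.continuousOn
  have : IsFiniteMeasure (volume.restrict U) := ⟨by simpa using hUb.measure_lt_top⟩
  exact MemLp.of_bound hf.aestronglyMeasurable M
    (ae_restrict_of_forall_mem hU fun x hx => hM x (subset_closure hx))

/-- `u` is the class of the smooth function `φ`, with its classical gradient. -/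
structure IsSmoothPair {U : Set (E d)} (φ : E d → ℝ) (u : L2Pair U) : Prop where
  smooth : ContDiff ℝ (⊤ : ℕ∞) φ
  fst : u.fst =ᵐ[volume.restrict U] φ
  snd : u.snd =ᵐ[volume.restrict U] gradient φ

theorem exists_isSmoothPair {U : Set (E d)} (hU : MeasurableSet U) (hUb : Bornology.IsBounded U)
    {φ : E d → ℝ} (hφ : ContDiff ℝ (⊤ : ℕ∞) φ) : ∃ u : L2Pair U, IsSmoothPair φ u := by
  have h1 := memLp_of_continuous hU hUb hφ.continuous
  have h2 := memLp_of_continuous hU hUb (continuous_gradient hφ)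
  exact ⟨WithLp.toLp 2 (h1.toLp φ, h2.toLp (gradient φ)), hφ, h1.coeFn_toLp, h2.coeFn_toLp⟩

theorem IsSmoothPair.enorm_fst_sq {U : Set (E d)} {φ : E d → ℝ} {u : L2Pair U}
    (h : IsSmoothPair φ u) : ‖u.fst‖ₑ ^ 2 = sqInt φ U := by
  rw [Lp.enorm_def, eLpNorm_congr_ae h.fst, eLpNorm_two_sq]; rfl

theorem IsSmoothPair.enorm_snd_sq {U : Set (E d)} {φ : E d → ℝ} {u : L2Pair U}
    (h : IsSmoothPair φ u) : ‖u.snd‖ₑ ^ 2 = sqInt (gradient φ) U := by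
  rw [Lp.enorm_def, eLpNorm_congr_ae h.snd, eLpNorm_two_sq]; rfl

theorem tendsto_L2Pair_iff {U : Set (E d)} {u : ℕ → L2Pair U} {w : L2Pair U} :
    Tendsto u atTop (𝓝 w) ↔ Tendsto (fun k => (u k).fst) atTop (𝓝 w.fst) ∧
      Tendsto (fun k => (u k).snd) atTop (𝓝 w.snd) := by
  rw [(WithLp.homeomorphProd 2 (Lp ℝ 2 (volume.restrict U))
    (Lp (E d) 2 (volume.restrict U))).isInducing.tendsto_nhds_iff, nhds_prod_eq, tendsto_prod_iff']
  rfl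

theorem MSGFEM.HasZeroTrace.exists_seq {U Γ : Set (E d)} (hU : MeasurableSet U)
    (hUb : Bornology.IsBounded U) {w : L2Pair U} (h : HasZeroTrace U Γ w) :
    ∃ (φ : ℕ → E d → ℝ) (u : ℕ → L2Pair U), (∀ k, IsSmoothPair (φ k) (u k)) ∧
      Tendsto u atTop (𝓝 w) ∧
      Tendsto (fun k => eLpNorm (φ k) 2 ((Measure.hausdorffMeasure ((d : ℝ) - 1)).restrict Γ))
        atTop (𝓝 0) := by
  obtain ⟨φ, hφ, h1, h2, h3⟩ := h
  choose u hu using fun k => exists_isSmoothPair hU hUb (hφ k)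
  refine ⟨φ, u, hu, tendsto_L2Pair_iff.2 ⟨?_, ?_⟩, h3⟩
  · rw [Lp.tendsto_Lp_iff_tendsto_eLpNorm']
    refine h1.congr fun k => eLpNorm_congr_ae ?_
    filter_upwards [(hu k).fst] with x hx
    rw [Pi.sub_apply, hx]
  · rw [Lp.tendsto_Lp_iff_tendsto_eLpNorm']
    refine h2.congr fun k => eLpNorm_congr_ae ?_
    filter_upwards [(hu k).snd] with x hx
    rw [Pi.sub_apply, hx]

/-! ### Closedness of the Sobolev spaces -/

/-- Tested against a fixed direction, the defining identity of `H¹(U)` relates two `L²` inner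
products. -/
theorem mem_H1_iff {U : Set (E d)} {u : L2Pair U} : u ∈ H1 U ↔ ∀ (φ : E d → ℝ)
    (hφ : IsTestFunction U φ) (e : E d),
      inner ℝ (((innerSL ℝ e).comp_memLp' hφ.gradient_memLp).toLp _) u.fst =
        - inner ℝ (((ContinuousLinearMap.toSpanSingleton ℝ e).comp_memLp' hφ.memLp).toLp _) u.snd := by
  refine forall₂_congr fun φ hφ => ?_
  have h1 : ∀ e : E d, inner ℝ (((innerSL ℝ e).comp_memLp' hφ.gradient_memLp).toLp _) u.fst =
      inner ℝ e (∫ x in U, u.fst x • gradient φ x) := by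
    intro e
    rw [← integral_inner (integrable_smul_of_memLp (Lp.memLp u.fst) hφ.gradient_memLp), L2.inner_def]
    refine integral_congr_ae ?_
    filter_upwards [((innerSL ℝ e).comp_memLp' hφ.gradient_memLp).coeFn_toLp] with x hx
    rw [hx, real_inner_smul_right]
    simp
  have h2 : ∀ e : E d,
      inner ℝ (((ContinuousLinearMap.toSpanSingleton ℝ e).comp_memLp' hφ.memLp).toLp _) u.snd =
      inner ℝ e (∫ x in U, φ x • u.snd x) := by
    intro e
    rw [← integral_inner (integrable_smul_of_memLp hφ.memLp (Lp.memLp u.snd)), L2.inner_def]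
    refine integral_congr_ae ?_
    filter_upwards [((ContinuousLinearMap.toSpanSingleton ℝ e).comp_memLp' hφ.memLp).coeFn_toLp]
      with x hx
    rw [hx, real_inner_smul_right]
    simp [real_inner_smul_left]
  simp only [h1, h2, ← inner_neg_right]
  exact ⟨fun h e => by rw [h], fun h => ext_inner_left ℝ h⟩

theorem isClosed_H1 (U : Set (E d)) : IsClosed (H1 U : Set (L2Pair U)) := by
  have : (H1 U : Set (L2Pair U)) = ⋂ (φ : E d → ℝ) (hφ : IsTestFunction U φ) (e : E d), {u |
      inner ℝ (((innerSL ℝ e).comp_memLp' hφ.gradient_memLp).toLp _) u.fst =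
        - inner ℝ (((ContinuousLinearMap.toSpanSingleton ℝ e).comp_memLp' hφ.memLp).toLp _) u.snd} := by
    ext u
    simp only [Set.mem_iInter, SetLike.mem_coe, Set.mem_ofPred_eq]
    exact mem_H1_iff
  rw [this]
  refine isClosed_iInter fun φ => isClosed_iInter fun hφ => isClosed_iInter fun e => ?_
  have c1 : Continuous fun u : L2Pair U => u.fst := WithLp.continuous_fst ..
  have c2 : Continuous fun u : L2Pair U => u.snd := WithLp.continuous_snd ..
  exact isClosed_eq (continuous_const.inner c1) (continuous_const.inner c2).neg

theorem IsSmoothPair.mem_H1 {U : Set (E d)} {φ : E d → ℝ} {u : L2Pair U}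
    (h : IsSmoothPair φ u) : u ∈ H1 U := by
  intro ψ hψ
  have hφd : Differentiable ℝ φ := h.smooth.differentiable (by simp)
  have hψd : Differentiable ℝ ψ := hψ.smooth.differentiable (by simp)
  have cφ := h.smooth.continuous
  have cψ := hψ.smooth.continuous
  have gφ := continuous_gradient h.smooth
  have gψ := continuous_gradient hψ.smooth
  have sψ := hψ.compact
  have sg : HasCompactSupport (gradient ψ) :=
    (hψ.compact.fderiv ℝ).comp_left (g := (InnerProductSpace.toDual ℝ (E d)).symm) (map_zero _)
  have i1 : Integrable (fun x => φ x • gradient ψ x) :=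
    (cφ.smul gψ).integrable_of_hasCompactSupport sg.smul_left
  have i2 : Integrable (fun x => ψ x • gradient φ x) :=
    (cψ.smul gφ).integrable_of_hasCompactSupport sψ.smul_right
  have i3 : Integrable (fun x => φ x * ψ x) :=
    (cφ.mul cψ).integrable_of_hasCompactSupport sψ.mul_left
  have key : ∫ x, φ x • gradient ψ x = - ∫ x, ψ x • gradient φ x := by
    refine ext_inner_left ℝ fun e => ?_
    rw [inner_neg_right, ← integral_inner i1, ← integral_inner i2]
    have e1 : ∀ x, inner ℝ e (φ x • gradient ψ x) = φ x * fderiv ℝ ψ x e := fun x => by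
      rw [real_inner_smul_right, real_inner_comm, inner_gradient_left]
    have e2 : ∀ x, inner ℝ e (ψ x • gradient φ x) = fderiv ℝ φ x e * ψ x := fun x => by
      rw [real_inner_smul_right, real_inner_comm, inner_gradient_left, mul_comm]
    have j1 := i1.const_inner (𝕜 := ℝ) e
    have j2 := i2.const_inner (𝕜 := ℝ) e
    simp only [e1, e2] at j1 j2 ⊢
    exact integral_mul_fderiv_eq_neg_fderiv_mul_of_integrable j2 j1 i3 (fun x _ => hφd x)
      fun x _ => hψd x
  have hz : ∀ x ∉ U, ψ x = 0 ∧ gradient ψ x = 0 := fun x hx => by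
    have hx' : x ∉ tsupport ψ := fun h => hx (hψ.support h)
    refine ⟨image_eq_zero_of_notMem_tsupport hx', ?_⟩
    rw [gradient, (notMem_tsupport_iff_eventuallyEq.1 hx').fderiv_eq]
    simp
  have e1 : ∫ x in U, u.fst x • gradient ψ x = ∫ x, φ x • gradient ψ x := by
    refine (integral_congr_ae ?_).trans (setIntegral_eq_integral_of_forall_compl_eq_zero (s := U)
      fun x hx => by rw [(hz x hx).2, smul_zero])
    filter_upwards [h.fst] with x hx
    rw [hx]
  have e2 : ∫ x in U, ψ x • u.snd x = ∫ x, ψ x • gradient φ x := by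
    refine (integral_congr_ae ?_).trans (setIntegral_eq_integral_of_forall_compl_eq_zero (s := U)
      fun x hx => by rw [(hz x hx).1, zero_smul])
    filter_upwards [h.snd] with x hx
    rw [hx]
  rw [e1, e2, key]

/-- Being a limit of smooth functions, a function with a vanishing trace lies in `H¹(U)`. -/
theorem MSGFEM.HasZeroTrace.mem_H1Zero {U Γ : Set (E d)} (hU : MeasurableSet U)
    (hUb : Bornology.IsBounded U) {w : L2Pair U} (h : HasZeroTrace U Γ w) : w ∈ H1Zero U Γ := by
  obtain ⟨φ, u, hu, ht, -⟩ := h.exists_seq hU hUb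
  exact ⟨(isClosed_H1 U).mem_of_tendsto ht (Eventually.of_forall fun k => (hu k).mem_H1), h⟩

theorem isClosed_H1Zero (U Γ : Set (E d)) : IsClosed (H1Zero U Γ : Set (L2Pair U)) := by
  refine (isClosed_H1 U).inter (isClosed_of_closure_subset fun u hu => ?_)
  change HasZeroTrace U Γ u
  rw [hasZeroTrace_iff]
  intro ε hε
  obtain ⟨w, hw, hd⟩ := EMetric.mem_closure_iff.1 hu (ε / 2) (ENNReal.half_pos hε.ne')
  change HasZeroTrace U Γ w at hw
  obtain ⟨φ, hφ, h1, h2, h3⟩ := hasZeroTrace_iff.1 hw (ε / 2) (ENNReal.half_pos hε.ne')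
  rw [edist_comm] at hd
  refine ⟨φ, hφ, ?_, ?_, h3.trans ENNReal.half_le_self⟩
  · have e : (fun x => φ x - u.fst x) = (fun x => φ x - w.fst x) + (⇑w.fst - ⇑u.fst) := by
      funext x; simp
    rw [e, ← ENNReal.add_halves ε]
    refine (eLpNorm_add_le (hφ.continuous.aestronglyMeasurable.sub (Lp.aestronglyMeasurable _))
      ((Lp.aestronglyMeasurable _).sub (Lp.aestronglyMeasurable _)) (by norm_num)).trans
      (add_le_add h1 ?_)
    rw [← Lp.edist_def]
    exact (WithLp.edist_fst_le w u).trans hd.le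
  · have e : (fun x => gradient φ x - u.snd x) = (fun x => gradient φ x - w.snd x) +
        (⇑w.snd - ⇑u.snd) := by
      funext x; simp
    rw [e, ← ENNReal.add_halves ε]
    refine (eLpNorm_add_le ((continuous_gradient hφ).aestronglyMeasurable.sub
      (Lp.aestronglyMeasurable _))
      ((Lp.aestronglyMeasurable _).sub (Lp.aestronglyMeasurable _)) (by norm_num)).trans
      (add_le_add h2 ?_)
    rw [← Lp.edist_def]
    exact (WithLp.edist_snd_le w u).trans hd.le

/-! ### Functional inequalities for limits of smooth functions -/

/-- Friedrichs' inequality for functions that vanish on `Γ`. -/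
theorem IsControlled.norm_fst_le {U Γ : Set (E d)} (hU : MeasurableSet U)
    (hUb : Bornology.IsBounded U)
    (h : IsControlled (fun φ => sqInt (gradient φ) U +
      ∫⁻ x in Γ, ‖φ x‖ₑ ^ 2 ∂(Measure.hausdorffMeasure ((d : ℝ) - 1))) U) :
    ∃ C : NNReal, ∀ w : L2Pair U, HasZeroTrace U Γ w → ‖w.fst‖ ^ 2 ≤ C * ‖w.snd‖ ^ 2 := by
  obtain ⟨C, hC⟩ := h
  refine ⟨C, fun w hw => ?_⟩
  obtain ⟨φ, u, hu, ht, h0⟩ := hw.exists_seq hU hUb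
  obtain ⟨t1, t2⟩ := tendsto_L2Pair_iff.1 ht
  have s1 := ((ENNReal.continuous_pow 2).tendsto _).comp t1.enorm
  have s2 := ((ENNReal.continuous_pow 2).tendsto _).comp t2.enorm
  have s3 := ((ENNReal.continuous_pow 2).tendsto _).comp h0
  have h1 := le_of_tendsto_of_tendsto' s1 (ENNReal.Tendsto.const_mul (a := (C : ℝ≥0∞)) (s2.add s3)
    (Or.inr (by simp))) fun k => by
      simp only [Function.comp_apply]
      rw [(hu k).enorm_fst_sq, (hu k).enorm_snd_sq, eLpNorm_two_sq]
      exact hC _ (hu k).smooth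
  rw [zero_pow two_ne_zero, add_zero] at h1
  simp only [enorm_eq_nnnorm] at h1
  exact_mod_cast h1

/-- Rellich's inequality: up to finitely many averages, the `L²` norm is a small multiple of the norm
of the gradient. -/
theorem HasFiniteApprox.exists_clm {U : Set (E d)} (hU : MeasurableSet U)
    (hUb : Bornology.IsBounded U) (h : HasFiniteApprox U Set.univ) {η : NNReal} (hη : 0 < η) :
    ∃ (S : Finset (Set (E d))) (T : L2Pair U →L[ℝ] (S → ℝ)) (C : NNReal), ∀ (w : L2Pair U) (Γ : Set (E d)),
      HasZeroTrace U Γ w → ‖w.fst‖ ^ 2 ≤ η * ‖w.snd‖ ^ 2 + C * ‖T w‖ ^ 2 := by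
  obtain ⟨S, C, hS, hC⟩ := h η hη
  have hfin : ∀ B, volume.restrict U B ≠ ∞ := fun B =>
    ((measure_mono (Set.subset_univ B)).trans_lt
      (by rw [Measure.restrict_apply_univ]; exact hUb.measure_lt_top)).ne
  let p := WithLp.fstL 2 ℝ (Lp ℝ 2 (volume.restrict U)) (Lp (E d) 2 (volume.restrict U))
  let T : L2Pair U →L[ℝ] (S → ℝ) := ContinuousLinearMap.pi fun B =>
    (innerSL ℝ (indicatorConstLp 2 (hS B B.2).1 (hfin B) (1 : ℝ))) ∘L p
  have hT : ∀ w B, T w B = ∫ x in (B : Set (E d)), w.fst x := fun w B => by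
    change inner ℝ (indicatorConstLp 2 (hS B B.2).1 (hfin B) (1 : ℝ)) w.fst = _
    rw [L2.inner_indicatorConstLp_one, Measure.restrict_restrict (hS B B.2).1,
      Set.inter_eq_left.2 (hS B B.2).2]
  refine ⟨S, T, C * S.card, fun w Γ hw => ?_⟩
  obtain ⟨φ, u, hu, ht, -⟩ := hw.exists_seq hU hUb
  obtain ⟨t1, t2⟩ := tendsto_L2Pair_iff.1 ht
  have s1 := ((ENNReal.continuous_pow 2).tendsto _).comp t1.enorm
  have s2 := ((ENNReal.continuous_pow 2).tendsto _).comp t2.enorm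
  have s3 := ((ENNReal.continuous_pow 2).tendsto _).comp ((T.continuous.tendsto w).comp ht).enorm
  have h1 := le_of_tendsto_of_tendsto' s1 ((ENNReal.Tendsto.const_mul (a := (η : ℝ≥0∞)) s2
    (Or.inr (by simp))).add (ENNReal.Tendsto.const_mul (a := (C * S.card : ℝ≥0∞)) s3
    (Or.inr (by finiteness)))) fun k => by
      simp only [Function.comp_apply]
      have h2 := hC _ (hu k).smooth
      rw [Set.inter_univ, ← (hu k).enorm_fst_sq, ← (hu k).enorm_snd_sq] at h2
      refine h2.trans (add_le_add_right ?_ _)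
      rw [mul_assoc]
      gcongr
      have h3 : ∀ B ∈ S, ‖∫ x in B, φ k x‖ₑ ^ 2 ≤ ‖T (u k)‖ₑ ^ 2 := fun B hB => by
        gcongr
        have h4 : ∫ x in B, φ k x = T (u k) ⟨B, hB⟩ := by
          rw [hT]
          refine integral_congr_ae ?_
          filter_upwards [ae_mono (Measure.restrict_mono (hS B hB).2 le_rfl) (hu k).fst] with x hx
          rw [hx]
        rw [h4]
        exact enorm_le_iff_norm_le.2 (norm_le_pi_norm _ _)
      calc _ ≤ ∑ B ∈ S, ‖T (u k)‖ₑ ^ 2 := Finset.sum_le_sum h3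
        _ = _ := by rw [Finset.sum_const, nsmul_eq_mul]
  simp only [enorm_eq_nnnorm] at h1
  exact_mod_cast h1

/-- An operator that is small up to finitely many coordinates is compact. -/
theorem isCompactOperator_of_approx {X Y : Type*} [NormedAddCommGroup X] [NormedSpace ℝ X]
    [NormedAddCommGroup Y] [NormedSpace ℝ Y] [CompleteSpace Y] (P : X →L[ℝ] Y)
    (h : ∀ η : NNReal, 0 < η → ∃ (S : Type) (_ : Fintype S) (T : X →L[ℝ] (S → ℝ)) (C : NNReal),
      ∀ u, ‖P u‖ ^ 2 ≤ η * ‖u‖ ^ 2 + C * ‖T u‖ ^ 2) : IsCompactOperator P := by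
  have htb : TotallyBounded (P '' Metric.closedBall 0 1) := by
    refine Metric.totallyBounded_iff.2 fun ε hε => ?_
    obtain ⟨S, _, T, C, hT⟩ := h (Real.toNNReal (ε ^ 2 / 16)) (by simp; positivity)
    rw [Real.coe_toNNReal _ (by positivity)] at hT
    have hb : TotallyBounded (T '' Metric.closedBall 0 1) :=
      ((T.lipschitz.isBounded_image
        Metric.isBounded_closedBall).isCompact_closure.totallyBounded).subset subset_closure
    set δ : ℝ := ε / (2 * (C + 1)) with hδ
    have hδ0 : 0 < δ := by positivity
    obtain ⟨t, ht, htf, hcov⟩ :=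
      Set.exists_subset_image_finite_and.1 (Metric.finite_approx_of_totallyBounded hb δ hδ0)
    refine ⟨P '' t, htf.image P, ?_⟩
    rintro _ ⟨u, hu, rfl⟩
    obtain ⟨_, ⟨w, hw, rfl⟩, hd⟩ := Set.mem_iUnion₂.1 (hcov ⟨u, hu, rfl⟩)
    refine Set.mem_iUnion₂.2 ⟨P w, ⟨w, hw, rfl⟩, ?_⟩
    rw [Metric.mem_ball, dist_eq_norm, ← map_sub] at hd ⊢
    have h1 := hT (u - w)
    have hu' := mem_closedBall_zero_iff.1 hu
    have hw' := mem_closedBall_zero_iff.1 (ht hw)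
    -- The two terms of the hypothesis are at most `4 ε² / 16` and `C δ² ≤ ε² / 4`.
    have h2 : ‖u - w‖ ^ 2 ≤ 2 ^ 2 := by
      gcongr
      exact (norm_sub_le _ _).trans (by linarith)
    have h3 : ‖T (u - w)‖ ^ 2 ≤ δ ^ 2 := by gcongr
    have h4 : (C : ℝ) * δ ^ 2 ≤ ε ^ 2 / 4 := by
      have hC : (0 : ℝ) ≤ C := C.2
      rw [hδ, div_pow, mul_pow, mul_div_assoc', div_le_div_iff₀ (by positivity) (by norm_num)]
      have : (C : ℝ) ≤ (C + 1) ^ 2 := by nlinarith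
      nlinarith [mul_le_mul_of_nonneg_right this (sq_nonneg ε)]
    refine lt_of_pow_lt_pow_left₀ 2 hε.le (h1.trans_lt ?_)
    have hC : (C : ℝ) * ‖T (u - w)‖ ^ 2 ≤ C * δ ^ 2 := by gcongr
    have hε2 : 0 < ε ^ 2 := by positivity
    nlinarith
  exact (isCompactOperator_iff_isCompact_closure_image_closedBall (P : X →ₗ[ℝ] Y) zero_lt_one).2
    (htb.closure.isCompact_of_isClosed isClosed_closure)

/-! ### The energy form as a bounded bilinear form -/

/-- The linear map of a matrix on Euclidean space. -/
noncomputable def matCLM (M : Matrix (Fin d) (Fin d) ℝ) : E d →L[ℝ] E d :=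
  ∑ i, ∑ j, M i j • (EuclideanSpace.proj (𝕜 := ℝ) j).smulRight (EuclideanSpace.single i (1 : ℝ))

theorem inner_matCLM (M : Matrix (Fin d) (Fin d) ℝ) (ξ η : E d) :
    inner ℝ (matCLM M ξ) η = matForm M ξ η := by
  simp only [matCLM, matForm, sum_apply, smul_apply, ContinuousLinearMap.smulRight_apply, sum_inner,
    real_inner_smul_left, EuclideanSpace.inner_single_left]
  simp [mul_assoc]

theorem matForm_add_left (M : Matrix (Fin d) (Fin d) ℝ) (ξ ξ' η : E d) :
    matForm M (ξ + ξ') η = matForm M ξ η + matForm M ξ' η := by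
  simp only [← inner_matCLM, map_add, inner_add_left]

theorem matForm_add_right (M : Matrix (Fin d) (Fin d) ℝ) (ξ η η' : E d) :
    matForm M ξ (η + η') = matForm M ξ η + matForm M ξ η' := by
  simp only [← inner_matCLM, inner_add_right]

theorem matForm_smul_left (M : Matrix (Fin d) (Fin d) ℝ) (c : ℝ) (ξ η : E d) :
    matForm M (c • ξ) η = c * matForm M ξ η := by
  simp only [← inner_matCLM, map_smul, real_inner_smul_left]

theorem matForm_smul_right (M : Matrix (Fin d) (Fin d) ℝ) (c : ℝ) (ξ η : E d) :
    matForm M ξ (c • η) = c * matForm M ξ η := by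
  simp only [← inner_matCLM, real_inner_smul_right]

theorem matForm_comm {M : Matrix (Fin d) (Fin d) ℝ} (hM : ∀ i j, M i j = M j i) (ξ η : E d) :
    matForm M ξ η = matForm M η ξ := by
  rw [matForm, matForm, Finset.sum_comm]
  refine Finset.sum_congr rfl fun i _ => Finset.sum_congr rfl fun j _ => ?_
  rw [hM j i]; ring

theorem matForm_self (M : Matrix (Fin d) (Fin d) ℝ) (ξ : E d) :
    matForm M ξ ξ = ∑ i, ∑ j, M i j * ξ i * ξ j :=
  Finset.sum_congr rfl fun i _ => Finset.sum_congr rfl fun j _ => by ring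

/-- The pointwise properties of an elliptic coefficient. -/
structure IsEllipticMatrix (M : Matrix (Fin d) (Fin d) ℝ) (α β : ℝ) : Prop where
  symm : ∀ i j, M i j = M j i
  lower : ∀ ξ : E d, α * ‖ξ‖ ^ 2 ≤ matForm M ξ ξ
  upper : ∀ ξ : E d, matForm M ξ ξ ≤ β * ‖ξ‖ ^ 2

theorem MSGFEM.IsElliptic.ae_isEllipticMatrix {A : E d → Matrix (Fin d) (Fin d) ℝ} {Ω U : Set (E d)}
    {α β : ℝ} (hA : IsElliptic A Ω α β) (hU : U ⊆ Ω) :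
    ∀ᵐ x ∂(volume.restrict U), IsEllipticMatrix (A x) α β := by
  refine ae_mono (Measure.restrict_mono hU le_rfl) ?_
  filter_upwards [hA.symm, hA.lower, hA.upper] with x h1 h2 h3
  exact ⟨h1, fun ξ => by rw [matForm_self, EuclideanSpace.real_norm_sq_eq]; exact h2 ξ,
    fun ξ => by rw [matForm_self, EuclideanSpace.real_norm_sq_eq]; exact h3 ξ⟩

theorem IsEllipticMatrix.norm_matCLM_le {M : Matrix (Fin d) (Fin d) ℝ} {α β : ℝ} (hα : 0 ≤ α)
    (hβ : 0 ≤ β) (h : IsEllipticMatrix M α β) : ‖matCLM M‖ ≤ β := by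
  refine ContinuousLinearMap.opNorm_le_bound _ hβ fun ξ => ?_
  set η := matCLM M ξ with hη
  have h1 : matForm M ξ η = ‖η‖ ^ 2 := by rw [← inner_matCLM, ← hη, real_inner_self_eq_norm_sq]
  -- Cauchy–Schwarz inequality for the form of `M`
  have h2 : ∀ t : ℝ, 0 ≤ matForm M η η * (t * t) + 2 * ‖η‖ ^ 2 * t + matForm M ξ ξ := fun t => by
    have h3 := (mul_nonneg hα (sq_nonneg _)).trans (h.lower (ξ + t • η))
    simp only [matForm_add_left, matForm_add_right, matForm_smul_left, matForm_smul_right] at h3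
    rw [matForm_comm h.symm η ξ, h1] at h3
    linarith
  have h3 := discrim_le_zero h2
  have h4 : 0 ≤ matForm M ξ ξ := (mul_nonneg hα (sq_nonneg _)).trans (h.lower ξ)
  have h5 : matForm M η η * matForm M ξ ξ ≤ (β * ‖η‖ ^ 2) * (β * ‖ξ‖ ^ 2) :=
    mul_le_mul (h.upper η) (h.upper ξ) h4 (by positivity)
  rw [discrim] at h3
  rcases (norm_nonneg η).eq_or_lt with h0 | h0
  · rw [← h0]; positivity
  · have h6 : 0 < ‖η‖ ^ 2 := by positivity
    refine le_of_sq_le_sq ?_ (by positivity)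
    have h7 : ‖η‖ ^ 2 * ‖η‖ ^ 2 ≤ ‖η‖ ^ 2 * (β * ‖ξ‖) ^ 2 := by nlinarith
    exact le_of_mul_le_mul_left h7 h6

theorem MSGFEM.IsElliptic.aestronglyMeasurable_matCLM {A : E d → Matrix (Fin d) (Fin d) ℝ}
    {Ω U : Set (E d)} {α β : ℝ} (hA : IsElliptic A Ω α β) (hU : U ⊆ Ω) :
    AEStronglyMeasurable (fun x => matCLM (A x)) (volume.restrict U) :=
  Finset.aestronglyMeasurable_fun_sum _ fun i _ => Finset.aestronglyMeasurable_fun_sum _ fun j _ =>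
    ((hA.measurable i j).mono_measure (Measure.restrict_mono hU le_rfl)).smul_const _

/-- The energy form is a bounded bilinear form on `L²` pairs. -/
theorem MSGFEM.IsElliptic.exists_energyCLM {A : E d → Matrix (Fin d) (Fin d) ℝ} {Ω U : Set (E d)}
    {α β : ℝ} (hA : IsElliptic A Ω α β) (hU : U ⊆ Ω) :
    ∃ a : L2Pair U →L[ℝ] L2Pair U →L[ℝ] ℝ, ∀ u v, a u v = energyForm A u v := by
  have hL := hA.aestronglyMeasurable_matCLM hU
  have hβ : 0 ≤ β := (hA.pos.trans hA.lt).le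
  obtain ⟨T, hT⟩ := exists_multiplier (le_refl (volume.restrict U)) hL hβ
    ((hA.ae_isEllipticMatrix hU).mono fun x hx => hx.norm_matCLM_le hA.pos.le hβ)
  let q := WithLp.sndL 2 ℝ (Lp ℝ 2 (volume.restrict U)) (Lp (E d) 2 (volume.restrict U))
  refine ⟨(innerSL ℝ).bilinearComp (T ∘L q) q, fun u v => ?_⟩
  change inner ℝ (T u.snd) v.snd = _
  rw [L2.inner_def, energyForm]
  refine integral_congr_ae ?_
  filter_upwards [hT u.snd] with x hx
  rw [hx, inner_matCLM]

theorem MSGFEM.IsElliptic.integrable_matForm {A : E d → Matrix (Fin d) (Fin d) ℝ} {Ω U : Set (E d)}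
    {α β : ℝ} (hA : IsElliptic A Ω α β) (hU : U ⊆ Ω) {f g : E d → E d}
    (hf : MemLp f 2 (volume.restrict U)) (hg : MemLp g 2 (volume.restrict U)) :
    Integrable (fun x => matForm (A x) (f x) (g x)) (volume.restrict U) := by
  have hL := hA.aestronglyMeasurable_matCLM hU
  have h1 : MemLp (fun x => matCLM (A x) (f x)) 2 (volume.restrict U) := by
    refine hf.of_le_mul (c := β)
      ((ContinuousLinearMap.id ℝ (E d →L[ℝ] E d)).aestronglyMeasurable_comp₂ hL hf.1) ?_
    filter_upwards [hA.ae_isEllipticMatrix hU] with x hx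
    exact (matCLM (A x)).le_of_opNorm_le (hx.norm_matCLM_le hA.pos.le (hA.pos.trans hA.lt).le) _
  refine (integrable_congr ?_).1 (L2.integrable_inner (𝕜 := ℝ) (h1.toLp _) (hg.toLp _))
  filter_upwards [h1.coeFn_toLp, hg.coeFn_toLp] with x e1 e2
  rw [e1, e2, inner_matCLM]

theorem MSGFEM.IsElliptic.energyForm_comm {A : E d → Matrix (Fin d) (Fin d) ℝ} {Ω U : Set (E d)}
    {α β : ℝ} (hA : IsElliptic A Ω α β) (hU : U ⊆ Ω) (u v : L2Pair U) :
    energyForm A u v = energyForm A v u := by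
  refine integral_congr_ae ?_
  filter_upwards [hA.ae_isEllipticMatrix hU] with x hx
  exact matForm_comm hx.symm _ _

/-- Coercivity in the gradient. -/
theorem MSGFEM.IsElliptic.le_energyForm {A : E d → Matrix (Fin d) (Fin d) ℝ} {Ω U : Set (E d)}
    {α β : ℝ} (hA : IsElliptic A Ω α β) (hU : U ⊆ Ω) (u : L2Pair U) :
    α * ‖u.snd‖ ^ 2 ≤ energyForm A u u := by
  rw [← real_inner_self_eq_norm_sq, L2.inner_def, ← integral_const_mul]
  refine integral_mono_ae ((L2.integrable_inner u.snd u.snd).const_mul α)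
    (hA.integrable_matForm hU (Lp.memLp _) (Lp.memLp _)) ?_
  filter_upwards [hA.ae_isEllipticMatrix hU] with x hx
  simp only [real_inner_self_eq_norm_sq]
  exact hx.lower _

theorem MSGFEM.IsElliptic.isClosed_H0AD {A : E d → Matrix (Fin d) (Fin d) ℝ} {Ω U : Set (E d)}
    {α β : ℝ} (hA : IsElliptic A Ω α β) (hU : U ⊆ Ω) (ΓD : Set (E d)) :
    IsClosed (H0AD A Ω ΓD U : Set (L2Pair U)) := by
  obtain ⟨a, ha⟩ := hA.exists_energyCLM hU
  have e : (HAD A Ω ΓD U : Set (L2Pair U)) =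
      (H1 U : Set (L2Pair U)) ∩ ⋂ v ∈ H10D Ω ΓD U, {u | a u v = 0} := by
    ext u
    simp only [Set.mem_inter_iff, Set.mem_iInter, SetLike.mem_coe, Set.mem_ofPred_eq, ha]
    exact and_congr Iff.rfl (forall₂_congr fun v _ => and_iff_right
      (hA.integrable_matForm hU (Lp.memLp _) (Lp.memLp _)))
  have h1 : IsClosed (HAD A Ω ΓD U : Set (L2Pair U)) := by
    rw [e]
    refine (isClosed_H1 U).inter (isClosed_biInter fun v _ => ?_)
    exact isClosed_eq ((ContinuousLinearMap.apply ℝ ℝ v).continuous.comp a.continuous)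
      continuous_const
  exact h1.inter (isClosed_H1Zero U _)

/-! ### The cut-off identity -/

theorem gradient_sq_apply {θ : E d → ℝ} {x : E d} (h : DifferentiableAt ℝ θ x) :
    gradient (fun y => θ y ^ 2) x = (2 * θ x) • gradient θ x := by
  simp only [gradient]
  rw [fderiv_fun_pow 2 h]
  simp [map_smul]

theorem lipschitzWith_sq {θ : E d → ℝ} {K : NNReal} (hθ : LipschitzWith K θ) (h0 : ∀ x, 0 ≤ θ x)
    (h1 : ∀ x, θ x ≤ 1) : LipschitzWith (2 * K) fun x => θ x ^ 2 := by
  refine LipschitzWith.of_dist_le_mul fun x y => ?_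
  have h := hθ.dist_le_mul x y
  rw [Real.dist_eq] at h ⊢
  rw [sq_sub_sq, abs_mul, abs_of_nonneg (add_nonneg (h0 x) (h0 y))]
  push_cast
  nlinarith [h0 x, h0 y, h1 x, h1 y, abs_nonneg (θ x - θ y)]

/-- If `θ² v` and `θ² u` are admissible test functions for the `A`-harmonic functions `u` and `v`, the
terms of `a(θ u, θ v)` containing `∇u` or `∇v` cancel. -/
theorem energyForm_mul_mul {A : E d → Matrix (Fin d) (Fin d) ℝ} {Ω U V : Set (E d)} {α β : ℝ}
    (hA : IsElliptic A Ω α β) (hVΩ : V ⊆ Ω) (hUV : U ⊆ V) (hV : MeasurableSet V)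
    {θ : E d → ℝ} {K : NNReal} (hθ : LipschitzWith K θ) (hθ0 : ∀ x ∈ V \ U, θ x = 0)
    {u v u₂ v₂ : L2Pair V} {u₁ v₁ : L2Pair U}
    (hu₁ : u₁.snd =ᵐ[volume.restrict U] fun x => θ x • u.snd x + u.fst x • gradient θ x)
    (hv₁ : v₁.snd =ᵐ[volume.restrict U] fun x => θ x • v.snd x + v.fst x • gradient θ x)
    (hu₂ : u₂.snd =ᵐ[volume.restrict V] fun x =>
      θ x ^ 2 • u.snd x + u.fst x • gradient (fun y => θ y ^ 2) x)
    (hv₂ : v₂.snd =ᵐ[volume.restrict V] fun x =>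
      θ x ^ 2 • v.snd x + v.fst x • gradient (fun y => θ y ^ 2) x)
    (huv : energyForm A u v₂ = 0) (hvu : energyForm A v u₂ = 0) :
    energyForm A u₁ v₁ =
      ∫ x in U, matForm (A x) (gradient θ x) (gradient θ x) * u.fst x * v.fst x := by
  have hdiff : ∀ᵐ x ∂(volume.restrict V), DifferentiableAt ℝ θ x := ae_restrict_of_ae hθ.ae_differentiableAt
  have hle : volume.restrict U ≤ volume.restrict V := Measure.restrict_mono hUV le_rfl
  have i1 := hA.integrable_matForm hVΩ (Lp.memLp u.snd) (Lp.memLp v₂.snd)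
  have i2 := hA.integrable_matForm hVΩ (Lp.memLp v.snd) (Lp.memLp u₂.snd)
  have i3 := hA.integrable_matForm (hUV.trans hVΩ) (Lp.memLp u₁.snd) (Lp.memLp v₁.snd)
  have h0 : ∫ x in U, (matForm (A x) (u.snd x) (v₂.snd x) + matForm (A x) (v.snd x) (u₂.snd x)) = 0 := by
    have e : ∫ x in V, (matForm (A x) (u.snd x) (v₂.snd x) + matForm (A x) (v.snd x) (u₂.snd x)) = 0 := by
      rw [integral_add i1 i2]
      change energyForm A u v₂ + energyForm A v u₂ = 0
      rw [huv, hvu, add_zero]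
    rw [← e]
    symm
    refine setIntegral_eq_of_subset_of_ae_sdiff_eq_zero hV.nullMeasurableSet hUV ?_
    filter_upwards [(ae_restrict_iff' hV).1 hu₂, (ae_restrict_iff' hV).1 hv₂,
      (ae_restrict_iff' hV).1 hdiff] with x h1 h2 h3 hx
    rw [h1 hx.1, h2 hx.1, gradient_sq_apply (h3 hx.1), hθ0 x hx]
    simp only [← inner_matCLM]
    simp
  have i4 : Integrable (fun x => matForm (A x) (u.snd x) (v₂.snd x) +
      matForm (A x) (v.snd x) (u₂.snd x)) (volume.restrict U) :=
    (i1.mono_measure hle).add (i2.mono_measure hle)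
  -- Half the sum of the two equations contains `θ² A∇u·∇v` once, like `a(θ u, θ v)`.
  have h1 : energyForm A u₁ v₁ = energyForm A u₁ v₁ - 1 / 2 * ∫ x in U,
      (matForm (A x) (u.snd x) (v₂.snd x) + matForm (A x) (v.snd x) (u₂.snd x)) := by
    rw [h0, mul_zero, sub_zero]
  rw [h1, energyForm, ← integral_const_mul, ← integral_sub i3 (i4.const_mul _)]
  refine integral_congr_ae ?_
  filter_upwards [hu₁, hv₁, ae_mono hle hu₂, ae_mono hle hv₂, ae_mono hle hdiff,
    hA.ae_isEllipticMatrix (hUV.trans hVΩ)] with x e1 e2 e3 e4 e5 e6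
  rw [e1, e2, e3, e4, gradient_sq_apply e5]
  simp only [matForm_add_left, matForm_add_right, matForm_smul_left, matForm_smul_right]
  rw [matForm_comm e6.symm (v.snd x) (u.snd x), matForm_comm e6.symm (v.snd x) (gradient θ x),
    matForm_comm e6.symm (u.snd x) (gradient θ x)]
  ring

/-! ### Subspaces of prescribed dimension -/

/-- In an infinite-dimensional space every finite-dimensional subspace can be enlarged to any larger
finite dimension. -/
theorem exists_rank_eq_of_le {Y : Type*} [AddCommGroup Y] [Module ℝ Y] (hY : ¬ FiniteDimensional ℝ Y)
    {m n : ℕ} (hmn : m ≤ n) (S : Submodule ℝ Y) (hS : Module.rank ℝ S = m) :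
    ∃ Q : Submodule ℝ Y, S ≤ Q ∧ Module.rank ℝ Q = n := by
  induction n, hmn using Nat.le_induction with
  | base => exact ⟨S, le_rfl, hS⟩
  | succ n _ ih =>
    obtain ⟨Q, hSQ, hQ⟩ := ih
    have : FiniteDimensional ℝ Q := Module.finite_of_rank_eq_nat hQ
    have hne : Q ≠ ⊤ := by
      rintro rfl
      exact hY (Module.finite_def.2 ((Submodule.fg_iff_finiteDimensional _).2 this))
    obtain ⟨y, -, hy⟩ := SetLike.exists_of_lt (lt_top_iff_ne_top.2 hne)
    have hy0 : y ≠ 0 := fun h => hy (h ▸ Q.zero_mem)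
    refine ⟨Q ⊔ Submodule.span ℝ {y}, hSQ.trans le_sup_left, ?_⟩
    have hdis : Q ⊓ Submodule.span ℝ {y} = ⊥ :=
      disjoint_iff.1 ((Submodule.disjoint_span_singleton' hy0).2 hy)
    have h1 := Submodule.finrank_sup_add_finrank_inf_eq Q (Submodule.span ℝ {y})
    rw [hdis, finrank_bot, finrank_span_singleton hy0,
      Module.finrank_eq_of_rank_eq hQ, add_zero] at h1
    rw [← Module.finrank_eq_rank, h1]

/-- Smooth functions supported inside `U` vanish on `∂U` in the sense of traces; bumps with disjoint
supports are linearly independent. -/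
theorem not_finiteDimensional_H1Zero (hd : 0 < d) {U Γ : Set (E d)} (hU : IsOpen U)
    (hUb : Bornology.IsBounded U) (hne : U.Nonempty) (hΓ : MeasurableSet Γ) (hΓU : Γ ⊆ frontier U) :
    ¬ FiniteDimensional ℝ (H1Zero U Γ) := by
  intro hfin
  have : Nonempty (Fin d) := ⟨⟨0, hd⟩⟩
  obtain ⟨x₀, hx₀⟩ := hne
  have hinf : Infinite U := (infinite_of_mem_nhds x₀ (hU.mem_nhds hx₀)).to_subtype
  obtain ⟨W, hWinf, hWo, hWd⟩ := exists_seq_infinite_isOpen_pairwise_disjoint U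
  have hbump : ∀ n, ∃ (φ : E d → ℝ) (u : L2Pair U) (x : E d), IsSmoothPair φ u ∧
      tsupport φ ⊆ Subtype.val '' W n ∧ φ x = 1 ∧ u ∈ H1Zero U Γ := by
    intro n
    obtain ⟨x, hx⟩ := (hWinf n).nonempty
    have hop : IsOpen (Subtype.val '' W n : Set (E d)) := hU.isOpenMap_subtype_val _ (hWo n)
    obtain ⟨φ, h1, -, h2, -, h3⟩ := exists_contDiff_tsupport_subset (n := (⊤ : ℕ∞))
      (hop.mem_nhds ⟨x, hx, rfl⟩)
    obtain ⟨u, hu⟩ := exists_isSmoothPair hU.measurableSet hUb h2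
    refine ⟨φ, u, x, hu, h1, h3, HasZeroTrace.mem_H1Zero hU.measurableSet hUb
      ⟨fun _ => φ, fun _ => h2, ?_, ?_, ?_⟩⟩
    · have e : eLpNorm (fun y => φ y - u.fst y) 2 (volume.restrict U) = 0 := by
        rw [eLpNorm_congr_ae (g := 0) (by filter_upwards [hu.fst] with y hy; simp [hy]), eLpNorm_zero]
      exact tendsto_const_nhds.congr fun _ => e.symm
    · have e : eLpNorm (fun y => gradient φ y - u.snd y) 2 (volume.restrict U) = 0 := by
        rw [eLpNorm_congr_ae (g := 0) (by filter_upwards [hu.snd] with y hy; simp [hy]), eLpNorm_zero]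
      exact tendsto_const_nhds.congr fun _ => e.symm
    · have e : eLpNorm φ 2 ((Measure.hausdorffMeasure ((d : ℝ) - 1)).restrict Γ) = 0 := by
        rw [eLpNorm_congr_ae (g := 0) (ae_restrict_of_forall_mem hΓ fun y hy => ?_), eLpNorm_zero]
        refine image_eq_zero_of_notMem_tsupport fun hy' => ?_
        obtain ⟨z, -, rfl⟩ := h1 hy'
        exact (hU.frontier_eq ▸ hΓU hy).2 z.2
      exact tendsto_const_nhds.congr fun _ => e.symm
  choose φ u x hu hsupp hφx hmem using hbump
  let p : H1Zero U Γ →ₗ[ℝ] Lp ℝ 2 (volume.restrict U) :=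
    (WithLp.fstₗ 2 ℝ (Lp ℝ 2 (volume.restrict U)) (Lp (E d) 2 (volume.restrict U))) ∘ₗ
      (H1Zero U Γ).subtype
  have hli : LinearIndependent ℝ (p ∘ fun n => (⟨u n, hmem n⟩ : H1Zero U Γ)) := by
    refine linearIndependent_of_ne_zero_of_inner_eq_zero (fun n h0 => ?_) fun m n hmn => ?_
    · change (u n).fst = 0 at h0
      have h1 : φ n =ᵐ[volume.restrict U] 0 := by
        refine (hu n).fst.symm.trans ?_
        rw [h0]
        exact Lp.coeFn_zero _ _ _
      have hop : IsOpen {y | φ n y ≠ 0} := isOpen_ne_fun (hu n).smooth.continuous continuous_const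
      have h2 := (hop.measure_pos volume ⟨x n, by simp [hφx n]⟩)
      have h3 : {y | φ n y ≠ 0} ⊆ U := fun y hy => by
        obtain ⟨z, -, rfl⟩ := hsupp n (subset_tsupport _ hy)
        exact z.2
      have h4 := (ae_restrict_iff' hU.measurableSet).1 h1
      refine h2.ne' (measure_mono_null (fun y hy => ?_) h4)
      exact fun h => hy (h (h3 hy))
    · change inner ℝ (u m).fst (u n).fst = 0
      rw [L2.inner_def]
      refine integral_eq_zero_of_ae ?_
      filter_upwards [(hu m).fst, (hu n).fst] with y h1 h2
      rw [h1, h2, Pi.zero_apply]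
      by_cases hm : y ∈ tsupport (φ m)
      · have hn : y ∉ tsupport (φ n) := fun hn => by
          obtain ⟨z, hz, rfl⟩ := hsupp m hm
          obtain ⟨z', hz', e⟩ := hsupp n hn
          rw [Subtype.val_injective e] at hz'
          exact Set.disjoint_left.1 (hWd hmn) hz hz'
        simp [image_eq_zero_of_notMem_tsupport hn]
      · simp [image_eq_zero_of_notMem_tsupport hm]
  have := hli.of_comp
  have := this.finite
  exact not_finite ℕ

/-! ### Widths -/

section Width

variable {A : E d → Matrix (Fin d) (Fin d) ℝ} {U V : Set (E d)}
  {X : Submodule ℝ (L2Pair V)} {Y : Submodule ℝ (L2Pair U)} {P : X →L[ℝ] Y}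

theorem deviation_le {Q : Submodule ℝ Y} {t : ℝ} (ht : 0 ≤ t)
    (h : ∀ u : X, ∃ q ∈ Q, energyForm A ((P u - q : Y) : L2Pair U) ((P u - q : Y) : L2Pair U) ≤
      t * energyForm A (u : L2Pair V) u) : deviation A P Q ≤ ENNReal.ofReal (√t) := by
  refine iSup₂_le fun u hu => ?_
  obtain ⟨q, hq, hle⟩ := h u
  refine (iInf₂_le q hq).trans (ENNReal.div_le_of_le_mul ?_)
  rw [← ENNReal.ofReal_mul (Real.sqrt_nonneg _)]
  refine ENNReal.ofReal_le_ofReal ?_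
  rw [energyNorm, energyNorm, ← Real.sqrt_mul ht]
  exact Real.sqrt_le_sqrt hle

theorem le_deviation {Q : Submodule ℝ Y} {t : ℝ} (ht : 0 ≤ t)
    (hpos : ∀ u : X, u ≠ 0 → 0 < energyForm A (u : L2Pair V) u)
    (h : ∃ u : X, u ≠ 0 ∧ ∀ q ∈ Q, t * energyForm A (u : L2Pair V) u ≤
      energyForm A ((P u - q : Y) : L2Pair U) ((P u - q : Y) : L2Pair U)) :
    ENNReal.ofReal (√t) ≤ deviation A P Q := by
  obtain ⟨u, hu, hle⟩ := h
  refine le_iSup₂_of_le u hu (le_iInf₂ fun q hq => ?_)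
  have hp : 0 < energyNorm A (u : L2Pair V) := Real.sqrt_pos.2 (hpos u hu)
  rw [ENNReal.le_div_iff_mul_le (Or.inl (by simpa using hp)) (Or.inl ENNReal.ofReal_ne_top),
    ← ENNReal.ofReal_mul (Real.sqrt_nonneg _)]
  refine ENNReal.ofReal_le_ofReal ?_
  rw [energyNorm, energyNorm, ← Real.sqrt_mul ht]
  exact Real.sqrt_le_sqrt (hle q hq)

theorem nWidth_le {n : ℕ} {Q : Submodule ℝ Y} (hQ : Module.rank ℝ Q = n) :
    nWidth A P n ≤ deviation A P Q :=
  iInf₂_le (f := fun (Q : Submodule ℝ Y) (_ : Module.rank ℝ Q = n) => deviation A P Q) Q hQ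

theorem le_nWidth {n : ℕ} {r : ℝ≥0∞}
    (h : ∀ Q : Submodule ℝ Y, Module.rank ℝ Q = n → r ≤ deviation A P Q) : r ≤ nWidth A P n :=
  le_iInf₂ h

set_option maxHeartbeats 800000 in
/-- The widths of `P` are read off from any full list of eigenvalues. -/
theorem FormPair.EigenList.nWidth_eq [CompleteSpace X] {a : X →L[ℝ] X →L[ℝ] ℝ}
    {c : Y →L[ℝ] Y →L[ℝ] ℝ} (hFP : FormPair P a c)
    (ha : ∀ u v, a u v = energyForm A (u : L2Pair V) (v : L2Pair V))
    (hc : ∀ u v, c u v = energyForm A (u : L2Pair U) (v : L2Pair U))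
    (hY : ¬ FiniteDimensional ℝ Y) {N : ℕ∞} {lam : ℕ → ℝ} {v : ℕ → X}
    (hl : FormPair.EigenList P a c N lam v) (n : ℕ) :
    ((n : ℕ∞) < N → nWidth A P n = ENNReal.ofReal (lam n ^ (-(1 / 2) : ℝ))) ∧
    (N ≤ (n : ℕ∞) → nWidth A P n = 0) ∧
    ((n : ℕ∞) ≤ N →
      Module.rank ℝ (Submodule.span ℝ (Set.range fun k : Fin n => P (v k))) = n ∧
      deviation A P (Submodule.span ℝ (Set.range fun k : Fin n => P (v k))) = nWidth A P n) := by
  have hposX : ∀ u : X, u ≠ 0 → 0 < energyForm A (u : L2Pair V) u := fun u hu => by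
    rw [← ha]; exact hFP.pos hu
  have hlam : (n : ℕ∞) < N → 0 < lam n := fun hn => (hl.eigen n hn).pos hFP
  have hval : (n : ℕ∞) < N → lam n ^ (-(1 / 2) : ℝ) = √((lam n)⁻¹) := fun hn => by
    rw [Real.sqrt_eq_rpow, Real.inv_rpow (hlam hn).le, ← Real.rpow_neg
      (hlam hn).le]
  have hlow : (n : ℕ∞) < N → ENNReal.ofReal (lam n ^ (-(1 / 2) : ℝ)) ≤ nWidth A P n := fun hn => by
    rw [hval hn]
    refine le_nWidth fun Q hQ => le_deviation (inv_nonneg.2 (hlam hn).le) hposX ?_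
    obtain ⟨u, hu, h⟩ := hl.exists_lower hFP hn Q hQ
    exact ⟨u, hu, fun q hq => by rw [← ha, ← hc]; exact h q hq⟩
  have hup : (n : ℕ∞) < N → deviation A P (Submodule.span ℝ (Set.range fun k : Fin n => P (v k))) ≤
      ENNReal.ofReal (lam n ^ (-(1 / 2) : ℝ)) := fun hn => by
    rw [hval hn]
    refine deviation_le (inv_nonneg.2 (hlam hn).le) fun u => ?_
    obtain ⟨q, hq, h, -⟩ := hl.exists_upper hFP hn.le u
    exact ⟨q, hq, by rw [← ha, ← hc]; exact h hn⟩
  -- once the list has ended, its span is exact, and so is every larger space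
  have hzero : ∀ m : ℕ, N = m → ∀ Q : Submodule ℝ Y,
      Submodule.span ℝ (Set.range fun k : Fin m => P (v k)) ≤ Q → deviation A P Q = 0 := by
    intro m hm Q hQ
    have h0 : deviation A P Q ≤ ENNReal.ofReal (√0) := by
      refine deviation_le le_rfl fun u => ?_
      obtain ⟨q, hq, -, h⟩ := hl.exists_upper hFP hm.ge u
      refine ⟨q, hQ hq, ?_⟩
      rw [zero_mul, ← hc]
      exact h hm.le
    simpa using h0
  have hw0 : N ≤ (n : ℕ∞) → nWidth A P n = 0 := fun hn => by
    obtain ⟨m, rfl⟩ := ENat.ne_top_iff_exists.1 (hn.trans_lt (ENat.natCast_lt_top n)).ne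
    obtain ⟨Q, hSQ, hQ⟩ := exists_rank_eq_of_le hY (Nat.cast_le.1 hn) _
      (hl.rank_span_image hFP le_rfl)
    refine le_antisymm ?_ zero_le
    exact (nWidth_le hQ).trans (hzero m rfl Q hSQ).le
  have hrank := fun hn : (n : ℕ∞) ≤ N => hl.rank_span_image hFP hn
  refine ⟨fun hn => le_antisymm ((nWidth_le (hrank hn.le)).trans (hup hn)) (hlow hn), hw0,
    fun hn => ⟨hrank hn, le_antisymm ?_ (nWidth_le (hrank hn))⟩⟩
  rcases hn.lt_or_eq with hlt | heq
  · exact (hup hlt).trans (hlow hlt)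
  · rw [hzero n heq.symm _ le_rfl]
    exact zero_le

end Width


/-! ### The cut-off operator on harmonic functions -/

/-- Caccioppoli's inequality: the cut-off of an `A`-harmonic function is bounded in `H¹` by the `L²` norm
of the function. -/
theorem norm_sq_le_of_cutoff {A : E d → Matrix (Fin d) (Fin d) ℝ} {Ω U V : Set (E d)} {α β : ℝ}
    (hA : IsElliptic A Ω α β) (hUV : U ⊆ V) (hVΩ : V ⊆ Ω) {θ : E d → ℝ} {K : NNReal}
    (hθ : LipschitzWith K θ) (hθ1 : ∀ x, ‖θ x‖ ≤ 1) {u : L2Pair V} {w : L2Pair U}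
    (hw : w.fst =ᵐ[volume.restrict U] fun x => θ x * u.fst x)
    (h : energyForm A w w =
      ∫ x in U, matForm (A x) (gradient θ x) (gradient θ x) * u.fst x * u.fst x) :
    ‖w‖ ^ 2 ≤ (1 + β * K ^ 2 / α) * ‖u.fst‖ ^ 2 := by
  have hle : volume.restrict U ≤ volume.restrict V := Measure.restrict_mono hUV le_rfl
  have hα := hA.pos
  have hβ : 0 ≤ β := (hA.pos.trans hA.lt).le
  have h1 : ‖w.fst‖ ≤ ‖u.fst‖ := by
    rw [Lp.norm_def, Lp.norm_def, eLpNorm_congr_ae hw]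
    refine ENNReal.toReal_mono (Lp.eLpNorm_ne_top _) ?_
    refine (eLpNorm_mono fun x => ?_).trans (eLpNorm_mono_measure _ hle)
    rw [norm_mul]
    exact mul_le_of_le_one_left (norm_nonneg _) (hθ1 x)
  have hi : Integrable (fun x => u.fst x * u.fst x) (volume.restrict V) :=
    L2.integrable_inner (𝕜 := ℝ) u.fst u.fst
  have h2 : energyForm A w w ≤ β * K ^ 2 * ‖u.fst‖ ^ 2 := by
    calc energyForm A w w ≤ ∫ x in U, β * K ^ 2 * (u.fst x * u.fst x) := by
          rw [h]
          refine integral_mono_of_nonneg ?_ ((hi.mono_measure hle).const_mul _) ?_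
          · filter_upwards [hA.ae_isEllipticMatrix (hUV.trans hVΩ)] with x hx
            rw [Pi.zero_apply, mul_assoc]
            exact mul_nonneg ((mul_nonneg hα.le (sq_nonneg _)).trans (hx.lower _))
              (mul_self_nonneg _)
          · filter_upwards [hA.ae_isEllipticMatrix (hUV.trans hVΩ)] with x hx
            rw [mul_assoc]
            refine mul_le_mul_of_nonneg_right ((hx.upper _).trans ?_) (mul_self_nonneg _)
            gcongr
            exact norm_gradient_le_of_lipschitz hθ x
      _ = β * K ^ 2 * ∫ x in U, u.fst x * u.fst x := integral_const_mul _ _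
      _ ≤ β * K ^ 2 * ∫ x in V, u.fst x * u.fst x := by
          refine mul_le_mul_of_nonneg_left ?_ (by positivity)
          exact integral_mono_measure hle (ae_of_all _ fun x => mul_self_nonneg _) hi
      _ = β * K ^ 2 * ‖u.fst‖ ^ 2 := by
          rw [← real_inner_self_eq_norm_sq, L2.inner_def]; rfl
  have h3 := (hA.le_energyForm (hUV.trans hVΩ) w).trans h2
  have h4 : ‖w.snd‖ ^ 2 ≤ β * K ^ 2 / α * ‖u.fst‖ ^ 2 := by
    rw [div_mul_eq_mul_div, le_div_iff₀ hα]; linarith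
  have h5 : ‖w.fst‖ ^ 2 ≤ ‖u.fst‖ ^ 2 := by gcongr
  rw [WithLp.prod_norm_sq_eq_of_L2]
  linarith

/-- Multiplication by `χ`, as an operator bounded by the `L²` norm on the `A`-harmonic functions. -/
theorem exists_cutoff_operator {Ω ΓD ω ωs : Set (E d)}
    (hΩ : IsLipschitzDomain Ω)
    (hΓD : ΓD ⊆ frontier Ω) (hΓDm : MeasurableSet ΓD)
    (hωs : IsLipschitzDomain ωs)
    (hωo : IsOpen ω) (hωL : HasLipschitzBoundary ω)
    (hωωs : ω ⊆ ωs) (hωsΩ : ωs ⊆ Ω)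
    {A : E d → Matrix (Fin d) (Fin d) ℝ} {α β : ℝ} (hA : IsElliptic A Ω α β)
    {χ : E d → ℝ} (hχ : IsPartitionFunction χ ω Ω) :
    ∃ (P : H0AD A Ω ΓD ωs →L[ℝ] H10D Ω ΓD ω) (D : ℝ), 0 < D ∧
      (∀ u, (P u : L2Pair ω).fst =ᵐ[volume.restrict ω]
        fun x => χ x * (u : L2Pair ωs).fst x) ∧
      (∀ u v : H0AD A Ω ΓD ωs,
        energyForm A (P u : L2Pair ω) (P v : L2Pair ω) =
          ∫ x in ω, matForm (A x) (gradient χ x) (gradient χ x) *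
            (u : L2Pair ωs).fst x * (v : L2Pair ωs).fst x) ∧
      ∀ u, ‖P u‖ ^ 2 ≤ D * ‖(u : L2Pair ωs).fst‖ ^ 2 := by
  have hα := hA.pos
  have hωb : Bornology.IsBounded ω := hωs.isBounded.subset hωωs
  have hωΩ : ω ⊆ Ω := hωωs.trans hωsΩ
  have hωm : MeasurableSet ω := hωo.measurableSet
  have hωsm : MeasurableSet ωs := hωs.isOpen.measurableSet
  have hmeas : ∀ U : Set (E d), MeasurableSet ((frontier U ∩ Ω) ∪ (frontier U ∩ ΓD)) := fun U =>
    (isClosed_frontier.measurableSet.inter hΩ.isOpen.measurableSet).union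
      (isClosed_frontier.measurableSet.inter hΓDm)
  have hΓsm : MeasurableSet (frontier ωs ∩ ΓD) := isClosed_frontier.measurableSet.inter hΓDm
  have hfr : ∀ U : Set (E d), (frontier U ∩ Ω) ∪ (frontier U ∩ ΓD) ⊆ frontier U := fun U =>
    Set.union_subset Set.inter_subset_left Set.inter_subset_left
  have hfin : ∀ U : Set (E d), IsOpen U → Bornology.IsBounded U → HasLipschitzBoundary U →
      Measure.hausdorffMeasure ((d : ℝ) - 1) ((frontier U ∩ Ω) ∪ (frontier U ∩ ΓD)) ≠ ∞ :=
    fun U h1 h2 h3 =>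
      ((measure_mono (hfr U)).trans_lt (h3.hausdorffMeasure_frontier_lt_top h1 h2)).ne
  obtain ⟨K, θ, hθ, hθ0, hθ1, hθχ⟩ := hχ.exists_extension hωo hΩ
  have hθn : ∀ x, ‖θ x‖ ≤ 1 := fun x => by rw [Real.norm_of_nonneg (hθ0 x)]; exact hθ1 x
  have hθz : ∀ x ∈ Ω, x ∉ ω → θ x = 0 := fun x hx hxω => by
    rw [hθχ hx]; exact hχ.eq_zero x ⟨hx, hxω⟩
  have hgrad : ∀ x ∈ ω, gradient θ x = gradient χ x := fun x hx => by
    have h1 : θ =ᶠ[𝓝 x] χ := hθχ.eventuallyEq_of_mem (hΩ.isOpen.mem_nhds (hωΩ hx))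
    rw [gradient, gradient, h1.fderiv_eq]
  have hθ2 := lipschitzWith_sq hθ hθ0 hθ1
  have hθ2n : ∀ x, ‖θ x ^ 2‖ ≤ 1 := fun x => by
    rw [norm_pow]; exact pow_le_one₀ (norm_nonneg _) (hθn x)
  -- multiplication by `θ` vanishes on `∂U` inside `Ω`, and preserves the Dirichlet condition
  have hcase : ∀ U : Set (E d), IsOpen U → ω ⊆ U → U ⊆ ωs →
      ∀ x ∈ (frontier U ∩ Ω) ∪ (frontier U ∩ ΓD), θ x = 0 ∨ x ∈ frontier ωs ∩ ΓD := by
    rintro U hU hωU hUωs x (⟨hxf, hxΩ⟩ | ⟨hxf, hxD⟩)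
    · rw [hU.frontier_eq] at hxf
      exact Or.inl (hθz x hxΩ fun h => hxf.2 (hωU h))
    · refine Or.inr ⟨?_, hxD⟩
      rw [hωs.isOpen.frontier_eq]
      have h1 := hΓD hxD
      rw [hΩ.isOpen.frontier_eq] at h1
      exact ⟨closure_mono hUωs (frontier_subset_closure hxf), fun h => h1.2 (hωsΩ h)⟩
  obtain ⟨M, hM⟩ := exists_mulPair hθ hθn hωωs
  obtain ⟨M₂, hM₂⟩ := exists_mulPair hθ2 hθ2n (subset_refl ωs)
  have hMmem : ∀ u ∈ H0AD A Ω ΓD ωs, M u ∈ H10D Ω ΓD ω := fun u hu =>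
    HasZeroTrace.mem_H1Zero hωm hωb (HasZeroTrace.mul hθ hθn hωm hωωs hωb (hmeas ω) hΓsm
      ((hfr ω).trans frontier_subset_closure) (hfin ω hωo hωb hωL) (hcase ω hωo subset_rfl hωωs)
      hu.2.2 (hM u).1 (hM u).2)
  have hM₂mem : ∀ u ∈ H0AD A Ω ΓD ωs, M₂ u ∈ H10D Ω ΓD ωs := fun u hu =>
    HasZeroTrace.mem_H1Zero hωsm hωs.isBounded (HasZeroTrace.mul hθ2 hθ2n hωsm subset_rfl
      hωs.isBounded (hmeas ωs) hΓsm ((hfr ωs).trans frontier_subset_closure)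
      (hfin ωs hωs.isOpen hωs.isBounded hωs.lipschitz)
      (fun x hx => (hcase ωs hωs.isOpen hωωs subset_rfl x hx).imp_left fun h => by simp [h])
      hu.2.2 (hM₂ u).1 (hM₂ u).2)
  have hid : ∀ u ∈ H0AD A Ω ΓD ωs, ∀ v ∈ H0AD A Ω ΓD ωs, energyForm A (M u) (M v) =
      ∫ x in ω, matForm (A x) (gradient θ x) (gradient θ x) * u.fst x * v.fst x := fun u hu v hv =>
    energyForm_mul_mul hA hωsΩ hωωs hωsm hθ (fun x hx => hθz x (hωsΩ hx.1) hx.2) (hM u).2 (hM v).2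
      (hM₂ u).2 (hM₂ v).2 (hu.1.2 _ (hM₂mem v hv)).2 (hv.1.2 _ (hM₂mem u hu)).2
  let P : H0AD A Ω ΓD ωs →L[ℝ] H10D Ω ΓD ω :=
    (M ∘L (H0AD A Ω ΓD ωs).subtypeL).codRestrict (H10D Ω ΓD ω) fun u => hMmem u u.2
  have hβ : 0 ≤ β := (hA.pos.trans hA.lt).le
  refine ⟨P, 1 + β * K ^ 2 / α, by positivity, fun u => ?_, fun u v => ?_, fun u =>
    norm_sq_le_of_cutoff hA hωωs hωsΩ hθ hθn (hM u).1 (hid u u.2 u u.2)⟩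
  · filter_upwards [(hM u).1, ae_restrict_mem hωm] with x hx hxω
    rw [← hθχ (hωΩ hxω)]
    exact hx
  · refine (hid u u.2 v v.2).trans (setIntegral_congr_fun hωm fun x hx => ?_)
    simp only [hgrad x hx]

end

set_option maxHeartbeats 2000000 in
theorem theorem3p10 {d : ℕ} (hd : d = 2 ∨ d = 3) (Ω ΓD ω ωs : Set (E d))
    (hΩ : IsLipschitzDomain Ω)
    (hΓD : ΓD ⊆ frontier Ω) (hΓDm : MeasurableSet ΓD)
    (hωs : IsLipschitzDomain ωs)
    (hωo : IsOpen ω) (hωne : ω.Nonempty) (hωL : HasLipschitzBoundary ω)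
    (hωωs : ω ⊆ ωs) (hωsΩ : ωs ⊆ Ω)
    (hpos : 0 < Measure.hausdorffMeasure ((d : ℝ) - 1) (frontier ωs ∩ ΓD))
    (A : E d → Matrix (Fin d) (Fin d) ℝ) (α β : ℝ) (hA : IsElliptic A Ω α β)
    (χ : E d → ℝ) (hχ : IsPartitionFunction χ ω Ω) :
    ∃ P : H0AD A Ω ΓD ωs →L[ℝ] H10D Ω ΓD ω,
      -- `P u = χ u` on `ω`
      (∀ u, (P u : L2Pair ω).fst =ᵐ[volume.restrict ω]
        fun x => χ x * (u : L2Pair ωs).fst x) ∧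
      -- `P` is compact, and the energy norm is equivalent to the `H¹` norm on its domain
      IsCompactOperator P ∧
      (∃ C : ℝ, ∀ u : H0AD A Ω ΓD ωs, ‖u‖ ≤ C * energyNorm A (u : L2Pair ωs)) ∧
      -- the second form of the right-hand side of the eigenproblem
      (∀ u v : H0AD A Ω ΓD ωs,
        energyForm A (P u : L2Pair ω) (P v : L2Pair ω) =
          ∫ x in ω, matForm (A x) (gradient χ x) (gradient χ x) *
            (u : L2Pair ωs).fst x * (v : L2Pair ωs).fst x) ∧
      -- all eigenvalues are positive, and they can be listed in increasing order
      (∀ (t : ℝ) (v : H0AD A Ω ΓD ωs), IsEigenpair A P t v → 0 < t) ∧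
      (∃ (N : ℕ∞) (lam : ℕ → ℝ) (v : ℕ → H0AD A Ω ΓD ωs), IsEigenSystem A P N lam v) ∧
      -- for every such list: the `n`-width and the optimal space
      (∀ (N : ℕ∞) (lam : ℕ → ℝ) (v : ℕ → H0AD A Ω ΓD ωs), IsEigenSystem A P N lam v →
        ∀ n : ℕ,
          ((n : ℕ∞) < N → nWidth A P n = ENNReal.ofReal (lam n ^ (-(1 / 2) : ℝ))) ∧
          (N ≤ (n : ℕ∞) → nWidth A P n = 0) ∧
          ((n : ℕ∞) ≤ N →
            Module.rank ℝ (Submodule.span ℝ (Set.range fun k : Fin n => P (v k))) = n ∧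
            deviation A P (Submodule.span ℝ (Set.range fun k : Fin n => P (v k))) =
              nWidth A P n)) := by
  have hα := hA.pos
  have hωb : Bornology.IsBounded ω := hωs.isBounded.subset hωωs
  have hωΩ : ω ⊆ Ω := hωωs.trans hωsΩ
  have hωsm : MeasurableSet ωs := hωs.isOpen.measurableSet
  have hΓsm : MeasurableSet (frontier ωs ∩ ΓD) := isClosed_frontier.measurableSet.inter hΓDm
  have hY : ¬ FiniteDimensional ℝ (H10D Ω ΓD ω) :=
    not_finiteDimensional_H1Zero (by omega) hωo hωb hωne
      ((isClosed_frontier.measurableSet.inter hΩ.isOpen.measurableSet).union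
        (isClosed_frontier.measurableSet.inter hΓDm))
      (Set.union_subset Set.inter_subset_left Set.inter_subset_left)
  obtain ⟨P, D, hD, hPχ, hPid, hPD⟩ :=
    exists_cutoff_operator hΩ hΓD hΓDm hωs hωo hωL hωωs hωsΩ hA hχ
  have hcX : CompleteSpace (H0AD A Ω ΓD ωs) :=
    (hA.isClosed_H0AD hωsΩ ΓD).isComplete.completeSpace_coe
  have hcY : CompleteSpace (H10D Ω ΓD ω) := (isClosed_H1Zero ω _).isComplete.completeSpace_coe
  obtain ⟨C, hC⟩ := (hωs.isControlled hΓsm Set.inter_subset_left hpos.ne').norm_fst_le hωsm hωs.isBounded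
  -- Friedrichs' inequality, as coercivity of the energy form
  have hcoer : ∀ u : H0AD A Ω ΓD ωs,
      ‖u‖ ^ 2 ≤ (C + 1) / α * energyForm A (u : L2Pair ωs) (u : L2Pair ωs) := fun u => by
    have h1 := hC u u.2.2.2
    have h2 := hA.le_energyForm hωsΩ (u : L2Pair ωs)
    rw [Submodule.coe_norm, WithLp.prod_norm_sq_eq_of_L2]
    rw [div_mul_eq_mul_div, le_div_iff₀ hα]
    have hC0 : (0 : ℝ) ≤ C := C.2
    nlinarith [sq_nonneg ‖(u : L2Pair ωs).snd‖]
  have hcompact : IsCompactOperator P := by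
    refine isCompactOperator_of_approx P fun η hη => ?_
    lift D to NNReal using hD.le
    have hD0 : 0 < D := by exact_mod_cast hD
    have hD1 : (0 : ℝ) < D := hD
    obtain ⟨S, T, C', hT⟩ := (hasFiniteApprox_univ hωs.isOpen hωs.isBounded
      (hωs.lipschitz.hasConeProperty hωs.isOpen)).exists_clm hωsm hωs.isBounded (div_pos hη hD0)
    refine ⟨S, inferInstance, T ∘L (H0AD A Ω ΓD ωs).subtypeL, D * C', fun u => ?_⟩
    have h2 := hT u _ u.2.2.2
    have h3 : ‖(u : L2Pair ωs).snd‖ ≤ ‖u‖ := WithLp.norm_snd_le _ (u : L2Pair ωs)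
    have h4 : ‖(u : L2Pair ωs).snd‖ ^ 2 ≤ ‖u‖ ^ 2 := by gcongr
    calc ‖P u‖ ^ 2 ≤ D * (η / D * ‖u‖ ^ 2 + C' * ‖T u‖ ^ 2) := by
          refine (hPD u).trans ?_
          gcongr
          refine h2.trans ?_
          push_cast
          gcongr
      _ = _ := by
          push_cast
          field_simp
          rfl
  obtain ⟨a, ha⟩ := hA.exists_energyCLM hωsΩ
  obtain ⟨c, hc⟩ := hA.exists_energyCLM hωΩ
  let a' := a.bilinearComp (H0AD A Ω ΓD ωs).subtypeL (H0AD A Ω ΓD ωs).subtypeL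
  let c' := c.bilinearComp (H10D Ω ΓD ω).subtypeL (H10D Ω ΓD ω).subtypeL
  have ha' : ∀ u v, a' u v = energyForm A (u : L2Pair ωs) (v : L2Pair ωs) := fun u v => ha _ _
  have hc' : ∀ u v, c' u v = energyForm A (u : L2Pair ω) (v : L2Pair ω) := fun u v => hc _ _
  have hFP : FormPair P a' c' :=
    { symm := fun u v => by rw [ha', ha', hA.energyForm_comm hωsΩ]
      coercive := ⟨α / (C + 1), by positivity, fun u => by
        have h1 := hcoer u
        rw [div_mul_eq_mul_div, div_le_iff₀ (by positivity), ha']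
        rw [div_mul_eq_mul_div, le_div_iff₀ hα] at h1
        linarith⟩
      symm' := fun u v => by rw [hc', hc', hA.energyForm_comm hωΩ]
      nonneg := fun u => by
        rw [hc']
        exact (mul_nonneg hα.le (sq_nonneg _)).trans (hA.le_energyForm hωΩ _)
      compact := hcompact }
  have heig : ∀ t v, IsEigenpair A P t v ↔ FormPair.IsEigen P a' c' t v := fun t v => by
    simp only [IsEigenpair, FormPair.IsEigen, ha', hc']
  refine ⟨P, hPχ, hcompact, ⟨√((C + 1) / α), fun u => ?_⟩, hPid,
    fun t v hv => ((heig t v).1 hv).pos hFP, ?_, fun N lam v hs => ?_⟩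
  · rw [energyNorm, ← Real.sqrt_mul (by positivity)]
    exact Real.le_sqrt_of_sq_le (hcoer u)
  · obtain ⟨N, lam, v, h⟩ := FormPair.EigenList.exists_eigenList hFP
    exact ⟨N, lam, v, fun k hk => (heig _ _).2 (h.eigen k hk), h.mono, h.independent,
      fun t w hw => h.complete t w ((heig t w).1 hw)⟩
  · have hl : FormPair.EigenList P a' c' N lam v :=
      ⟨fun k hk => (heig _ _).1 (hs.eigenpair k hk), hs.mono, hs.independent,
        fun t w hw => hs.complete t w ((heig t w).2 hw)⟩
    exact hl.nWidth_eq hFP ha' hc' hY
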